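/- **Conventions.** Let $\Lambda\subset\mathbb R^n$ be an $n$-dimensional lattice. $\mathcal V(\Lambda)$ is its fundamental Voronoi region (the points for which $0$ is the closest lattice point), $\mathrm{vol}(\Lambda)$ is the volume of $\mathcal V(\Lambda)$, $r_{\rm pack}(\Lambda)$ is the radius of the largest open ball contained in $\mathcal V(\Lambda)$, $r_{\rm eff}(\Lambda)$ is the radius of an $n$-ball of volume $\mathrm{vol}(\Lambda)$, $$G(\Lambda)=\frac{1}{n\,\mathrm{vol}(\Lambda)^{1+2/n}}\int_{\mathcal V(\Lambda)}\|y\|^2\,dy ,$$ and $\Lambda^*=\{y: x^{T}y\in\mathbb Z\ \ \forall x\in\Lambda\}$ is the dual lattice. Limits are taken as $n\to\infty$ inside a fixed infinite set $I$ of positive integers. *Semi norm-ergodic noise.* Random vectors $z^{(n)}\in\mathbb R^n$ with $\frac1n\mathbb E\|z^{(n)}\|^2=\sigma_n^2$ are semi norm-ergodic if for every $\delta>0$, $\Pr[\|z^{(n)}\|>\sqrt{(1+\delta)n\sigma_n^2}]\to0$. *Goodness.* A sequence of lattices $\Lambda^{(n)}$ is - good for packing if $r_{\rm pack}(\Lambda^{(n)})/r_{\rm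 eff}(\Lambda^{(n)})\ge\frac12-o(1)$; - good for MSE quantization if $G(\Lambda^{(n)})\to\frac1{2\pi e}$; - good for coding in presence of semi norm-ergodic noise if for every semi norm-ergodic noise $(z^{(n)})$ with constant second moment per dimension $\sigma^2$ such that $\mathrm{vol}(\Lambda^{(n)})^{2/n}>2\pi e\sigma^2$ for all large $n$, $\Pr[z^{(n)}\notin\mathcal V(\Lambda^{(n)})]\to0$, however ties in the definition of $\mathcal V$ are broken; - good for coding against a given semi norm-ergodic noise $(z^{(n)})$ with second moments per dimension $\sigma_n^2$ (possibly varying with $n$) if either there is no $\eta>0$ with $\mathrm{vol}(\Lambda^{(n)})^{2/n}\ge(1+\eta)2\pi e\sigma_n^2$ for all large $n$, or $\Pr[z^{(n)}\notin\mathcal V(\Lambda^{(n)})]\to0$, however ties are broken. *Graphs.* Let $0<\Delta_V<\Delta_C$ be integers and $R=1-\Delta_V/\Delta_C$. For $n\in I$, let $\mathcal G^{(n)}$ be a $(\Delta_V,\Delta_C)$-regular bipartite graph without multiple edges, with a set $V$ of $n$ variable nodes and a set $C$ of $n\Delta_V/\Delta_C=n(1-R)$ check nodes. Let $A,\alpha,B,\beta$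 be real numbers with $1\le\alpha<A$ and $\frac1{1-R}<\beta<\min\{\frac2{1-R},B\}$. The graph is $(\alpha,A,\beta,B,\epsilon,\vartheta)$-good if, with $N(\cdot)$ denoting neighbourhoods, - (L1) $|N(S)|\ge A|S|$ for all $S\subset V$ with $|S|\le\lceil\epsilon n\rceil$; - (L2) $|N(S)|\ge \alpha|S|$ for all $S\subset V$ with $|S|\le\lceil\frac{n(1-R)}{2\alpha}\rceil$; - (R1) $|N(T)|\ge B|T|$ for all $T\subset C$ with $|T|\le\vartheta n(1-R)$; - (R2) $|N(T)|\ge \beta|T|$ for all $T\subset C$ with $|T|\le\frac{n(1-R)}2$. *LDA ensemble.* Let $\lambda>0$ and let $p$ be the smallest prime with $p\ge n^\lambda$. A random lattice from the $(\mathcal G^{(n)},\lambda)$ LDA ensemble is $$\Lambda=\{x\in\mathbb Z^n: Hx\equiv0 \bmod p\},$$ where $H$ is the $n(1-R)\times n$ matrix over $\mathbb F_p$ whose entries at the edges of $\mathcal G^{(n)}$ (rows are check nodes, columns are variable nodes) are independent and uniform over $\mathbb F_p$, and whose other entries are $0$. **Theorem.** Let $A>2(1+R)$, $B>\frac{2(1+R)}{1-R}$,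 $\epsilon=\frac{1-R}{A+1-R}$ and $\vartheta=\frac1{B(1-R)+1}$. With $h_2(a)=-a\log_2a-(1-a)\log_2(1-a)$, suppose that $$\begin{aligned}\Delta_V>\max\Big\{&\tfrac{h_2(\frac{1-R}{2\alpha})+1-R}{h_2(\frac{1-R}{2\alpha})-\frac12h_2(\frac{1-R}{\alpha})},\ R+2\alpha,\ A+1,\ \tfrac{h_2(\epsilon)+(1-R)h_2(\frac{A\epsilon}{1-R})}{h_2(\epsilon)-\frac{A\epsilon}{1-R}h_2(\frac{1-R}{A})},\ \tfrac{1-R+h_2(\frac{\beta(1-R)}2)}{1-\frac{\beta(1-R)}2h_2(\frac1{\beta(1-R)})},\ \tfrac{(2+\beta R)(1-R)}{2-\beta(1-R)},\\ &(1-R)(B+1),\ \tfrac{(1-R)h_2(\vartheta)+h_2(B\vartheta(1-R))}{h_2(\vartheta)-B\vartheta(1-R)h_2(\frac1{B(1-R)})},\ \tfrac{(A+1)(1-R)-A\epsilon(2-R)}{1-R-A\epsilon},\ \tfrac{B+1-\vartheta B(2-R)}{\frac1{1-R}-\vartheta B}\Big\},\end{aligned}$$ that every $\mathcal G^{(n)}$,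 $n\in I$, is $(\alpha,A,\beta,B,\epsilon,\vartheta)$-good, and that $$\lambda>\max\Big\{\tfrac1R,\ \tfrac1{1-R},\ \tfrac2{A-2(1-R)},\ \tfrac2{B(1-R)-2(1+R)},\ 2\big(1-\tfrac1{AB-1}-\tfrac1A\big)^{-1},\ \tfrac1{2(\alpha-1+R)},\ \tfrac{2B+3/2}{B(1-R)-1}\Big\}.$$ Then for every semi norm-ergodic noise $(z^{(n)})$ with second moments per dimension $\sigma_n^2$ there are sets $\mathcal A_n$ of lattices in $\mathbb R^n$ such that a random lattice from the $(\mathcal G^{(n)},\lambda)$ LDA ensemble lies in $\mathcal A_n$ with probability tending to $1$, and every sequence of lattices with $\Lambda^{(n)}\in\mathcal A_n$ for all large $n\in I$ is simultaneously good for packing, good for coding in presence of semi norm-ergodic noise, good for coding against $(z^{(n)})$, and good for MSE quantization, and the sequence of its dual lattices $(\Lambda^{(n)})^*$ is good for packing. -/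

import Mathlib

open Filter Topology MeasureTheory
open scoped ENNReal

noncomputable section

namespace LDA

/-! ### Lattices in Euclidean space -/

/-- `ℝⁿ` with the Euclidean norm. -/
abbrev Euc (n : ℕ) : Type := EuclideanSpace ℝ (Fin n)

/-- The (closed) fundamental Voronoi region of `L`: the points for which `0` is a closest point of
`L`. A rule for breaking ties changes it by a null set only, so volumes and integrals over it do
not depend on the rule. -/
def voronoi {n : ℕ} (L : Submodule ℤ (Euc n)) : Set (Euc n) :=
  {x | ∀ y ∈ L, ‖x‖ ≤ ‖x - y‖}

/-- The points for which `0` is the unique closest point of `L`. This set is contained in the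
fundamental Voronoi region for every rule for breaking ties. -/
def strictVoronoi {n : ℕ} (L : Submodule ℤ (Euc n)) : Set (Euc n) :=
  {x | ∀ y ∈ L, y ≠ 0 → ‖x‖ < ‖x - y‖}

/-- The volume of the fundamental Voronoi region. -/
def vol {n : ℕ} (L : Submodule ℤ (Euc n)) : ℝ := volume.real (voronoi L)

/-- The packing radius: the radius of the largest open ball contained in the fundamental
Voronoi region. -/
def packingRadius {n : ℕ} (L : Submodule ℤ (Euc n)) : ℝ :=
  sSup {r : ℝ | ∃ c : Euc n, Metric.ball c r ⊆ voronoi L}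

/-- The effective radius: the radius of a ball whose volume is `vol L`. -/
def effectiveRadius {n : ℕ} (L : Submodule ℤ (Euc n)) : ℝ :=
  (vol L / volume.real (Metric.closedBall (0 : Euc n) 1)) ^ (1 / (n : ℝ))

/-- The normalized second moment per dimension. -/
def normalizedSecondMoment {n : ℕ} (L : Submodule ℤ (Euc n)) : ℝ :=
  1 / (n * vol L ^ (1 + 2 / (n : ℝ))) * ∫ y in voronoi L, ‖y‖ ^ 2

/-- The dual lattice `{y | ∀ x ∈ L, ⟪y, x⟫ ∈ ℤ}`. -/
def dualLattice {n : ℕ} (L : Submodule ℤ (Euc n)) : Submodule ℤ (Euc n) :=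
  LinearMap.BilinForm.dualSubmodule (innerₗ (Euc n)) L

theorem mem_dualLattice {n : ℕ} (L : Submodule ℤ (Euc n)) (y : Euc n) :
    y ∈ dualLattice L ↔ ∀ x ∈ L, ∃ k : ℤ, (k : ℝ) = inner ℝ y x := by
  simp [dualLattice, LinearMap.BilinForm.mem_dualSubmodule, Submodule.mem_one]

/-! ### Goodness of sequences of lattices

Sequences are indexed by the dimension. The filter `F` on the dimensions is
`atTop ⊓ 𝓟 I` when the dimension tends to infinity inside an infinite set `I`. -/

/-- Good for packing: `rpack / reff ≥ 1/2 - o(1)`. -/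
def GoodForPacking (F : Filter ℕ) (L : ∀ n, Submodule ℤ (Euc n)) : Prop :=
  ∀ η : ℝ, 0 < η → ∀ᶠ n in F, 1 / 2 - η ≤ packingRadius (L n) / effectiveRadius (L n)

/-- Good for MSE quantization. -/
def GoodForMSE (F : Filter ℕ) (L : ∀ n, Submodule ℤ (Euc n)) : Prop :=
  Tendsto (fun n => normalizedSecondMoment (L n)) F (𝓝 (1 / (2 * Real.pi * Real.exp 1)))

/-- The random vectors with laws `z n` on `ℝⁿ` have second moment per dimension `v n` and are semi
norm-ergodic: for each `δ > 0` the norm of the `n`-th vector is at most `√((1 + δ) n (v n))` with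
probability tending to `1`. -/
structure SemiNormErgodic (F : Filter ℕ) (z : ∀ n, ProbabilityMeasure (Euc n)) (v : ℕ → ℝ) :
    Prop where
  integrable : ∀ᶠ n in F, Integrable (fun x : Euc n => ‖x‖ ^ 2) (z n : Measure (Euc n))
  secondMoment : ∀ᶠ n in F, ∫ x, ‖x‖ ^ 2 ∂(z n : Measure (Euc n)) = n * v n
  ergodic : ∀ δ : ℝ, 0 < δ → Tendsto
    (fun n => (z n : Measure (Euc n)) (Metric.closedBall 0 (Real.sqrt ((1 + δ) * n * v n)))ᶜ)
    F (𝓝 0)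

/-- The probability that the origin is not the unique lattice point closest to the noise vector
tends to `0`. -/
def ErrorVanishes (F : Filter ℕ) (L : ∀ n, Submodule ℤ (Euc n))
    (z : ∀ n, ProbabilityMeasure (Euc n)) : Prop :=
  Tendsto (fun n => (z n : Measure (Euc n)) (strictVoronoi (L n))ᶜ) F (𝓝 0)

/-- Good for coding in presence of semi norm-ergodic noise: the error probability vanishes for
every semi norm-ergodic noise whose second moment per dimension is a constant `σ²` with
`vol ^ (2 / n) > 2 π e σ²` for all large `n`. -/
def GoodForCoding (F : Filter ℕ) (L : ∀ n, Submodule ℤ (Euc n)) : Prop :=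
  ∀ (z : ∀ n, ProbabilityMeasure (Euc n)) (σsq : ℝ), SemiNormErgodic F z (fun _ => σsq) →
    (∀ᶠ n in F, 2 * Real.pi * Real.exp 1 * σsq < vol (L n) ^ (2 / (n : ℝ))) →
    ErrorVanishes F L z

/-- The scale-free form of the coding property, for one noise sequence `z` whose second moment per
dimension `v n` may vary with `n`: the error probability vanishes as soon as
`vol ^ (2 / n) ≥ (1 + η) 2 π e (v n)` for some `η > 0` and all large `n`. -/
def GoodForCodingAgainst (F : Filter ℕ) (z : ∀ n, ProbabilityMeasure (Euc n)) (v : ℕ → ℝ)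
    (L : ∀ n, Submodule ℤ (Euc n)) : Prop :=
  (∃ η : ℝ, 0 < η ∧
    ∀ᶠ n in F, (1 + η) * (2 * Real.pi * Real.exp 1 * v n) ≤ vol (L n) ^ (2 / (n : ℝ))) →
    ErrorVanishes F L z

/-! ### Tanner graphs

A bipartite graph with `n` variable nodes and `m` check nodes is given by its set of edges
`E ⊆ Fin n × Fin m`. -/

/-- `(ΔV, ΔC)`-regularity. -/
def IsBiregular {n m : ℕ} (E : Finset (Fin n × Fin m)) (ΔV ΔC : ℕ) : Prop :=
  (∀ i : Fin n, (E.filter fun e => e.1 = i).card = ΔV) ∧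
    ∀ j : Fin m, (E.filter fun e => e.2 = j).card = ΔC

/-- The neighbourhood of a set of variable nodes. -/
def nbrV {n m : ℕ} (E : Finset (Fin n × Fin m)) (S : Finset (Fin n)) : Finset (Fin m) :=
  (E.filter fun e => e.1 ∈ S).image Prod.snd

/-- The neighbourhood of a set of check nodes. -/
def nbrC {n m : ℕ} (E : Finset (Fin n × Fin m)) (T : Finset (Fin m)) : Finset (Fin n) :=
  (E.filter fun e => e.2 ∈ T).image Prod.fst

/-- The expansion properties of an `(α, A, β, B, ε, ϑ)`-good graph. -/
structure IsGoodGraph (R α A β B ε ϑ : ℝ) {n m : ℕ} (E : Finset (Fin n × Fin m)) : Prop where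
  L1 : ∀ S : Finset (Fin n), S.card ≤ ⌈ε * n⌉₊ → A * S.card ≤ (nbrV E S).card
  L2 : ∀ S : Finset (Fin n), S.card ≤ ⌈n * (1 - R) / (2 * α)⌉₊ → α * S.card ≤ (nbrV E S).card
  R1 : ∀ T : Finset (Fin m), (T.card : ℝ) ≤ ϑ * n * (1 - R) → B * T.card ≤ (nbrC E T).card
  R2 : ∀ T : Finset (Fin m), (T.card : ℝ) ≤ n * (1 - R) / 2 → β * T.card ≤ (nbrC E T).card

/-- The binary entropy function, in bits. -/
def h₂ (a : ℝ) : ℝ := Real.binEntropy a / Real.log 2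

/-- The lower bound on the variable degree `ΔV`. -/
def degreeBound (R α A β B ε ϑ : ℝ) : ℝ :=
  max ((h₂ ((1 - R) / (2 * α)) + 1 - R) /
        (h₂ ((1 - R) / (2 * α)) - 1 / 2 * h₂ ((1 - R) / α))) <|
  max (R + 2 * α) <|
  max (A + 1) <|
  max ((h₂ ε + (1 - R) * h₂ (A * ε / (1 - R))) /
        (h₂ ε - A * ε / (1 - R) * h₂ ((1 - R) / A))) <|
  max ((1 - R + h₂ (β * (1 - R) / 2)) /
        (1 - β * (1 - R) / 2 * h₂ (1 / (β * (1 - R))))) <|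
  max ((2 + β * R) * (1 - R) / (2 - β * (1 - R))) <|
  max ((1 - R) * (B + 1)) <|
  max (((1 - R) * h₂ ϑ + h₂ (B * ϑ * (1 - R))) /
        (h₂ ϑ - B * ϑ * (1 - R) * h₂ (1 / (B * (1 - R))))) <|
  max (((A + 1) * (1 - R) - A * ε * (2 - R)) / (1 - R - A * ε))
    ((B + 1 - ϑ * B * (2 - R)) / (1 / (1 - R) - ϑ * B))

/-- The lower bound on the exponent `lam`. -/
def lamBound (R α A B : ℝ) : ℝ :=
  max (1 / R) <|
  max (1 / (1 - R)) <|
  max (2 / (A - 2 * (1 - R))) <|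
  max (2 / (B * (1 - R) - 2 * (1 + R))) <|
  max (2 * (1 - 1 / (A * B - 1) - 1 / A)⁻¹) <|
  max (1 / (2 * (α - 1 + R)))
    ((2 * B + 3 / 2) / (B * (1 - R) - 1))

/-! ### The ensemble -/

theorem exists_prime_ge (x : ℝ) : ∃ q : ℕ, q.Prime ∧ x ≤ q := by
  obtain ⟨q, hq, hp⟩ := Nat.exists_infinite_primes ⌈x⌉₊
  exact ⟨q, hp, (Nat.le_ceil x).trans (by exact_mod_cast hq)⟩

open Classical in
/-- The smallest prime number `p` with `p ≥ n ^ lam`. -/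
def ldaPrime (lam : ℝ) (n : ℕ) : ℕ := Nat.find (exists_prime_ge ((n : ℝ) ^ lam))

open Classical in
theorem ldaPrime_prime (lam : ℝ) (n : ℕ) : (ldaPrime lam n).Prime :=
  (Nat.find_spec (exists_prime_ge ((n : ℝ) ^ lam))).1

instance (lam : ℝ) (n : ℕ) : Fact (ldaPrime lam n).Prime := ⟨ldaPrime_prime lam n⟩

/-- The parity check matrix with coefficients `h'` on the edges of the Tanner graph `E` and zeros
elsewhere. -/
def parityCheck {p n m : ℕ} (E : Finset (Fin n × Fin m)) (h' : Matrix (Fin m) (Fin n) (ZMod p)) :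
    Matrix (Fin m) (Fin n) (ZMod p) :=
  Matrix.of fun i j => if (j, i) ∈ E then h' i j else 0

/-- The linear code with parity check matrix `H`. -/
def code {p n m : ℕ} (H : Matrix (Fin m) (Fin n) (ZMod p)) : Submodule (ZMod p) (Fin n → ZMod p) :=
  LinearMap.ker H.mulVecLin

/-- Construction A: the integer vectors whose reduction modulo `p` lies in the code. -/
def constructionA {p n : ℕ} (C : Submodule (ZMod p) (Fin n → ZMod p)) : Submodule ℤ (Euc n) where
  carrier := {v | ∃ x : Fin n → ℤ, (∀ i, v i = x i) ∧ (fun i => (x i : ZMod p)) ∈ C}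
  zero_mem' := ⟨0, by simp, by
    have h : (fun i => (((0 : Fin n → ℤ) i : ℤ) : ZMod p)) = 0 := by ext; simp
    rw [h]; exact C.zero_mem⟩
  add_mem' := by
    rintro a b ⟨x, hx, hxC⟩ ⟨y, hy, hyC⟩
    refine ⟨x + y, fun i => by simp [hx, hy], ?_⟩
    have h : (fun i => (((x + y) i : ℤ) : ZMod p)) =
        (fun i => (x i : ZMod p)) + fun i => (y i : ZMod p) := by ext; simp
    rw [h]; exact C.add_mem hxC hyC
  smul_mem' := by
    rintro c a ⟨x, hx, hxC⟩
    refine ⟨c • x, fun i => by simp [hx], ?_⟩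
    have h : (fun i => (((c • x) i : ℤ) : ZMod p)) =
        (c : ZMod p) • fun i => (x i : ZMod p) := by ext; simp
    rw [h]; exact C.smul_mem _ hxC

/-- The law of a random lattice from the `(E, lam)` LDA ensemble: the coefficients on the edges are
independent and uniform over `F_p`, where `p = ldaPrime lam n`. -/
def ldaEnsemble (lam : ℝ) {n m : ℕ} (E : Finset (Fin n × Fin m)) : PMF (Submodule ℤ (Euc n)) :=
  haveI : Fintype (Matrix (Fin m) (Fin n) (ZMod (ldaPrime lam n))) :=
    inferInstanceAs (Fintype (Fin m → Fin n → ZMod (ldaPrime lam n)))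
  (PMF.uniformOfFintype (Matrix (Fin m) (Fin n) (ZMod (ldaPrime lam n)))).map
    fun h' => constructionA (code (parityCheck E h'))

end LDA

end

/-! Write P for the prime and X = P^(1-R). When the parity check matrix H is onto, the lattice has
volume P^m = X^n, so its effective radius is X * `unitRadius n` up to a factor tending to 1. The
proof computes first and second moments over the random coefficients, and rests on one fact: for
fixed y, the coordinates of Hy at the checks adjacent to the support of y are independent and
uniform, so Hy = 0 has probability P^(-|N(supp y)|). The same holds for the products u^T H
(`frac_mulVec_eq_zero_le`, `frac_vecMul_eq_le`). Union bounds over vectors thus become sums over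
supports, where the number of integer points of a ball with given support
(`card_le_of_support_subset`) competes with the expansion of the graph.

The supports fall into three classes (`sum_le_three`). Small sets expand by A or B, and the size of
lam makes their total contribution vanish polynomially. Medium sets contribute n-th powers of a base
tending to 0. Large sets are treated through complements: a check outside N(S) sees only variables
outside S. There the base tends to c < 1 when the radius is c times the critical one.

At radius (1-η) X * `unitRadius n` the first moment excludes nonzero lattice points around the
origin, which gives packing. It gives packing for the dual too, since p times the dual lattice is
Construction A of the row space (`mem_dualLattice_constructionA`). The bound is uniform in the
centre of the ball, so it can be averaged over the noise, which gives coding. At radius (1+δ) X *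
`unitRadius n` the second moment method shows that almost every syndrome is attained by an integer
point of the ball (`sum_card_missed_le`). Hence all but a proportion o(P^(-2R)) of space is within
that radius of the lattice, and the rest costs at most P^2 n per point; this bounds the second
moment from above, while a Gaussian comparison bounds it from below (`le_normalizedSecondMoment`). A
diagonal choice of the tolerance η (`exists_sets`) produces the sets of lattices. -/

namespace LDA

/-! ### Counting integer points in balls -/

theorem integrable_exp_neg_mul_sub_sq {τ : ℝ} (hτ : 0 < τ) (c : ℝ) :
    Integrable fun x : ℝ => Real.exp (-τ * (x - c) ^ 2) :=
  (integrable_exp_neg_mul_sq hτ).comp_sub_right c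

theorem integral_exp_neg_mul_sub_sq (τ c : ℝ) :
    ∫ x : ℝ, Real.exp (-τ * (x - c) ^ 2) = √(Real.pi / τ) := by
  rw [integral_sub_right_eq_self (fun x : ℝ => Real.exp (-τ * x ^ 2)) c, integral_gaussian]

/-- Away from the peak each term is at most the integral over the adjacent unit interval on the side
of `c`, where the Gaussian is larger, and these intervals are pairwise disjoint. -/
theorem sum_exp_neg_mul_sub_sq_le_of_one_le {τ : ℝ} (hτ : 0 < τ) (c : ℝ) (K : Finset ℤ)
    (hK : ∀ k ∈ K, 1 ≤ |(k : ℝ) - c|) :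
    ∑ k ∈ K, Real.exp (-τ * (k - c) ^ 2) ≤ √(Real.pi / τ) := by
  set f : ℝ → ℝ := fun x => Real.exp (-τ * (x - c) ^ 2) with hf
  have hfi : Integrable f := integrable_exp_neg_mul_sub_sq hτ c
  let J : ℤ → Set ℝ := fun k => if c ≤ k then Set.Ioc ((k : ℝ) - 1) k else Set.Ico (k : ℝ) (k + 1)
  have hJm : ∀ k, MeasurableSet (J k) := by
    intro k
    by_cases h : c ≤ k <;> simp [J, h]
  have hJv : ∀ k, volume.real (J k) = 1 := by
    intro k
    by_cases h : c ≤ k <;> simp [J, h]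
  have hJi : ∀ k ∈ K, f k ≤ ∫ x in J k, f x := by
    intro k hk
    have hk1 := hK k hk
    have : ∀ x ∈ J k, f k ≤ f x := by
      intro x hx
      simp only [hf]
      apply Real.exp_le_exp.2
      have : (x - c) ^ 2 ≤ (k - c) ^ 2 := by
        rw [sq_le_sq]
        by_cases h : c ≤ k
        · simp only [J, h, if_true, Set.mem_Ioc] at hx
          rw [abs_of_nonneg (by linarith)] at hk1
          rw [abs_of_nonneg (by linarith), abs_of_nonneg (by linarith)]
          linarith
        · simp only [J, h, if_false, Set.mem_Ico] at hx
          rw [abs_of_neg (by linarith)] at hk1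
          rw [abs_of_nonpos (by linarith), abs_of_nonpos (by linarith)]
          linarith
      nlinarith
    calc f k = f k * volume.real (J k) := by rw [hJv, mul_one]
      _ ≤ ∫ x in J k, f x := by
        apply setIntegral_ge_of_const_le_real (hJm k) _ this hfi.integrableOn
        by_cases h : c ≤ k <;> simp [J, h]
  have hdisj : Set.Pairwise (K : Set ℤ) (Function.onFun Disjoint J) := by
    intro k hk l hl hkl
    rw [Function.onFun, Set.disjoint_left]
    intro x hx hx'
    have hk1 := hK k hk
    have hl1 := hK l hl
    apply hkl
    by_cases h : c ≤ k <;> by_cases h' : c ≤ l <;>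
      simp only [J, h, h', if_true, if_false, Set.mem_Ioc, Set.mem_Ico] at hx hx'
    · have h1 : (k : ℝ) < l + 1 := by linarith
      have h2 : (l : ℝ) < k + 1 := by linarith
      norm_cast at h1 h2
      omega
    · rw [abs_of_nonneg (by linarith)] at hk1
      rw [abs_of_neg (by linarith)] at hl1
      linarith
    · rw [abs_of_neg (by linarith)] at hk1
      rw [abs_of_nonneg (by linarith)] at hl1
      linarith
    · have h1 : (k : ℝ) < l + 1 := by linarith
      have h2 : (l : ℝ) < k + 1 := by linarith
      norm_cast at h1 h2
      omega
  calc ∑ k ∈ K, f k ≤ ∑ k ∈ K, ∫ x in J k, f x := Finset.sum_le_sum hJi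
    _ = ∫ x in ⋃ k ∈ K, J k, f x :=
      (integral_biUnion_finset K (fun k _ => hJm k) hdisj fun k _ => hfi.integrableOn).symm
    _ ≤ ∫ x, f x := setIntegral_le_integral hfi (ae_of_all _ fun x => (Real.exp_pos _).le)
    _ = √(Real.pi / τ) := integral_exp_neg_mul_sub_sq τ c

/-- At most two integers are too close to `c` for the comparison with the integral, and each
contributes at most 1. -/
theorem sum_exp_neg_mul_sub_sq_le {τ : ℝ} (hτ : 0 < τ) (c : ℝ) (K : Finset ℤ) :
    ∑ k ∈ K, Real.exp (-τ * (k - c) ^ 2) ≤ 2 + √(Real.pi / τ) := by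
  rw [← Finset.sum_filter_add_sum_filter_not K fun k : ℤ => |(k : ℝ) - c| < 1]
  refine add_le_add ?_ (sum_exp_neg_mul_sub_sq_le_of_one_le hτ c _ fun k hk => ?_)
  · have hsub : (K.filter fun k : ℤ => |(k : ℝ) - c| < 1) ⊆ {⌊c⌋, ⌊c⌋ + 1} := by
      intro k hk
      rw [Finset.mem_filter, abs_lt] at hk
      have h1 : k - 1 ≤ ⌊c⌋ := by rw [Int.le_floor]; push_cast; linarith
      have h2 : ⌊c⌋ < k + 1 := by rw [Int.floor_lt]; push_cast; linarith
      simp only [Finset.mem_insert, Finset.mem_singleton]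
      omega
    calc ∑ k ∈ K.filter (fun k : ℤ => |(k : ℝ) - c| < 1), Real.exp (-τ * (k - c) ^ 2)
        ≤ ∑ k ∈ K.filter (fun k : ℤ => |(k : ℝ) - c| < 1), (1 : ℝ) := by
          refine Finset.sum_le_sum fun k _ => Real.exp_le_one_iff.2 ?_
          nlinarith [sq_nonneg ((k : ℝ) - c)]
      _ ≤ 2 := by
          rw [Finset.sum_const, nsmul_one]
          exact_mod_cast (Finset.card_le_card hsub).trans Finset.card_le_two
  · simpa using (Finset.mem_filter.1 hk).2

/-- An integer vector as a point of Euclidean space. -/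
noncomputable def intVec {n : ℕ} (x : Fin n → ℤ) : Euc n := WithLp.toLp 2 fun i => (x i : ℝ)

@[simp] theorem intVec_apply {n : ℕ} (x : Fin n → ℤ) (i : Fin n) : intVec x i = x i := rfl

theorem intVec_sub {n : ℕ} (x y : Fin n → ℤ) : intVec (x - y) = intVec x - intVec y := by
  ext i; simp

theorem intVec_injective {n : ℕ} : Function.Injective (intVec (n := n)) := by
  intro x y h
  ext i
  have := congrArg (fun v : Euc n => v i) h
  simpa using this

theorem abs_apply_le_norm {n : ℕ} (x : Euc n) (i : Fin n) : |x i| ≤ ‖x‖ := by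
  simpa using PiLp.norm_apply_le x i

theorem finite_intVec_ball {n : ℕ} (c : Euc n) (r : ℝ) :
    {x : Fin n → ℤ | ‖intVec x - c‖ ≤ r}.Finite := by
  refine (Set.finite_Icc (fun i => ⌊c i - r⌋) fun i => ⌈c i + r⌉).subset fun x hx => ?_
  have h : ∀ i, |(x i : ℝ) - c i| ≤ r := fun i => by
    simpa using (abs_apply_le_norm (intVec x - c) i).trans hx
  refine ⟨fun i => ?_, fun i => ?_⟩
  · have h1 := (abs_le.1 (h i)).1
    have h2 := Int.floor_le (c i - r)
    have h3 : ((⌊c i - r⌋ : ℤ) : ℝ) ≤ x i := by linarith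
    exact_mod_cast h3
  · have h1 := (abs_le.1 (h i)).2
    have h2 := Int.le_ceil (c i + r)
    have h3 : (x i : ℝ) ≤ (⌈c i + r⌉ : ℤ) := by linarith
    exact_mod_cast h3

/-- The integer points of the closed ball of radius `r` around `c`. -/
noncomputable def intPoints {n : ℕ} (c : Euc n) (r : ℝ) : Finset (Fin n → ℤ) :=
  (finite_intVec_ball c r).toFinset

@[simp] theorem mem_intPoints {n : ℕ} {c : Euc n} {r : ℝ} {x : Fin n → ℤ} :
    x ∈ intPoints c r ↔ ‖intVec x - c‖ ≤ r := by simp [intPoints]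

/-- A Chernoff bound with Gaussian weight: `exp (τ * (r² - ‖x - c‖²))` is at least 1 on the ball,
and its sum over integer points supported in `S` factors into one-dimensional sums. The parameter
`τ` is later tuned to the size of `S`. -/
theorem card_le_of_support_subset {n : ℕ} {τ : ℝ} (hτ : 0 < τ) (c : Euc n) {r : ℝ}
    (S : Finset (Fin n)) (X : Finset (Fin n → ℤ)) (hX : ∀ x ∈ X, ‖intVec x - c‖ ≤ r)
    (hS : ∀ x ∈ X, ∀ i ∉ S, x i = 0) :
    (X.card : ℝ) ≤ Real.exp (τ * r ^ 2) * (2 + √(Real.pi / τ)) ^ S.card := by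
  classical
  have h1 : ∀ x ∈ X, (1 : ℝ) ≤
      Real.exp (τ * r ^ 2) * ∏ i ∈ S, Real.exp (-τ * (x i - c i) ^ 2) := by
    intro x hx
    rw [← Real.exp_sum, ← Real.exp_add, ← Finset.mul_sum]
    apply Real.one_le_exp
    have h2 : ∑ i ∈ S, ((x i : ℝ) - c i) ^ 2 ≤ r ^ 2 := by
      calc ∑ i ∈ S, ((x i : ℝ) - c i) ^ 2 ≤ ∑ i, ((x i : ℝ) - c i) ^ 2 :=
            Finset.sum_le_sum_of_subset_of_nonneg (Finset.subset_univ _) fun _ _ _ => sq_nonneg _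
        _ = ‖intVec x - c‖ ^ 2 := by
            rw [EuclideanSpace.norm_sq_eq]; simp
        _ ≤ r ^ 2 := pow_le_pow_left₀ (norm_nonneg _) (hX x hx) 2
    nlinarith
  -- The coordinates taken on `X` span a finite box containing `X`, over which the sum of products
  -- factors.
  let K : Fin n → Finset ℤ := fun i => X.image fun x => x i
  have hinj : Set.InjOn (fun (x : Fin n → ℤ) (i : Fin n) (_ : i ∈ S) => x i) (X : Set (Fin n → ℤ)) := by
    intro x hx y hy h
    ext i
    by_cases hi : i ∈ S
    · exact congrFun (congrFun h i) hi
    · rw [hS x hx i hi, hS y hy i hi]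
  calc (X.card : ℝ) = ∑ x ∈ X, (1 : ℝ) := by simp
    _ ≤ ∑ x ∈ X, Real.exp (τ * r ^ 2) * ∏ i ∈ S, Real.exp (-τ * (x i - c i) ^ 2) :=
      Finset.sum_le_sum h1
    _ = Real.exp (τ * r ^ 2) * ∑ x ∈ X, ∏ i ∈ S, Real.exp (-τ * (x i - c i) ^ 2) :=
      (Finset.mul_sum ..).symm
    _ ≤ Real.exp (τ * r ^ 2) * ∑ g ∈ S.pi K,
          ∏ i ∈ S.attach, Real.exp (-τ * (g i.1 i.2 - c i) ^ 2) := by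
      refine mul_le_mul_of_nonneg_left ?_ (Real.exp_pos _).le
      let φ : ((i : Fin n) → i ∈ S → ℤ) → ℝ := fun g =>
        ∏ i ∈ S.attach, Real.exp (-τ * (g i.1 i.2 - c i) ^ 2)
      have h3 : ∀ x ∈ X, ∏ i ∈ S, Real.exp (-τ * (x i - c i) ^ 2) = φ fun i _ => x i := by
        intro x _
        exact (Finset.prod_attach S fun i => Real.exp (-τ * (x i - c i) ^ 2)).symm
      rw [Finset.sum_congr rfl h3, ← Finset.sum_image (f := φ)
        (g := fun (x : Fin n → ℤ) (i : Fin n) (_ : i ∈ S) => x i) hinj]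
      refine Finset.sum_le_sum_of_subset_of_nonneg ?_ fun g _ _ =>
        Finset.prod_nonneg fun _ _ => (Real.exp_pos _).le
      intro g hg
      obtain ⟨x, hx, rfl⟩ := Finset.mem_image.1 hg
      exact Finset.mem_pi.2 fun i _ => Finset.mem_image_of_mem _ hx
    _ = Real.exp (τ * r ^ 2) * ∏ i ∈ S, ∑ k ∈ K i, Real.exp (-τ * (k - c i) ^ 2) := by
      rw [Finset.prod_sum]
    _ ≤ Real.exp (τ * r ^ 2) * ∏ i ∈ S, (2 + √(Real.pi / τ)) := by
      refine mul_le_mul_of_nonneg_left (Finset.prod_le_prod (fun i _ =>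
        Finset.sum_nonneg fun _ _ => (Real.exp_pos _).le) fun i _ =>
          sum_exp_neg_mul_sub_sq_le hτ _ _) (Real.exp_pos _).le
    _ = _ := by rw [Finset.prod_const]

/-! ### The unit cube -/

/-- The half-open unit cube. -/
def unitCube (n : ℕ) : Set (Euc n) := {x | ∀ i, x i ∈ Set.Ico (0 : ℝ) 1}

theorem measurableSet_unitCube (n : ℕ) : MeasurableSet (unitCube n) := by
  have : unitCube n = ⋂ i, (fun x : Euc n => x i) ⁻¹' Set.Ico 0 1 := by
    ext; simp [unitCube]
  rw [this]
  exact MeasurableSet.iInter fun i => measurableSet_Ico.preimage (by fun_prop)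

theorem volume_unitCube (n : ℕ) : volume (unitCube n) = 1 := by
  have h := (EuclideanSpace.volume_preserving_symm_measurableEquiv_toLp (Fin n)).measure_preimage
    (s := Set.univ.pi fun _ => Set.Ico (0 : ℝ) 1)
    (MeasurableSet.univ_pi fun _ => measurableSet_Ico).nullMeasurableSet
  rw [Real.volume_pi_Ico] at h
  simp only [sub_zero, ENNReal.ofReal_one, Finset.prod_const_one] at h
  rw [← h]
  congr 1
  ext x
  simp [unitCube, Set.mem_pi]

/-- The integer vector of the floors of the coordinates. -/
noncomputable def floorVec {n : ℕ} (x : Euc n) : Fin n → ℤ := fun i => ⌊x i⌋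

theorem sub_intVec_mem_unitCube {n : ℕ} {x : Euc n} {y : Fin n → ℤ} :
    x - intVec y ∈ unitCube n ↔ y = floorVec x := by
  constructor
  · intro h
    ext i
    have := h i
    simp only [PiLp.sub_apply, intVec_apply, Set.mem_Ico] at this
    exact (Int.floor_eq_iff.2 ⟨by linarith [this.1], by linarith [this.2]⟩).symm
  · rintro rfl i
    simp only [floorVec, PiLp.sub_apply, intVec_apply, Set.mem_Ico]
    exact ⟨by linarith [Int.floor_le (x i)], by linarith [Int.lt_floor_add_one (x i)]⟩

theorem norm_le_sqrt_of_mem_unitCube {n : ℕ} {x : Euc n} (hx : x ∈ unitCube n) : ‖x‖ ≤ √n := by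
  rw [EuclideanSpace.norm_eq]
  apply Real.sqrt_le_sqrt
  calc ∑ i, ‖x i‖ ^ 2 ≤ ∑ _i : Fin n, (1 : ℝ) := by
        refine Finset.sum_le_sum fun i _ => ?_
        have := hx i
        rw [Real.norm_eq_abs, sq_abs]
        nlinarith [this.1, this.2]
    _ = n := by simp

/-- The unit cubes at the floor vectors cover the smaller ball; `√n` bounds their diameter. -/
theorem volume_closedBall_le_card_intPoints {n : ℕ} (c : Euc n) (r : ℝ) :
    volume (Metric.closedBall c (r - √n)) ≤ (intPoints c r).card := by
  have hsub : Metric.closedBall c (r - √n) ⊆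
      ⋃ x ∈ intPoints c r, (fun y => y - intVec x) ⁻¹' unitCube n := by
    intro y hy
    have h1 : y - intVec (floorVec y) ∈ unitCube n := sub_intVec_mem_unitCube.2 rfl
    refine Set.mem_iUnion₂.2 ⟨floorVec y, ?_, h1⟩
    rw [mem_intPoints]
    have h2 := norm_le_sqrt_of_mem_unitCube h1
    rw [mem_closedBall_iff_norm] at hy
    calc ‖intVec (floorVec y) - c‖ = ‖(y - c) - (y - intVec (floorVec y))‖ := by congr 1; abel
      _ ≤ ‖y - c‖ + ‖y - intVec (floorVec y)‖ := norm_sub_le _ _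
      _ ≤ r := by linarith
  calc volume (Metric.closedBall c (r - √n))
      ≤ volume (⋃ x ∈ intPoints c r, (fun y => y - intVec x) ⁻¹' unitCube n) :=
        measure_mono hsub
    _ ≤ ∑ x ∈ intPoints c r, volume ((fun y => y - intVec x) ⁻¹' unitCube n) :=
        measure_biUnion_finset_le _ _
    _ = (intPoints c r).card := by
      simp_rw [sub_eq_add_neg, measure_preimage_add_right, volume_unitCube]
      simp

/-! ### The volume of the unit ball -/

/-- Stirling's upper bound up to a linear factor, obtained by dominating the integrand by a pure
exponential. Polynomial losses are harmless in every later use. -/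
theorem Gamma_add_one_le {x : ℝ} (hx : 2 ≤ x) :
    Real.Gamma (x + 1) ≤ 4 * x * (x / Real.exp 1) ^ x := by
  have hx0 : 0 < x := by linarith
  -- The rate `1 / x` balances two losses: the exponential integrates to `x`, while `(1 - 1 / x) ^
  -- x` stays above `1 / 4`.
  set δ : ℝ := 1 / x with hδ
  have hδ0 : 0 < δ := by positivity
  have hδ1 : δ ≤ 1 / 2 := by rw [hδ]; exact one_div_le_one_div_of_le (by norm_num) hx
  set M : ℝ := (x / ((1 - δ) * Real.exp 1)) ^ x with hM
  have hpt : ∀ t ∈ Set.Ioi (0 : ℝ), Real.exp (-t) * t ^ x ≤ M * Real.exp (-δ * t) := by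
    intro t ht
    have ht0 : 0 < t := ht
    have h1d : 0 < 1 - δ := by linarith
    set u := (1 - δ) * t / x with hu
    have hu0 : 0 < u := by positivity
    have h1 : t = (x / (1 - δ)) * u := by rw [hu]; field_simp
    -- Sharp at `u = 1`, that is, at the maximum `t = x / (1 - δ)` of the tilted integrand.
    have h2 : u ≤ Real.exp (u - 1) := by linarith [Real.add_one_le_exp (u - 1)]
    have h3 : u ^ x ≤ Real.exp (u * x - x) := by
      calc u ^ x ≤ (Real.exp (u - 1)) ^ x := Real.rpow_le_rpow hu0.le h2 hx0.le
        _ = Real.exp (u * x - x) := by rw [← Real.exp_mul]; ring_nf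
    have h4 : t ^ x = (x / (1 - δ)) ^ x * u ^ x := by
      conv_lhs => rw [h1]
      rw [Real.mul_rpow (by positivity) hu0.le]
    have h5 : M = (x / (1 - δ)) ^ x * Real.exp (-x) := by
      rw [hM, ← div_div, Real.div_rpow (by positivity) (Real.exp_pos _).le, ← Real.exp_mul,
        one_mul, Real.exp_neg, div_eq_mul_inv]
    have h6 : u * x = (1 - δ) * t := by rw [hu]; field_simp
    rw [h4, h5]
    calc Real.exp (-t) * ((x / (1 - δ)) ^ x * u ^ x)
        ≤ Real.exp (-t) * ((x / (1 - δ)) ^ x * Real.exp (u * x - x)) := by gcongr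
      _ = (x / (1 - δ)) ^ x * (Real.exp (-t) * Real.exp (u * x - x)) := by ring
      _ = (x / (1 - δ)) ^ x * (Real.exp (-x) * Real.exp (-δ * t)) := by
        rw [← Real.exp_add, ← Real.exp_add, h6]; ring_nf
      _ = _ := by ring
  have hM4 : M ≤ 4 * (x / Real.exp 1) ^ x := by
    have h1d : 0 < 1 - δ := by linarith
    -- Bernoulli's inequality at exponent `x` would only give 0; at `x / 2` it gives `1 / 2`, which
    -- is then squared.
    have hb : (1 : ℝ) / 2 ≤ (1 - δ) ^ (x / 2) := by
      have := one_add_mul_self_le_rpow_one_add (s := -δ) (by linarith) (p := x / 2) (by linarith)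
      have h2 : 1 + x / 2 * (-δ) = 1 / 2 := by rw [hδ]; field_simp; norm_num
      rw [h2] at this
      simpa [sub_eq_add_neg] using this
    have hb2 : (1 : ℝ) / 4 ≤ (1 - δ) ^ x := by
      have : (1 - δ) ^ x = (1 - δ) ^ (x / 2) * (1 - δ) ^ (x / 2) := by
        rw [← Real.rpow_add h1d]; ring_nf
      rw [this]; nlinarith
    have : M = (x / Real.exp 1) ^ x / (1 - δ) ^ x := by
      rw [hM, ← Real.div_rpow (by positivity) h1d.le]
      congr 1
      rw [div_div, mul_comm]
    rw [this, div_le_iff₀ (by positivity)]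
    nlinarith [Real.rpow_nonneg (show (0 : ℝ) ≤ x / Real.exp 1 by positivity) x]
  have hint : ∫ t in Set.Ioi (0 : ℝ), M * Real.exp (-δ * t) = M * x := by
    rw [integral_const_mul]
    congr 1
    rw [integral_exp_mul_Ioi (by linarith) 0]
    rw [hδ]; field_simp; simp
  calc Real.Gamma (x + 1) = ∫ t in Set.Ioi (0 : ℝ), Real.exp (-t) * t ^ x := by
        rw [Real.Gamma_eq_integral (by linarith)]; simp
    _ ≤ ∫ t in Set.Ioi (0 : ℝ), M * Real.exp (-δ * t) := by
        refine setIntegral_mono_on ?_ ?_ measurableSet_Ioi hpt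
        · have := Real.GammaIntegral_convergent (s := x + 1) (by linarith)
          simpa using this
        · exact (integrableOn_exp_mul_Ioi (by linarith) 0).const_mul M
    _ = M * x := hint
    _ ≤ _ := by nlinarith

theorem le_volume_closedBall {n : ℕ} (hn : 4 ≤ n) (c : Euc n) {r : ℝ} (hr : 0 ≤ r) :
    (r * √(2 * Real.pi * Real.exp 1 / n)) ^ n / (2 * n) ≤ volume.real (Metric.closedBall c r) := by
  have hn0 : (0 : ℝ) < n := by positivity
  have hn4 : (4 : ℝ) ≤ n := by exact_mod_cast hn
  have : Nonempty (Fin n) := ⟨⟨0, by omega⟩⟩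
  rw [Measure.real, EuclideanSpace.volume_closedBall, ENNReal.toReal_mul, ENNReal.toReal_pow,
    ENNReal.toReal_ofReal hr, ENNReal.toReal_ofReal (by positivity), Fintype.card_fin, mul_pow,
    mul_div_assoc]
  refine mul_le_mul_of_nonneg_left ?_ (by positivity)
  have hG := Gamma_add_one_le (x := (n : ℝ) / 2) (by linarith)
  have hGpos : 0 < Real.Gamma ((n : ℝ) / 2 + 1) := Real.Gamma_pos_of_pos (by positivity)
  rw [div_le_div_iff₀ (by positivity) hGpos]
  have h1 : √(2 * Real.pi * Real.exp 1 / n) ^ n * ((n : ℝ) / 2 / Real.exp 1) ^ ((n : ℝ) / 2) =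
      √Real.pi ^ n := by
    have h2 : ((n : ℝ) / 2 / Real.exp 1) ^ ((n : ℝ) / 2) = √((n : ℝ) / 2 / Real.exp 1) ^ n := by
      rw [Real.sqrt_eq_rpow, ← Real.rpow_natCast, ← Real.rpow_mul (by positivity)]
      congr 1; ring
    rw [h2, ← mul_pow, ← Real.sqrt_mul (by positivity)]
    congr 2
    field_simp
  calc √(2 * Real.pi * Real.exp 1 / n) ^ n * Real.Gamma ((n : ℝ) / 2 + 1)
      ≤ √(2 * Real.pi * Real.exp 1 / n) ^ n *
        (4 * ((n : ℝ) / 2) * ((n : ℝ) / 2 / Real.exp 1) ^ ((n : ℝ) / 2)) := by gcongr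
    _ = 2 * n * (√(2 * Real.pi * Real.exp 1 / n) ^ n *
        ((n : ℝ) / 2 / Real.exp 1) ^ ((n : ℝ) / 2)) := by ring
    _ = √Real.pi ^ n * (2 * n) := by rw [h1]; ring

/-! ### The Voronoi region as a fundamental domain -/

section Voronoi

variable {n : ℕ} (L : Submodule ℤ (Euc n))

theorem isClosed_voronoi : IsClosed (voronoi L) := by
  have : voronoi L = ⋂ y ∈ L, {x : Euc n | ‖x‖ ≤ ‖x - y‖} := by
    ext; simp [voronoi]
  rw [this]
  exact isClosed_biInter fun y _ => isClosed_le (by fun_prop) (by fun_prop)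

theorem measurableSet_voronoi : MeasurableSet (voronoi L) := (isClosed_voronoi L).measurableSet

variable {L}

theorem norm_eq_infDist_of_mem_voronoi {x : Euc n} (hx : x ∈ voronoi L) :
    ‖x‖ = Metric.infDist x (L : Set (Euc n)) := by
  apply le_antisymm
  · rw [Metric.le_infDist ⟨0, L.zero_mem⟩]
    intro y hy
    rw [dist_eq_norm]
    exact hx y hy
  · have := Metric.infDist_le_dist_of_mem (x := x) (s := (L : Set (Euc n))) L.zero_mem
    simpa using this

theorem infDist_add_mem {y : Euc n} (hy : y ∈ L) (x : Euc n) :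
    Metric.infDist (y + x) (L : Set (Euc n)) = Metric.infDist x (L : Set (Euc n)) := by
  have key : ∀ (y : Euc n), y ∈ L → ∀ x : Euc n,
      Metric.infDist (y + x) (L : Set (Euc n)) ≤ Metric.infDist x (L : Set (Euc n)) := by
    intro y hy x
    rw [Metric.le_infDist ⟨0, L.zero_mem⟩]
    intro z hz
    have h : dist x z = dist (y + x) (y + z) := by simp
    rw [h]
    exact Metric.infDist_le_dist_of_mem (L.add_mem hy hz)
  refine le_antisymm (key y hy x) ?_
  simpa using key (-y) (L.neg_mem hy) (y + x)

theorem ball_subset_voronoi {d : ℝ} (hd : ∀ y ∈ L, y ≠ 0 → d ≤ ‖y‖) :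
    Metric.ball 0 (d / 2) ⊆ voronoi L := by
  intro x hx y hy
  rw [mem_ball_zero_iff] at hx
  by_cases h : y = 0
  · simp [h]
  · have h1 := hd y hy h
    have h2 := norm_sub_norm_le y x
    rw [norm_sub_rev] at h2
    linarith

theorem ball_subset_strictVoronoi {d : ℝ} (hd : ∀ y ∈ L, y ≠ 0 → d ≤ ‖y‖) :
    Metric.ball 0 (d / 2) ⊆ strictVoronoi L := by
  intro x hx y hy h
  rw [mem_ball_zero_iff] at hx
  have h1 := hd y hy h
  have h2 := norm_sub_norm_le y x
  rw [norm_sub_rev] at h2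
  linarith

/-- A real supremum is bounded below by a member only if the set is bounded above; the boundedness
of the Voronoi region provides this. -/
theorem le_packingRadius (hn : 0 < n) {K : ℝ} (hK : voronoi L ⊆ Metric.closedBall 0 K) {d : ℝ}
    (hd : ∀ y ∈ L, y ≠ 0 → d ≤ ‖y‖) : d / 2 ≤ packingRadius L := by
  refine le_csSup ⟨2 * K, ?_⟩ ⟨0, ball_subset_voronoi hd⟩
  rintro r ⟨c, hc⟩
  by_contra hr
  push Not at hr
  have hK0 : 0 ≤ K := by
    have : (0 : Euc n) ∈ voronoi L := by intro y _; simp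
    simpa using hK this
  have hr0 : 0 < r := by linarith
  let e : Euc n := EuclideanSpace.single ⟨0, hn⟩ 1
  have he : ‖e‖ = 1 := by simp [e]
  -- Antipodal points `c ± t • e` are at distance `2 * t > 2 * K`, so they cannot both lie in the
  -- ball of radius `K`.
  obtain ⟨t, ht0, ht, htr⟩ : ∃ t : ℝ, 0 < t ∧ K < t ∧ t < r :=
    ⟨(max K 0 + r) / 2, by
      rw [max_eq_left hK0]; linarith, by rw [max_eq_left hK0]; linarith,
      by rw [max_eq_left hK0]; linarith⟩
  have h1 : c + t • e ∈ Metric.ball c r := by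
    rw [mem_ball_iff_norm]; simp [norm_smul, he, abs_of_pos ht0, htr]
  have h2 : c - t • e ∈ Metric.ball c r := by
    rw [mem_ball_iff_norm]; simp [norm_smul, he, abs_of_pos ht0, htr]
  have h3 := hK (hc h1)
  have h4 := hK (hc h2)
  rw [mem_closedBall_zero_iff] at h3 h4
  have h5 : ‖(c + t • e) - (c - t • e)‖ = 2 * t := by
    have : (c + t • e) - (c - t • e) = (2 * t) • e := by rw [mul_smul, two_smul]; abel
    rw [this, norm_smul, he, Real.norm_eq_abs, abs_of_pos (by linarith), mul_one]
  have h6 := norm_sub_le (c + t • e) (c - t • e)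
  rw [h5] at h6
  linarith

-- Local finiteness provides a closest lattice point, so the translates cover; two translates meet
-- only inside a perpendicular bisector, which is null.
open scoped Pointwise in
theorem isAddFundamentalDomain_voronoi (hL : ∀ r : ℝ, {y | y ∈ L ∧ ‖y‖ ≤ r}.Finite) :
    IsAddFundamentalDomain L (voronoi L) (volume : Measure (Euc n)) where
  nullMeasurableSet := (measurableSet_voronoi L).nullMeasurableSet
  ae_covers := by
    refine ae_of_all _ fun x => ?_
    have hfin : {y | y ∈ L ∧ ‖y - x‖ ≤ ‖x‖}.Finite := by
      refine (hL (2 * ‖x‖)).subset fun y hy => ⟨hy.1, ?_⟩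
      have := norm_sub_norm_le y x
      have := hy.2
      linarith
    obtain ⟨y, hy, hmin⟩ := Set.exists_min_image _ (fun y => ‖y - x‖) hfin
      ⟨0, L.zero_mem, by simp⟩
    refine ⟨⟨-y, L.neg_mem hy.1⟩, ?_⟩
    intro w hw
    change ‖-y + x‖ ≤ ‖-y + x - w‖
    have e1 : ‖-y + x‖ = ‖y - x‖ := by rw [← norm_neg]; congr 1; abel
    have e2 : ‖-y + x - w‖ = ‖(y + w) - x‖ := by rw [← norm_neg]; congr 1; abel
    rw [e1, e2]
    by_cases h : ‖(y + w) - x‖ ≤ ‖x‖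
    · exact hmin (y + w) ⟨L.add_mem hy.1 hw, h⟩
    · exact hy.2.trans (not_le.1 h).le
  aedisjoint := by
    intro g h hgh
    rw [Function.onFun, AEDisjoint]
    have hgh' : (g : Euc n) ≠ h := fun e => hgh (Subtype.ext e)
    refine measure_mono_null (t := (AffineSubspace.perpBisector (g : Euc n) h : Set (Euc n))) ?_
      (Measure.addHaar_affineSubspace _ _ (by simpa using hgh'))
    rintro x ⟨hx1, hx2⟩
    rw [SetLike.mem_coe, AffineSubspace.mem_perpBisector_iff_dist_eq, dist_eq_norm, dist_eq_norm]
    have key : ∀ a b : L, x ∈ a +ᵥ voronoi L → ‖x - a‖ ≤ ‖x - b‖ := by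
      intro a b ha
      obtain ⟨w, hw, rfl⟩ := ha
      have hw' := hw ((b : Euc n) - a) (L.sub_mem b.2 a.2)
      change ‖(a : Euc n) + w - a‖ ≤ ‖(a : Euc n) + w - b‖
      rw [show (a : Euc n) + w - a = w by abel,
        show (a : Euc n) + w - b = w - (b - a) by abel]
      exact hw'
    exact le_antisymm (key g h hx1) (key h g hx2)

/-- The ball has the smallest normalized second moment, in the limit of large dimensions. -/
theorem le_normalizedSecondMoment (hn : 0 < n) {K : ℝ}
    (hK : voronoi L ⊆ Metric.closedBall 0 K) (hvol : 0 < vol L) :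
    1 / (2 * Real.pi * Real.exp 1) ≤ normalizedSecondMoment L := by
  set V := voronoi L
  have hn0 : (0 : ℝ) < n := by exact_mod_cast hn
  have hfin : volume V ≠ ∞ :=
    ((measure_mono hK).trans_lt measure_closedBall_lt_top).ne
  have : IsFiniteMeasure ((volume : Measure (Euc n)).restrict V) := ⟨by
    simpa using lt_top_iff_ne_top.2 hfin⟩
  set v := vol L with hv
  have hpi := Real.pi_pos
  -- With this `τ` the Gaussian has total mass `exp (-n / 2) * v`. Bounding it below by its tangent
  -- in `‖y‖²` at `τ * ‖y‖² = n / 2` and integrating over `V` yields the second moment bound.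
  set τ : ℝ := Real.pi * Real.exp 1 / v ^ (2 / (n : ℝ)) with hτ
  have hv2 : 0 < v ^ (2 / (n : ℝ)) := Real.rpow_pos_of_pos hvol _
  have hτ0 : 0 < τ := by positivity
  have hgauss : ∫ y : Euc n, Real.exp (-τ * ‖y‖ ^ 2) = (Real.pi / τ) ^ ((n : ℝ) / 2) := by
    rw [GaussianFourier.integral_rexp_neg_mul_sq_norm hτ0]
    simp
  have hgi : Integrable fun y : Euc n => Real.exp (-τ * ‖y‖ ^ 2) := by
    by_contra h
    rw [integral_undef h] at hgauss
    exact (Real.rpow_pos_of_pos (by positivity) _).ne hgauss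
  have hval : (Real.pi / τ) ^ ((n : ℝ) / 2) = Real.exp (-(n / 2)) * v := by
    have : Real.pi / τ = Real.exp (-1) * v ^ (2 / (n : ℝ)) := by
      rw [hτ, Real.exp_neg]; field_simp
    rw [this, Real.mul_rpow (Real.exp_pos _).le hv2.le, ← Real.exp_mul, ← Real.rpow_mul hvol.le]
    have e : 2 / (n : ℝ) * (n / 2) = 1 := by field_simp
    rw [e, Real.rpow_one]
    congr 2; ring
  have hsq : IntegrableOn (fun y : Euc n => ‖y‖ ^ 2) V := by
    refine Measure.integrableOn_of_bounded hfin (by fun_prop) (M := K ^ 2) ?_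
    refine (ae_restrict_iff' (measurableSet_voronoi L)).2 (ae_of_all _ fun y hy => ?_)
    have := hK hy
    rw [mem_closedBall_zero_iff] at this
    rw [Real.norm_eq_abs, abs_of_nonneg (by positivity)]
    exact pow_le_pow_left₀ (norm_nonneg _) this 2
  have h1 : ∫ y in V, Real.exp (-(n / 2)) * ((1 + n / 2) - τ * ‖y‖ ^ 2) ≤
      Real.exp (-(n / 2)) * v := by
    calc ∫ y in V, Real.exp (-(n / 2)) * ((1 + n / 2) - τ * ‖y‖ ^ 2)
        ≤ ∫ y in V, Real.exp (-τ * ‖y‖ ^ 2) := by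
          refine integral_mono (((integrable_const _).sub (hsq.const_mul _)).const_mul _)
            hgi.integrableOn fun y => ?_
          have : Real.exp (-τ * ‖y‖ ^ 2) =
              Real.exp (-(n / 2)) * Real.exp (n / 2 - τ * ‖y‖ ^ 2) := by
            rw [← Real.exp_add]; ring_nf
          simp only
          rw [this]
          refine mul_le_mul_of_nonneg_left ?_ (Real.exp_pos _).le
          linarith [Real.add_one_le_exp ((n : ℝ) / 2 - τ * ‖y‖ ^ 2)]
      _ ≤ ∫ y, Real.exp (-τ * ‖y‖ ^ 2) :=
          setIntegral_le_integral hgi (ae_of_all _ fun _ => (Real.exp_pos _).le)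
      _ = _ := by rw [hgauss, hval]
  rw [integral_const_mul, integral_sub (integrable_const _) (hsq.const_mul _),
    integral_const_mul, setIntegral_const, smul_eq_mul] at h1
  have h2 := le_of_mul_le_mul_left h1 (Real.exp_pos _)
  change v * (1 + n / 2) - τ * (∫ y in V, ‖y‖ ^ 2) ≤ v at h2
  have h3 : v * (n / 2) ≤ τ * ∫ y in V, ‖y‖ ^ 2 := by linarith
  rw [normalizedSecondMoment, Real.rpow_add hvol, Real.rpow_one]
  change _ ≤ 1 / (n * (v * v ^ (2 / (n : ℝ)))) * ∫ y in V, ‖y‖ ^ 2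
  rw [hτ] at h3
  generalize (∫ y in V, ‖y‖ ^ 2) = J at *
  rw [div_mul_eq_mul_div, le_div_iff₀ hv2] at h3
  rw [div_mul_eq_mul_div, one_mul, div_le_div_iff₀ (by positivity) (by positivity)]
  nlinarith

end Voronoi

instance vaddInvariantMeasure_submodule {n : ℕ} (L : Submodule ℤ (Euc n)) :
    VAddInvariantMeasure L (Euc n) volume :=
  ⟨fun c s _ => measure_preimage_add volume (c : Euc n) s⟩

/-! ### Construction A -/

section ConstructionA

variable {p n : ℕ}

/-- Reduction of integer vectors modulo `p`. -/
def reduce (p : ℕ) {n : ℕ} (x : Fin n → ℤ) : Fin n → ZMod p := fun i => (x i : ZMod p)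

theorem reduce_sub (x y : Fin n → ℤ) : reduce p (x - y) = reduce p x - reduce p y := by
  ext i; simp [reduce]

theorem reduce_surjective (p n : ℕ) : Function.Surjective (reduce p (n := n)) := by
  intro w
  choose f hf using fun i => ZMod.intCast_surjective (w i)
  exact ⟨f, funext hf⟩

variable {C : Submodule (ZMod p) (Fin n → ZMod p)}

theorem mem_constructionA {v : Euc n} :
    v ∈ constructionA C ↔ ∃ x : Fin n → ℤ, v = intVec x ∧ reduce p x ∈ C := by
  constructor
  · rintro ⟨x, hx, hC⟩
    exact ⟨x, by ext i; simp [hx], hC⟩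
  · rintro ⟨x, rfl, hC⟩
    exact ⟨x, fun i => rfl, hC⟩

theorem intVec_mem_constructionA {x : Fin n → ℤ} :
    intVec x ∈ constructionA C ↔ reduce p x ∈ C := by
  rw [mem_constructionA]
  constructor
  · rintro ⟨y, hy, hC⟩
    rwa [intVec_injective hy]
  · exact fun h => ⟨x, rfl, h⟩

theorem finite_constructionA (C : Submodule (ZMod p) (Fin n → ZMod p)) (r : ℝ) :
    {y | y ∈ constructionA C ∧ ‖y‖ ≤ r}.Finite := by
  refine ((finite_intVec_ball (0 : Euc n) r).image intVec).subset ?_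
  rintro y ⟨hy, hr⟩
  obtain ⟨x, rfl, -⟩ := mem_constructionA.1 hy
  exact ⟨x, by simpa using hr, rfl⟩

instance countable_constructionA : Countable (constructionA C) := by
  have : (constructionA C : Set (Euc n)) ⊆ Set.range intVec := by
    intro y hy
    obtain ⟨x, rfl, -⟩ := mem_constructionA.1 hy
    exact ⟨x, rfl⟩
  exact ((Set.countable_range _).mono this).to_subtype

theorem floorVec_intVec_add (y : Fin n → ℤ) (x : Euc n) :
    floorVec (intVec y + x) = y + floorVec x := by
  ext i; simp [floorVec]

/-- The lattice contains `p ℤⁿ`, so rounding down to multiples of `p` suffices. -/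
theorem infDist_constructionA_le [NeZero p] (x : Euc n) :
    Metric.infDist x (constructionA C : Set (Euc n)) ≤ p * √n := by
  have hp : (0 : ℝ) < p := by exact_mod_cast NeZero.pos p
  let y : Fin n → ℤ := fun i => p * ⌊x i / p⌋
  have hy : intVec y ∈ constructionA C := by
    rw [intVec_mem_constructionA]
    have : reduce p y = 0 := by ext i; simp [reduce, y]
    rw [this]
    exact C.zero_mem
  refine (Metric.infDist_le_dist_of_mem hy).trans ?_
  have h : x - intVec y = (p : ℝ) • ((p : ℝ)⁻¹ • x - intVec (floorVec ((p : ℝ)⁻¹ • x))) := by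
    ext i
    simp only [y, floorVec, PiLp.sub_apply, PiLp.smul_apply, intVec_apply, smul_eq_mul,
      div_eq_inv_mul, Int.cast_mul, Int.cast_natCast, mul_sub, mul_inv_cancel_left₀ hp.ne']
  rw [dist_eq_norm, h, norm_smul, Real.norm_eq_abs, abs_of_pos hp]
  exact mul_le_mul_of_nonneg_left
    (norm_le_sqrt_of_mem_unitCube (sub_intVec_mem_unitCube.2 rfl)) hp.le

theorem voronoi_constructionA_subset [NeZero p] :
    voronoi (constructionA C) ⊆ Metric.closedBall 0 (p * √n) := by
  intro x hx
  rw [mem_closedBall_zero_iff, norm_eq_infDist_of_mem_voronoi hx]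
  exact infDist_constructionA_le x

variable {W : Type*} (rep : W → Fin n → ℤ)

/-- The union of the unit cubes at the points `rep s`. -/
def cubes (rep : W → Fin n → ℤ) : Set (Euc n) := ⋃ s, (fun y => y - intVec (rep s)) ⁻¹' unitCube n

variable {rep}
theorem mem_cubes {x : Euc n} : x ∈ cubes rep ↔ ∃ s, rep s = floorVec x := by
  simp [cubes, sub_intVec_mem_unitCube]

theorem measurableSet_cubes [Finite W] : MeasurableSet (cubes rep) :=
  MeasurableSet.iUnion fun _ => (measurableSet_unitCube n).preimage (by fun_prop)

variable [AddCommGroup W] [Module (ZMod p) W] {φ : (Fin n → ZMod p) →ₗ[ZMod p] W}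

theorem exists_rep (hφ : Function.Surjective φ) :
    ∃ rep : W → Fin n → ℤ, ∀ s, φ (reduce p (rep s)) = s := by
  choose f hf using hφ
  choose g hg using reduce_surjective p n
  exact ⟨fun s => g (f s), fun s => by rw [hg, hf]⟩

variable (hrep : ∀ s, φ (reduce p (rep s)) = s)

include hrep in
theorem rep_injective : Function.Injective rep := by
  intro s t h
  rw [← hrep s, ← hrep t, h]

variable [Fintype W]

-- Floors commute with integer translations and lattice translations preserve the syndrome of the
-- floor vector, so each orbit meets the union of the cubes in exactly one point.
include hrep in
theorem isAddFundamentalDomain_cubes :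
    IsAddFundamentalDomain (constructionA (LinearMap.ker φ)) (cubes rep)
      (volume : Measure (Euc n)) := by
  refine IsAddFundamentalDomain.mk' measurableSet_cubes.nullMeasurableSet fun x => ?_
  set s := φ (reduce p (floorVec x)) with hs
  have hmem : ∀ t, intVec (rep t - floorVec x) ∈ constructionA (LinearMap.ker φ) ↔ t = s := by
    intro t
    rw [intVec_mem_constructionA, LinearMap.mem_ker, reduce_sub, map_sub, hrep, sub_eq_zero]
  refine ⟨⟨intVec (rep s - floorVec x), (hmem s).2 rfl⟩, ?_, ?_⟩
  · change intVec (rep s - floorVec x) + x ∈ cubes rep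
    rw [mem_cubes, floorVec_intVec_add]
    exact ⟨s, by simp⟩
  · rintro ⟨g, hg⟩ hgx
    change g + x ∈ cubes rep at hgx
    obtain ⟨y, rfl, hy⟩ := mem_constructionA.1 hg
    rw [mem_cubes, floorVec_intVec_add] at hgx
    obtain ⟨t, ht⟩ := hgx
    have h1 : y = rep t - floorVec x := by rw [ht]; simp
    subst h1
    have := (hmem t).1 hg
    subst this
    rfl

include hrep in
theorem volume_cubes : volume (cubes rep) = Fintype.card W := by
  rw [cubes, measure_iUnion]
  · simp_rw [sub_eq_add_neg, measure_preimage_add_right, volume_unitCube]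
    simp
  · intro s t hst
    rw [Function.onFun, Set.disjoint_left]
    intro x hx hx'
    rw [Set.mem_preimage, sub_intVec_mem_unitCube] at hx hx'
    exact hst (rep_injective hrep (hx.trans hx'.symm))
  · exact fun s => (measurableSet_unitCube n).preimage (by fun_prop)

/-- Fundamental domains have equal volume, and one unit cube per syndrome is such a domain. -/
theorem vol_constructionA (hφ : Function.Surjective φ) :
    vol (constructionA (LinearMap.ker φ)) = Fintype.card W := by
  obtain ⟨rep, hrep⟩ := exists_rep hφ
  rw [vol, Measure.real, (isAddFundamentalDomain_voronoi (finite_constructionA _)).measure_eq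
    (isAddFundamentalDomain_cubes hrep), volume_cubes hrep]
  simp

include hrep in
/-- The second moment of the Voronoi region is controlled by the covering properties of the
lattice. -/
theorem integral_voronoi_le [NeZero p] (r : ℝ) :
    ∫ y in voronoi (constructionA (LinearMap.ker φ)), ‖y‖ ^ 2 ≤
      Fintype.card W * r ^ 2 + p ^ 2 * n * ∑ s, volume.real {x ∈ unitCube n |
        r < Metric.infDist (x + intVec (rep s)) (constructionA (LinearMap.ker φ) : Set (Euc n))} := by
  set L := constructionA (LinearMap.ker φ) with hL
  set g : Euc n → ℝ := fun x => Metric.infDist x (L : Set (Euc n)) ^ 2 with hg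
  have hgc : Continuous g := (Metric.continuous_infDist_pt _).pow 2
  have hgb : ∀ x, g x ≤ p ^ 2 * n := by
    intro x
    calc g x ≤ (p * √n) ^ 2 :=
          pow_le_pow_left₀ Metric.infDist_nonneg (infDist_constructionA_le x) 2
      _ = p ^ 2 * n := by rw [mul_pow, Real.sq_sqrt (Nat.cast_nonneg n)]
  have hDfin : volume (cubes rep) ≠ ∞ := by rw [volume_cubes hrep]; exact ENNReal.natCast_ne_top _
  have : IsFiniteMeasure ((volume : Measure (Euc n)).restrict (cubes rep)) := ⟨by
    simpa using lt_top_iff_ne_top.2 hDfin⟩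
  -- On the Voronoi region the norm is the distance to `L`. This distance is `L`-periodic, so its
  -- integral can be moved to the cubes.
  have h1 : ∫ y in voronoi L, ‖y‖ ^ 2 = ∫ y in cubes rep, g y := by
    rw [setIntegral_congr_fun (measurableSet_voronoi L) (g := g)
      fun y hy => by simp only [hg]; rw [norm_eq_infDist_of_mem_voronoi hy]]
    refine (isAddFundamentalDomain_voronoi (finite_constructionA _)).setIntegral_eq
      (isAddFundamentalDomain_cubes hrep) fun y x => ?_
    simp only [hg]
    congr 1
    exact infDist_add_mem y.2 x
  set E : Set (Euc n) := {x | r < Metric.infDist x (L : Set (Euc n))} with hE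
  have hEm : MeasurableSet E := (isOpen_lt continuous_const (Metric.continuous_infDist_pt _)).measurableSet
  have hgi : IntegrableOn g (cubes rep) := by
    refine Measure.integrableOn_of_bounded hDfin (by fun_prop) (M := p ^ 2 * n) ?_
    refine ae_of_all _ fun x => ?_
    rw [Real.norm_eq_abs, abs_of_nonneg (sq_nonneg _)]
    exact hgb x
  -- Points within `r` of the lattice pay `r²`; the others pay the crude covering bound, affordable
  -- once they are rare.
  have h2 : ∫ y in cubes rep, g y ≤ ∫ y in cubes rep, (r ^ 2 + E.indicator (fun _ => (p : ℝ) ^ 2 * n) y) := by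
    refine integral_mono hgi ((integrable_const _).add ((integrable_const _).indicator hEm)) ?_
    intro x
    by_cases hx : x ∈ E
    · simp only [Set.indicator_of_mem hx]
      nlinarith [hgb x, sq_nonneg r]
    · simp only [Set.indicator_of_notMem hx, add_zero]
      exact pow_le_pow_left₀ Metric.infDist_nonneg (not_lt.1 hx) 2
  rw [integral_add (integrable_const _) ((integrable_const _).indicator hEm),
    integral_indicator hEm, setIntegral_const, setIntegral_const, smul_eq_mul, smul_eq_mul] at h2
  have h3 : volume.real (cubes rep) = Fintype.card W := by
    rw [Measure.real, volume_cubes hrep]; simp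
  have h4 : (volume.restrict (cubes rep)).real E ≤ ∑ s, volume.real {x ∈ unitCube n |
        r < Metric.infDist (x + intVec (rep s)) (L : Set (Euc n))} := by
    rw [measureReal_restrict_apply hEm]
    have hsub : E ∩ cubes rep ⊆ ⋃ s ∈ Finset.univ, (fun y => y - intVec (rep s)) ⁻¹' {x ∈ unitCube n |
        r < Metric.infDist (x + intVec (rep s)) (L : Set (Euc n))} := by
      rintro x ⟨hxE, hx⟩
      obtain ⟨s, hs⟩ := Set.mem_iUnion.1 hx
      refine Set.mem_iUnion₂.2 ⟨s, Finset.mem_univ s, hs, ?_⟩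
      simpa [hE] using hxE
    have hfinU : ∀ s, volume ((fun y => y - intVec (rep s)) ⁻¹' {x ∈ unitCube n |
        r < Metric.infDist (x + intVec (rep s)) (L : Set (Euc n))}) ≠ ∞ := by
      intro s
      simp_rw [sub_eq_add_neg]
      rw [measure_preimage_add_right]
      refine ((measure_mono (Set.sep_subset _ _)).trans_lt ?_).ne
      rw [volume_unitCube]; exact ENNReal.one_lt_top
    refine (measureReal_mono hsub ?_).trans ((measureReal_biUnion_finset_le _ _).trans
      (Finset.sum_le_sum fun s _ => ?_))
    · exact ((measure_biUnion_finset_le _ _).trans_lt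
        (ENNReal.sum_lt_top.2 fun s _ => (hfinU s).lt_top)).ne
    · simp_rw [sub_eq_add_neg]
      rw [measureReal_def, measure_preimage_add_right, measureReal_def]
  rw [h1]
  refine h2.trans ?_
  rw [h3]
  have h5 : (0 : ℝ) ≤ (p : ℝ) ^ 2 * n := by positivity
  nlinarith

end ConstructionA

/-! ### The dual lattice -/

section Dual

variable {p n m : ℕ} [Fact p.Prime] (H : Matrix (Fin m) (Fin n) (ZMod p))

/-- The code generated by the rows of `H`. -/
def rowSpace : Submodule (ZMod p) (Fin n → ZMod p) := LinearMap.range H.vecMulLinear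

variable {H}

theorem mem_rowSpace {x : Fin n → ZMod p} :
    x ∈ rowSpace H ↔ ∃ u, Matrix.vecMul u H = x := by
  simp [rowSpace, LinearMap.mem_range]

theorem dual_apply_eq_sum (ψ : (Fin m → ZMod p) →ₗ[ZMod p] ZMod p) (v : Fin m → ZMod p) :
    ψ v = ∑ j, ψ (Pi.single j 1) * v j := by
  rw [LinearMap.pi_apply_eq_sum_univ ψ]
  refine Finset.sum_congr rfl fun j _ => ?_
  have : (fun k => if j = k then (1 : ZMod p) else 0) = Pi.single j 1 := by
    ext k; simp [Pi.single_apply, eq_comm]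
  rw [this, smul_eq_mul, mul_comm]

/-- Linear duality: a functional that vanishes on the kernel of `H` factors through `H`. -/
theorem exists_vecMul_eq {x : Fin n → ZMod p}
    (hx : ∀ c, H.mulVec c = 0 → x ⬝ᵥ c = 0) : ∃ u, Matrix.vecMul u H = x := by
  let ℓ : Module.Dual (ZMod p) (Fin n → ZMod p) := dotProductBilin (ZMod p) (ZMod p) x
  have hℓ : ℓ ∈ (LinearMap.ker H.mulVecLin).dualAnnihilator := by
    rw [Submodule.mem_dualAnnihilator]
    intro c hc
    exact hx c hc
  rw [← LinearMap.range_dualMap_eq_dualAnnihilator_ker] at hℓ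
  obtain ⟨ψ, hψ⟩ := hℓ
  refine ⟨fun j => ψ (Pi.single j 1), ?_⟩
  ext i
  have h1 := LinearMap.congr_fun hψ (Pi.single i 1)
  have h2 : ℓ (Pi.single i 1) = x i := by simp [ℓ]
  rw [h2] at h1
  rw [← h1, LinearMap.dualMap_apply, Matrix.mulVecLin_apply, Matrix.mulVec_single_one,
    dual_apply_eq_sum ψ (H.col i)]
  rfl

theorem exists_vecMul_eq_zero (h : ¬ Function.Surjective H.mulVecLin) :
    ∃ u, u ≠ 0 ∧ Matrix.vecMul u H = 0 := by
  have hlt : LinearMap.range H.mulVecLin < ⊤ :=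
    lt_top_iff_ne_top.2 fun e => h (LinearMap.range_eq_top.1 e)
  obtain ⟨ψ, hψ0, hψ⟩ := Submodule.exists_le_ker_of_lt_top _ hlt
  refine ⟨fun j => ψ (Pi.single j 1), fun h0 => hψ0 ?_, ?_⟩
  · refine LinearMap.pi_ext' fun j => LinearMap.ext_ring ?_
    simpa using congrFun h0 j
  · ext i
    have h1 : ψ (H.mulVecLin (Pi.single i 1)) = 0 := hψ ⟨_, rfl⟩
    rw [Matrix.mulVecLin_apply, Matrix.mulVec_single_one, dual_apply_eq_sum ψ (H.col i)] at h1
    rw [Pi.zero_apply, ← h1]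
    rfl

theorem inner_intVec_left (y : Euc n) (x : Fin n → ℤ) : inner ℝ y (intVec x) = ∑ i, y i * x i := by
  simp [PiLp.inner_apply, mul_comm]

/-- Up to scaling by `p`, duality of lattices is duality of codes. Pairing with `p eᵢ`, which lies
in the lattice, forces `p y` to be integral. -/
theorem mem_dualLattice_constructionA {y : Euc n} :
    y ∈ dualLattice (constructionA (code H)) ↔ (p : ℝ) • y ∈ constructionA (rowSpace H) := by
  have hp : (p : ℝ) ≠ 0 := by exact_mod_cast (Fact.out : p.Prime).ne_zero
  rw [mem_dualLattice]
  constructor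
  · intro h
    have h1 : ∀ i, ∃ k : ℤ, (k : ℝ) = p * y i := by
      intro i
      have hmem : intVec (Pi.single i (p : ℤ)) ∈ constructionA (code H) := by
        rw [intVec_mem_constructionA]
        have : reduce p (Pi.single i (p : ℤ)) = 0 := by
          ext j
          by_cases hj : j = i
          · subst hj; simp [reduce]
          · simp [reduce, hj]
        rw [this]; exact Submodule.zero_mem _
      obtain ⟨k, hk⟩ := h _ hmem
      refine ⟨k, ?_⟩
      rw [hk, inner_intVec_left, Finset.sum_eq_single i]
      · simp [mul_comm]
      · intro j _ hj; simp [hj]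
      · simp
    choose x hx using h1
    refine mem_constructionA.2 ⟨x, by ext i; simp [hx], ?_⟩
    rw [mem_rowSpace]
    refine exists_vecMul_eq fun c hc => ?_
    obtain ⟨w, rfl⟩ := reduce_surjective p n c
    obtain ⟨k, hk⟩ := h (intVec w) (intVec_mem_constructionA.2 hc)
    rw [inner_intVec_left] at hk
    have h2 : (∑ i, x i * w i : ℤ) = p * k := by
      have : ((∑ i, x i * w i : ℤ) : ℝ) = p * k := by
        push_cast
        rw [hk, Finset.mul_sum]
        exact Finset.sum_congr rfl fun i _ => by rw [hx]; ring
      exact_mod_cast this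
    have h3 := congrArg (fun z : ℤ => (z : ZMod p)) h2
    simpa [dotProduct, reduce] using h3
  · intro h v hv
    obtain ⟨x, hx, hxr⟩ := mem_constructionA.1 h
    obtain ⟨w, rfl, hw⟩ := mem_constructionA.1 hv
    obtain ⟨u, hu⟩ := mem_rowSpace.1 hxr
    have h1 : ((∑ i, x i * w i : ℤ) : ZMod p) = 0 := by
      have : ((∑ i, x i * w i : ℤ) : ZMod p) = reduce p x ⬝ᵥ reduce p w := by
        simp [dotProduct, reduce]
      rw [this, ← hu, ← Matrix.dotProduct_mulVec]
      have hw' : H.mulVec (reduce p w) = 0 := hw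
      rw [hw', dotProduct_zero]
    rw [ZMod.intCast_zmod_eq_zero_iff_dvd] at h1
    obtain ⟨k, hk⟩ := h1
    refine ⟨k, ?_⟩
    rw [inner_intVec_left]
    have h2 : ((∑ i, x i * w i : ℤ) : ℝ) = p * k := by rw [hk]; push_cast; ring
    have h3 : ∀ i, (p : ℝ) * y i = x i := fun i => by
      simpa using congrArg (fun v : Euc n => v i) hx
    apply mul_left_cancel₀ hp
    rw [← h2, Finset.mul_sum]
    push_cast
    exact Finset.sum_congr rfl fun i _ => by rw [← h3]; ring

theorem voronoi_dualLattice :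
    voronoi (dualLattice (constructionA (code H))) =
      (fun y => (p : ℝ) • y) ⁻¹' voronoi (constructionA (rowSpace H)) := by
  have hp : (0 : ℝ) < p := by exact_mod_cast (Fact.out : p.Prime).pos
  ext x
  constructor
  · intro hx y hy
    have hmem : (p : ℝ)⁻¹ • y ∈ dualLattice (constructionA (code H)) := by
      rw [mem_dualLattice_constructionA, smul_inv_smul₀ hp.ne']; exact hy
    have h := hx _ hmem
    have e : (p : ℝ) • x - y = (p : ℝ) • (x - (p : ℝ)⁻¹ • y) := by
      rw [smul_sub, smul_inv_smul₀ hp.ne']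
    rw [e, norm_smul, norm_smul]
    exact mul_le_mul_of_nonneg_left h (norm_nonneg _)
  · intro hx y hy
    have h := hx _ (mem_dualLattice_constructionA.1 hy)
    rw [← smul_sub, norm_smul, norm_smul, Real.norm_eq_abs, abs_of_pos hp] at h
    exact le_of_mul_le_mul_left h hp

theorem voronoi_dualLattice_subset :
    voronoi (dualLattice (constructionA (code H))) ⊆ Metric.closedBall 0 √n := by
  have hp : (0 : ℝ) < p := by exact_mod_cast (Fact.out : p.Prime).pos
  intro x hx
  rw [voronoi_dualLattice] at hx
  have h := voronoi_constructionA_subset hx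
  rw [mem_closedBall_zero_iff, norm_smul, Real.norm_eq_abs, abs_of_pos hp] at h
  rw [mem_closedBall_zero_iff]
  exact le_of_mul_le_mul_left h hp

theorem vol_code (hH : Function.Surjective H.mulVecLin) :
    vol (constructionA (code H)) = (p : ℝ) ^ m := by
  rw [code, vol_constructionA hH]
  simp [ZMod.card]

/-- Surjectivity of `H` makes its rows independent, so the row space has `p ^ m` elements and index
`p ^ (n - m)`; scaling by `p⁻¹` divides the volume by `p ^ n`. -/
theorem vol_dualLattice (hH : Function.Surjective H.mulVecLin) :
    vol (dualLattice (constructionA (code H))) = ((p : ℝ) ^ m)⁻¹ := by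
  classical
  have hp : (0 : ℝ) < p := by exact_mod_cast (Fact.out : p.Prime).pos
  have hinj : Function.Injective H.vecMulLinear := by
    rw [← LinearMap.ker_eq_bot, LinearMap.ker_eq_bot']
    intro u hu
    ext j
    obtain ⟨c, hc⟩ := hH (Pi.single j 1)
    rw [Matrix.mulVecLin_apply] at hc
    have hu' : Matrix.vecMul u H = 0 := by simpa using hu
    have h1 : u ⬝ᵥ H.mulVec c = 0 := by
      rw [Matrix.dotProduct_mulVec, hu', zero_dotProduct]
    rw [hc] at h1
    simpa using h1
  have : Fintype ((Fin n → ZMod p) ⧸ rowSpace H) := Fintype.ofFinite _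
  have hker : LinearMap.ker (rowSpace H).mkQ = rowSpace H := Submodule.ker_mkQ _
  have hvol := vol_constructionA (p := p) (n := n) (φ := (rowSpace H).mkQ)
    (Submodule.mkQ_surjective _)
  rw [hker] at hvol
  have hc1 : Nat.card (rowSpace H) = p ^ m := by
    rw [rowSpace, ← Nat.card_congr (LinearEquiv.ofInjective _ hinj).toEquiv]
    simp [Nat.card_eq_fintype_card, ZMod.card]
  have hc2 : (p : ℝ) ^ n = p ^ m * Fintype.card ((Fin n → ZMod p) ⧸ rowSpace H) := by
    have h := Submodule.card_eq_card_quotient_mul_card (rowSpace H)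
    rw [hc1, Nat.card_eq_fintype_card, Nat.card_eq_fintype_card, Fintype.card_fun, ZMod.card,
      Fintype.card_fin] at h
    exact_mod_cast h
  rw [vol, voronoi_dualLattice, measureReal_def, Measure.addHaar_preimage_smul _ hp.ne',
    ENNReal.toReal_mul, ← measureReal_def]
  change _ * vol (constructionA (rowSpace H)) = _
  rw [hvol, ENNReal.toReal_ofReal (abs_nonneg _), finrank_euclideanSpace_fin,
    abs_of_pos (by positivity), hc2]
  have : (Fintype.card ((Fin n → ZMod p) ⧸ rowSpace H) : ℝ) ≠ 0 := by
    exact_mod_cast Fintype.card_ne_zero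
  field_simp

end Dual

/-! ### Probabilities -/

section Frac

variable {M : Type*} [Fintype M]

open Classical in
/-- The probability of the event `P` under the uniform law. -/
noncomputable def frac (P : M → Prop) : ℝ := (Finset.univ.filter P).card / Fintype.card M

theorem frac_nonneg (P : M → Prop) : 0 ≤ frac P := by unfold frac; positivity

theorem frac_mono {P Q : M → Prop} (h : ∀ x, P x → Q x) : frac P ≤ frac Q := by
  classical
  unfold frac
  refine div_le_div_of_nonneg_right ?_ (Nat.cast_nonneg _)
  exact_mod_cast Finset.card_le_card (Finset.monotone_filter_right _ fun x _ hx => h x hx)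

theorem frac_not_add [Nonempty M] (P : M → Prop) : frac P + frac (fun x => ¬ P x) = 1 := by
  classical
  unfold frac
  rw [← add_div, div_eq_one_iff_eq (by positivity)]
  have := Finset.card_filter_add_card_filter_not (s := (Finset.univ : Finset M)) P
  rw [Finset.card_univ] at this
  convert congrArg (Nat.cast (R := ℝ)) this using 1
  push_cast
  congr!

theorem frac_le_sum {ι : Type*} (s : Finset ι) {P : M → Prop} {Q : ι → M → Prop}
    (h : ∀ x, P x → ∃ i ∈ s, Q i x) : frac P ≤ ∑ i ∈ s, frac (Q i) := by
  classical
  unfold frac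
  rw [← Finset.sum_div]
  gcongr
  norm_cast
  refine (Finset.card_le_card fun x hx => ?_).trans Finset.card_biUnion_le
  obtain ⟨i, hi, hq⟩ := h x (Finset.mem_filter.1 hx).2
  exact Finset.mem_biUnion.2 ⟨i, hi, Finset.mem_filter.2 ⟨Finset.mem_univ _, hq⟩⟩

theorem frac_or_le (P Q : M → Prop) : frac (fun x => P x ∨ Q x) ≤ frac P + frac Q := by
  have := frac_le_sum (M := M) (Finset.univ : Finset Bool) (P := fun x => P x ∨ Q x)
    (Q := fun b => bif b then P else Q) (fun x hx => by
      rcases hx with h | h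
      · exact ⟨true, Finset.mem_univ _, h⟩
      · exact ⟨false, Finset.mem_univ _, h⟩)
  simpa using this

open Classical in
theorem frac_eq_sum (P : M → Prop) :
    frac P = (∑ x, if P x then (1 : ℝ) else 0) / Fintype.card M := by
  simp [frac]

/-- Markov's inequality. -/
theorem frac_lt_le {f : M → ℝ} (hf : ∀ x, 0 ≤ f x) {t : ℝ} (ht : 0 < t) :
    frac (fun x => t < f x) ≤ (∑ x, f x) / Fintype.card M / t := by
  classical
  rw [frac_eq_sum, div_right_comm]
  gcongr
  rw [le_div_iff₀ ht, Finset.sum_mul]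
  refine Finset.sum_le_sum fun x _ => ?_
  split_ifs with h
  · rw [one_mul]; exact h.le
  · rw [zero_mul]; exact hf x

/-- The fibres are cosets of the kernel, so they all have the same size. -/
theorem frac_fiber {N : Type*} [AddCommGroup M] [AddCommGroup N] [Fintype N] (φ : M →+ N)
    (hφ : Function.Surjective φ) (b : N) : frac (fun x => φ x = b) = (Fintype.card N : ℝ)⁻¹ := by
  classical
  have h1 : ∀ c, (Finset.univ.filter fun x => φ x = c).card =
      (Finset.univ.filter fun x => φ x = b).card := fun c =>
    AddMonoidHom.card_fiber_eq_of_mem_range φ (hφ c) (hφ b)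
  have h2 : Fintype.card M = Fintype.card N * (Finset.univ.filter fun x => φ x = b).card := by
    rw [← Finset.card_univ, Finset.card_eq_sum_card_fiberwise (f := φ) (t := Finset.univ)
      (fun x _ => Finset.mem_univ _), Finset.sum_congr rfl fun c _ => h1 c]
    simp
  have h3 : (Fintype.card M : ℝ) ≠ 0 := by
    have : Nonempty M := ⟨0⟩
    exact_mod_cast Fintype.card_ne_zero
  have h4 : frac (fun x => φ x = b) =
      ((Finset.univ.filter fun x => φ x = b).card : ℝ) / Fintype.card M := by
    unfold frac; congr!
  rw [h4]
  have h5 : (Fintype.card M : ℝ) =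
      Fintype.card N * (Finset.univ.filter fun x => φ x = b).card := by exact_mod_cast h2
  rw [h5] at h3 ⊢
  have := left_ne_zero_of_mul h3
  have := right_ne_zero_of_mul h3
  field_simp

end Frac

/-! ### Union bounds over the ensemble -/

/-- The support of a vector. -/
def supp {k : ℕ} {A : Type*} [Zero A] [DecidableEq A] (u : Fin k → A) : Finset (Fin k) :=
  Finset.univ.filter fun i => u i ≠ 0

@[simp] theorem mem_supp {k : ℕ} {A : Type*} [Zero A] [DecidableEq A] {u : Fin k → A} {i : Fin k} :
    i ∈ supp u ↔ u i ≠ 0 := by simp [supp]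

theorem supp_eq_empty {k : ℕ} {A : Type*} [Zero A] [DecidableEq A] {u : Fin k → A} :
    supp u = ∅ ↔ u = 0 := by
  rw [Finset.eq_empty_iff_forall_notMem]
  simp [funext_iff]

theorem mem_nbrV {n m : ℕ} {E : Finset (Fin n × Fin m)} {S : Finset (Fin n)} {j : Fin m} :
    j ∈ nbrV E S ↔ ∃ i ∈ S, (i, j) ∈ E := by
  simp [nbrV, and_comm]

theorem mem_nbrC {n m : ℕ} {E : Finset (Fin n × Fin m)} {T : Finset (Fin m)} {i : Fin n} :
    i ∈ nbrC E T ↔ ∃ j ∈ T, (i, j) ∈ E := by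
  simp [nbrC, and_comm]

/-- The integer points with support in `S` in the ball of radius `r` around `c`. -/
noncomputable def supported {n : ℕ} (c : Euc n) (r : ℝ) (S : Finset (Fin n)) :
    Finset (Fin n → ℤ) :=
  (intPoints c r).filter fun x => ∀ i ∉ S, x i = 0

theorem mem_supported {n : ℕ} {c : Euc n} {r : ℝ} {S : Finset (Fin n)} {x : Fin n → ℤ} :
    x ∈ supported c r S ↔ ‖intVec x - c‖ ≤ r ∧ ∀ i ∉ S, x i = 0 := by
  simp [supported]

theorem card_supported_le {n : ℕ} {τ : ℝ} (hτ : 0 < τ) (c : Euc n) (r : ℝ) (S : Finset (Fin n)) :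
    ((supported c r S).card : ℝ) ≤ Real.exp (τ * r ^ 2) * (2 + √(Real.pi / τ)) ^ S.card :=
  card_le_of_support_subset hτ c S _ (fun _ hx => (mem_supported.1 hx).1)
    fun _ hx => (mem_supported.1 hx).2

section Ensemble

variable {p n m : ℕ} [Fact p.Prime] (E : Finset (Fin n × Fin m))

theorem parityCheck_add (h h' : Matrix (Fin m) (Fin n) (ZMod p)) :
    parityCheck E (h + h') = parityCheck E h + parityCheck E h' := by
  ext j i
  by_cases hE : (i, j) ∈ E <;> simp [parityCheck, hE]

/-- Each check adjacent to the support of `y` owns an edge with `y i ≠ 0`, and varying that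
coefficient moves only its own coordinate of the product. Those coordinates are therefore jointly
uniform. -/
theorem frac_mulVec_eq_zero_le (y : Fin n → ZMod p) :
    frac (fun h : Matrix (Fin m) (Fin n) (ZMod p) => (parityCheck E h).mulVec y = 0) ≤
      ((p : ℝ) ^ (nbrV E (supp y)).card)⁻¹ := by
  have hpiv : ∀ j : nbrV E (supp y), ∃ i, y i ≠ 0 ∧ (i, j.1) ∈ E := fun j => by
    simpa using mem_nbrV.1 j.2
  choose piv hpiv0 hpivE using hpiv
  let φ : Matrix (Fin m) (Fin n) (ZMod p) →+ (nbrV E (supp y) → ZMod p) :=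
    { toFun := fun h j => (parityCheck E h).mulVec y j
      map_zero' := by
        ext j
        have : parityCheck E (0 : Matrix (Fin m) (Fin n) (ZMod p)) = 0 := by
          ext; simp [parityCheck]
        simp [this]
      map_add' := fun h h' => by
        ext j
        simp [parityCheck_add, Matrix.add_mulVec] }
  have hφ : Function.Surjective φ := by
    intro b
    refine ⟨Matrix.of fun j i => if hj : j ∈ nbrV E (supp y) then
      (if i = piv ⟨j, hj⟩ then b ⟨j, hj⟩ / y i else 0) else 0, ?_⟩
    ext j
    change (parityCheck E _).mulVec y j = b j
    rw [Matrix.mulVec, dotProduct, Finset.sum_eq_single (piv j)]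
    · simp [parityCheck, hpivE, hpiv0]
    · intro i _ hi
      simp [parityCheck, hi]
    · simp
  refine (frac_mono (Q := fun h => φ h = 0) fun h hh => ?_).trans_eq ?_
  · ext j
    exact congrFun hh j
  · rw [frac_fiber φ hφ]
    simp [ZMod.card]

/-- The transposed argument. The target is arbitrary because short dual codewords, not only
dependencies among rows, have to be excluded. -/
theorem frac_vecMul_eq_le (u : Fin m → ZMod p) (x : Fin n → ZMod p) :
    frac (fun h : Matrix (Fin m) (Fin n) (ZMod p) => Matrix.vecMul u (parityCheck E h) = x) ≤
      ((p : ℝ) ^ (nbrC E (supp u)).card)⁻¹ := by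
  have hpiv : ∀ i : nbrC E (supp u), ∃ j, u j ≠ 0 ∧ (i.1, j) ∈ E := fun i => by
    simpa using mem_nbrC.1 i.2
  choose piv hpiv0 hpivE using hpiv
  let φ : Matrix (Fin m) (Fin n) (ZMod p) →+ (nbrC E (supp u) → ZMod p) :=
    { toFun := fun h i => Matrix.vecMul u (parityCheck E h) i
      map_zero' := by
        ext j
        have : parityCheck E (0 : Matrix (Fin m) (Fin n) (ZMod p)) = 0 := by
          ext; simp [parityCheck]
        simp [this]
      map_add' := fun h h' => by
        ext j
        simp [parityCheck_add, Matrix.vecMul_add] }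
  have hφ : Function.Surjective φ := by
    intro b
    refine ⟨Matrix.of fun j i => if hi : i ∈ nbrC E (supp u) then
      (if j = piv ⟨i, hi⟩ then b ⟨i, hi⟩ / u j else 0) else 0, ?_⟩
    ext i
    change Matrix.vecMul u (parityCheck E _) i = b i
    rw [Matrix.vecMul, dotProduct, Finset.sum_eq_single (piv i)]
    · simp [parityCheck, hpivE, hpiv0, mul_div_cancel₀]
    · intro j _ hj
      simp [parityCheck, hj]
    · simp
  refine (frac_mono (Q := fun h => φ h = fun i => x i.1) fun h hh => ?_).trans_eq ?_
  · ext i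
    exact congrFun hh i
  · rw [frac_fiber φ hφ]
    simp [ZMod.card]

theorem supp_subset_of_vecMul_eq {h : Matrix (Fin m) (Fin n) (ZMod p)} {u : Fin m → ZMod p}
    {x : Fin n → ZMod p} (hx : Matrix.vecMul u (parityCheck E h) = x) :
    supp x ⊆ nbrC E (supp u) := by
  intro i hi
  rw [mem_supp, ← hx, Matrix.vecMul, dotProduct] at hi
  obtain ⟨j, -, hj⟩ := Finset.exists_ne_zero_of_sum_ne_zero hi
  have hE : (i, j) ∈ E := by
    by_contra hE
    simp [parityCheck, hE] at hj
  exact mem_nbrC.2 ⟨j, mem_supp.2 (left_ne_zero_of_mul hj), hE⟩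

theorem sum_supp_le {f : Finset (Fin m) → ℝ} (hf : ∀ T, 0 ≤ f T) :
    ∑ u ∈ (Finset.univ : Finset (Fin m → ZMod p)).erase 0, f (supp u) ≤
      ∑ T ∈ Finset.univ.erase ∅, (p : ℝ) ^ T.card * f T := by
  classical
  rw [← Finset.sum_fiberwise_of_maps_to (t := Finset.univ.erase ∅) (g := supp)]
  · refine Finset.sum_le_sum fun T _ => ?_
    rw [Finset.sum_congr rfl (g := fun _ => f T) fun u hu => by
      rw [(Finset.mem_filter.1 hu).2], Finset.sum_const, nsmul_eq_mul]
    refine mul_le_mul_of_nonneg_right ?_ (hf T)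
    have : (Finset.filter (fun u : Fin m → ZMod p => supp u = T) (Finset.univ.erase 0)).card ≤
        (Finset.univ : Finset (T → ZMod p)).card := by
      refine Finset.card_le_card_of_injOn (fun u i => u i) (fun _ _ => Finset.mem_coe.2 (Finset.mem_univ _)) ?_
      intro u hu v hv huv
      have hu' := (Finset.mem_filter.1 (Finset.mem_coe.1 hu)).2
      have hv' := (Finset.mem_filter.1 (Finset.mem_coe.1 hv)).2
      ext i
      by_cases hi : i ∈ T
      · exact congrFun huv ⟨i, hi⟩
      · have h1 : u i = 0 := by
          by_contra h; exact hi (hu' ▸ mem_supp.2 h)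
        have h2 : v i = 0 := by
          by_contra h; exact hi (hv' ▸ mem_supp.2 h)
        rw [h1, h2]
    have h2 : (Finset.univ : Finset (T → ZMod p)).card = p ^ T.card := by
      simp [ZMod.card]
    rw [h2] at this
    exact_mod_cast this
  · intro u hu
    have := (Finset.mem_erase.1 hu).1
    exact Finset.mem_erase.2 ⟨fun h => this (supp_eq_empty.1 h), Finset.mem_univ _⟩

theorem frac_not_surjective_le :
    frac (fun h : Matrix (Fin m) (Fin n) (ZMod p) =>
        ¬ Function.Surjective (parityCheck E h).mulVecLin) ≤
      ∑ T ∈ Finset.univ.erase ∅, (p : ℝ) ^ T.card * ((p : ℝ) ^ (nbrC E T).card)⁻¹ := by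
  refine (frac_le_sum ((Finset.univ : Finset (Fin m → ZMod p)).erase 0)
    (Q := fun u h => Matrix.vecMul u (parityCheck E h) = 0) fun h hh => ?_).trans ?_
  · obtain ⟨u, hu0, hu⟩ := exists_vecMul_eq_zero hh
    exact ⟨u, Finset.mem_erase.2 ⟨hu0, Finset.mem_univ _⟩, hu⟩
  · exact (Finset.sum_le_sum fun u _ => frac_vecMul_eq_le E u 0).trans
      (sum_supp_le (f := fun T => ((p : ℝ) ^ (nbrC E T).card)⁻¹) fun T => by positivity)

/-- No nonzero integer of absolute value below `p` is divisible by `p`. -/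
theorem supp_reduce {x : Fin n → ℤ} (hx : ‖intVec x‖ < p) : supp (reduce p x) = supp x := by
  ext i
  rw [mem_supp, mem_supp, not_iff_not]
  constructor
  · intro h
    rw [reduce, ZMod.intCast_zmod_eq_zero_iff_dvd] at h
    refine Int.eq_zero_of_abs_lt_dvd h ?_
    have h1 := (abs_apply_le_norm (intVec x) i).trans_lt hx
    rw [intVec_apply] at h1
    refine (Int.cast_lt (R := ℝ)).1 ?_
    simpa using h1
  · intro h; simp [reduce, h]

theorem intVec_eq_zero {x : Fin n → ℤ} : intVec x = 0 ↔ x = 0 := by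
  have : intVec (0 : Fin n → ℤ) = 0 := by ext; simp
  rw [← this, intVec_injective.eq_iff]

/-- First moment, grouped by support. The ball lies inside the one of radius `2 * r < p` about the
origin, so reduction modulo `p` preserves supports. -/
theorem frac_exists_codeword_le {c : Euc n} {r : ℝ} (hc : ‖c‖ ≤ r) (hr : 2 * r < p) :
    frac (fun h : Matrix (Fin m) (Fin n) (ZMod p) =>
        ∃ y ∈ constructionA (code (parityCheck E h)), y ≠ 0 ∧ ‖y - c‖ ≤ r) ≤
      ∑ S ∈ Finset.univ.erase ∅,
        ((supported c r S).card : ℝ) * ((p : ℝ) ^ (nbrV E S).card)⁻¹ := by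
  classical
  have hlt : ∀ x ∈ (intPoints c r).erase 0, ‖intVec x‖ < p := by
    intro x hx
    have h1 := mem_intPoints.1 (Finset.mem_erase.1 hx).2
    have := norm_sub_norm_le (intVec x) c
    linarith
  refine (frac_le_sum ((intPoints c r).erase 0)
    (Q := fun x h => (parityCheck E h).mulVec (reduce p x) = 0) ?_).trans ?_
  · rintro h ⟨y, hy, hy0, hyr⟩
    obtain ⟨x, rfl, hx⟩ := mem_constructionA.1 hy
    exact ⟨x, Finset.mem_erase.2 ⟨fun h => hy0 (intVec_eq_zero.2 h), mem_intPoints.2 hyr⟩, hx⟩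
  · calc ∑ x ∈ (intPoints c r).erase 0, frac (fun h : Matrix (Fin m) (Fin n) (ZMod p) =>
          (parityCheck E h).mulVec (reduce p x) = 0)
        ≤ ∑ x ∈ (intPoints c r).erase 0, ((p : ℝ) ^ (nbrV E (supp x)).card)⁻¹ := by
          refine Finset.sum_le_sum fun x hx => ?_
          rw [← supp_reduce (hlt x hx)]
          exact frac_mulVec_eq_zero_le E _
      _ = ∑ S ∈ Finset.univ.erase ∅, ∑ x ∈ (intPoints c r).erase 0 with supp x = S,
            ((p : ℝ) ^ (nbrV E (supp x)).card)⁻¹ := by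
          refine (Finset.sum_fiberwise_of_maps_to (fun x hx => ?_) _).symm
          exact Finset.mem_erase.2 ⟨fun h => (Finset.mem_erase.1 hx).1 (supp_eq_empty.1 h),
            Finset.mem_univ _⟩
      _ ≤ _ := by
          refine Finset.sum_le_sum fun S _ => ?_
          rw [Finset.sum_congr rfl (g := fun _ => ((p : ℝ) ^ (nbrV E S).card)⁻¹) fun u hu => by
            rw [(Finset.mem_filter.1 hu).2], Finset.sum_const, nsmul_eq_mul]
          gcongr
          intro x hx
          rw [Finset.mem_filter, Finset.mem_erase, mem_intPoints] at hx
          refine mem_supported.2 ⟨hx.1.2, fun i hi => ?_⟩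
          by_contra h
          exact hi (hx.2 ▸ mem_supp.2 h)

/-- A short vector is encoded by a pair `(u, x)`: the combination `u` of rows, and an integer point
`x` whose support must lie in the neighbourhood of that of `u`. -/
theorem frac_exists_dual_codeword_le {r : ℝ} (hr : r < p) :
    frac (fun h : Matrix (Fin m) (Fin n) (ZMod p) =>
        ∃ y ∈ constructionA (rowSpace (parityCheck E h)), y ≠ 0 ∧ ‖y‖ ≤ r) ≤
      ∑ T ∈ Finset.univ.erase ∅, (p : ℝ) ^ T.card *
        (((supported 0 r (nbrC E T)).card : ℝ) * ((p : ℝ) ^ (nbrC E T).card)⁻¹) := by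
  classical
  refine (frac_le_sum (((Finset.univ : Finset (Fin m → ZMod p)).erase 0).sigma
      fun u => supported 0 r (nbrC E (supp u)))
    (Q := fun a h => Matrix.vecMul a.1 (parityCheck E h) = reduce p a.2) ?_).trans ?_
  · rintro h ⟨y, hy, hy0, hyr⟩
    obtain ⟨x, rfl, hx⟩ := mem_constructionA.1 hy
    obtain ⟨u, hu⟩ := mem_rowSpace.1 hx
    have hsupp := supp_reduce (hyr.trans_lt hr)
    refine ⟨⟨u, x⟩, Finset.mem_sigma.2 ⟨Finset.mem_erase.2 ⟨?_, Finset.mem_univ _⟩,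
      mem_supported.2 ⟨by simpa using hyr, fun i hi => ?_⟩⟩, hu⟩
    · rintro rfl
      rw [Matrix.zero_vecMul] at hu
      rw [← hu] at hsupp
      have h0 : supp (0 : Fin n → ZMod p) = ∅ := supp_eq_empty.2 rfl
      rw [h0] at hsupp
      exact hy0 (intVec_eq_zero.2 (supp_eq_empty.1 hsupp.symm))
    · by_contra h
      refine hi (supp_subset_of_vecMul_eq E hu ?_)
      rw [hsupp]
      exact mem_supp.2 h
  · rw [Finset.sum_sigma]
    calc ∑ u ∈ Finset.univ.erase (0 : Fin m → ZMod p), ∑ x ∈ supported 0 r (nbrC E (supp u)),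
          frac (fun h : Matrix (Fin m) (Fin n) (ZMod p) =>
            Matrix.vecMul u (parityCheck E h) = reduce p x)
        ≤ ∑ u ∈ Finset.univ.erase (0 : Fin m → ZMod p),
            ((supported 0 r (nbrC E (supp u))).card : ℝ) *
              ((p : ℝ) ^ (nbrC E (supp u)).card)⁻¹ := by
          refine Finset.sum_le_sum fun u _ => ?_
          rw [← nsmul_eq_mul]
          exact Finset.sum_le_card_nsmul _ _ _ fun x _ => frac_vecMul_eq_le E u _
      _ ≤ _ := sum_supp_le (f := fun T => ((supported 0 r (nbrC E T)).card : ℝ) *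
              ((p : ℝ) ^ (nbrC E T).card)⁻¹) fun T => by positivity

/-- The second moment method: a bound on the number of values that a function misses. -/
theorem card_missed_mul_le {X W : Type*} [Fintype W] [DecidableEq W] [DecidableEq X]
    (s : Finset X) (f : X → W) :
    ((Finset.univ.filter fun w => ∀ x ∈ s, f x ≠ w).card : ℝ) * (s.card : ℝ) ^ 2 ≤
      Fintype.card W * (Fintype.card W *
        ((s ×ˢ s).filter fun a => f a.1 = f a.2).card - (s.card : ℝ) ^ 2) := by
  set N : W → ℝ := fun w => ((s.filter fun x => f x = w).card : ℝ) with hN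
  set Z := Finset.univ.filter fun w => ∀ x ∈ s, f x ≠ w with hZ
  have hNZ : ∀ w ∈ Z, N w = 0 := by
    intro w hw
    rw [hN]
    simp only [Nat.cast_eq_zero, Finset.card_eq_zero, Finset.filter_eq_empty_iff]
    exact (Finset.mem_filter.1 hw).2
  have hsum : ∑ w, N w = s.card := by
    rw [Finset.card_eq_sum_card_fiberwise (f := f) (t := Finset.univ) fun _ _ => Finset.mem_coe.2 (Finset.mem_univ _)]
    push_cast; rfl
  have hsq : ∑ w, N w ^ 2 = ((s ×ˢ s).filter fun a => f a.1 = f a.2).card := by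
    rw [Finset.card_eq_sum_card_fiberwise (f := fun a : X × X => f a.1) (t := Finset.univ)
      fun _ _ => Finset.mem_coe.2 (Finset.mem_univ _)]
    push_cast
    refine Finset.sum_congr rfl fun w _ => ?_
    simp only [hN, sq]
    norm_cast
    rw [← Finset.card_product]
    congr 1
    ext ⟨a, b⟩
    simp only [Finset.mem_product, Finset.mem_filter]
    constructor
    · rintro ⟨⟨h1, h2⟩, h3, h4⟩
      exact ⟨⟨⟨h1, h3⟩, h2.trans h4.symm⟩, h2⟩
    · rintro ⟨⟨⟨h1, h3⟩, h4⟩, h2⟩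
      exact ⟨⟨h1, h2⟩, h3, h4.symm.trans h2⟩
  -- Cauchy–Schwarz restricted to the values that are not missed.
  have hcs : (s.card : ℝ) ^ 2 ≤ (Fintype.card W - Z.card) * ∑ w, N w ^ 2 := by
    have h1 : ∑ w ∈ Zᶜ, N w = s.card := by
      rw [← hsum, ← Finset.sum_compl_add_sum Z, Finset.sum_eq_zero hNZ, add_zero]
    have h2 : ∑ w ∈ Zᶜ, N w ^ 2 = ∑ w, N w ^ 2 := by
      rw [← Finset.sum_compl_add_sum Z, Finset.sum_eq_zero (s := Z), add_zero]
      intro w hw; rw [hNZ w hw]; ring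
    have h3 : ((Zᶜ : Finset W).card : ℝ) = Fintype.card W - Z.card := by
      rw [Finset.card_compl, Nat.cast_sub (Finset.card_le_univ Z)]
    have := sq_sum_le_card_mul_sum_sq (s := Zᶜ) (f := N)
    rwa [h1, h2, h3] at this
  rw [hsq] at hcs
  set P := (((s ×ˢ s).filter fun a => f a.1 = f a.2).card : ℝ) with hP
  have hP0 : 0 ≤ P := Nat.cast_nonneg _
  have hZ0 : (0 : ℝ) ≤ Z.card := Nat.cast_nonneg _
  have hZW : (Z.card : ℝ) ≤ Fintype.card W := by exact_mod_cast Finset.card_le_univ Z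
  -- Multiplying `hcs` by `card W + card Z` leaves the slack `card Z ^ 2 * P`.
  nlinarith [mul_nonneg hZ0 hP0, mul_le_mul_of_nonneg_left hcs hZ0,
    mul_le_mul_of_nonneg_left hcs (sub_nonneg.2 hZW), mul_nonneg (mul_nonneg hZ0 hP0) hZ0]

/-- The left side is at most `p ^ |T₀|`, with `T₀` the checks not touching the support of `y`.
Replacing this by a sum over all candidates `T` lets the sum over pairs `y = x - x'` be exchanged
with it. -/
theorem pow_mul_frac_le (y : Fin n → ZMod p) :
    (p : ℝ) ^ m * frac (fun h : Matrix (Fin m) (Fin n) (ZMod p) =>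
      (parityCheck E h).mulVec y = 0) ≤
      1 + ∑ T ∈ Finset.univ.erase ∅, if ∀ i ∈ nbrC E T, y i = 0 then (p : ℝ) ^ T.card else 0 := by
  classical
  have hp : (0 : ℝ) < p := by exact_mod_cast (Fact.out : p.Prime).pos
  set T₀ := (nbrV E (supp y))ᶜ with hT₀
  have h0 : ∀ i ∈ nbrC E T₀, y i = 0 := by
    intro i hi
    obtain ⟨j, hj, hij⟩ := mem_nbrC.1 hi
    by_contra h
    exact Finset.mem_compl.1 hj (mem_nbrV.2 ⟨i, mem_supp.2 h, hij⟩)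
  have hcard : T₀.card + (nbrV E (supp y)).card = m := by
    rw [hT₀, Finset.card_compl_add_card, Fintype.card_fin]
  have h1 : (p : ℝ) ^ m * frac (fun h : Matrix (Fin m) (Fin n) (ZMod p) =>
      (parityCheck E h).mulVec y = 0) ≤ (p : ℝ) ^ T₀.card := by
    refine (mul_le_mul_of_nonneg_left (frac_mulVec_eq_zero_le E y) (by positivity)).trans_eq ?_
    have e : (p : ℝ) ^ m = (p : ℝ) ^ T₀.card * (p : ℝ) ^ (nbrV E (supp y)).card := by
      rw [← pow_add, hcard]
    rw [e, mul_inv_cancel_right₀ (by positivity)]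
  have hnn : ∀ T ∈ Finset.univ.erase ∅,
      0 ≤ if ∀ i ∈ nbrC E T, y i = 0 then (p : ℝ) ^ T.card else 0 := by
    intro T _; split_ifs <;> positivity
  refine h1.trans ?_
  by_cases hT : T₀ = ∅
  · rw [hT, Finset.card_empty, pow_zero]
    linarith [Finset.sum_nonneg hnn]
  · have := Finset.single_le_sum hnn (Finset.mem_erase.2 ⟨hT, Finset.mem_univ T₀⟩)
    rw [if_pos h0] at this
    linarith

/-- The second moment method averaged over the ensemble: the excess of collisions comes from pairs
whose difference vanishes on some `nbrC E T`. These are counted by fixing one point of the pair and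
recentring the ball, so `hK` must hold for all centres. -/
theorem sum_card_missed_le {r : ℝ} (hr : 2 * r < p) {K : Finset (Fin n) → ℝ}
    (hK : ∀ c S, ((supported c r S).card : ℝ) ≤ K S) (c : Euc n)
    (hX : 0 < (intPoints c r).card) :
    (∑ h : Matrix (Fin m) (Fin n) (ZMod p), ((Finset.univ.filter fun w => ∀ x ∈ intPoints c r,
        (parityCheck E h).mulVec (reduce p x) ≠ w).card : ℝ)) /
        Fintype.card (Matrix (Fin m) (Fin n) (ZMod p)) ≤
      (p : ℝ) ^ m * (((intPoints c r).card : ℝ)⁻¹ *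
        ∑ T ∈ Finset.univ.erase ∅, (p : ℝ) ^ T.card * K (nbrC E T)ᶜ) := by
  classical
  set X := intPoints c r with hXdef
  set M := Matrix (Fin m) (Fin n) (ZMod p)
  have hX0 : (0 : ℝ) < X.card := by exact_mod_cast hX
  have hM0 : (0 : ℝ) < Fintype.card M := by exact_mod_cast Fintype.card_pos
  have hp : (0 : ℝ) < p := by exact_mod_cast (Fact.out : p.Prime).pos
  have hW : (Fintype.card (Fin m → ZMod p) : ℝ) = (p : ℝ) ^ m := by simp [ZMod.card]
  have hpairs : (∑ h : M, (((X ×ˢ X).filter fun a =>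
      (parityCheck E h).mulVec (reduce p a.1) = (parityCheck E h).mulVec (reduce p a.2)).card : ℝ)) /
        Fintype.card M = ∑ a ∈ X ×ˢ X, frac fun h : M =>
          (parityCheck E h).mulVec (reduce p (a.1 - a.2)) = 0 := by
    simp_rw [frac_eq_sum, ← Finset.sum_div]
    congr 1
    rw [Finset.sum_comm]
    refine Finset.sum_congr rfl fun h _ => ?_
    rw [Finset.card_filter]
    push_cast
    refine Finset.sum_congr rfl fun a _ => ?_
    simp only [reduce_sub, Matrix.mulVec_sub, sub_eq_zero]
  have hcount : ∀ T, ((((X ×ˢ X).filter fun a => ∀ i ∈ nbrC E T,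
      reduce p (a.1 - a.2) i = 0).card : ℝ)) ≤ X.card * K (nbrC E T)ᶜ := by
    intro T
    have h1 : ((X ×ˢ X).filter fun a => ∀ i ∈ nbrC E T, reduce p (a.1 - a.2) i = 0).card =
        ∑ x ∈ X, (X.filter fun x' => ∀ i ∈ nbrC E T, reduce p (x' - x) i = 0).card := by
      rw [Finset.card_filter, Finset.sum_product_right]
      simp_rw [Finset.card_filter]
    rw [h1]
    push_cast
    rw [← nsmul_eq_mul]
    refine Finset.sum_le_card_nsmul _ _ _ fun x hx => ?_
    refine le_trans ?_ (hK (c - intVec x) _)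
    norm_cast
    refine Finset.card_le_card_of_injOn (fun x' => x' - x) ?_ (fun a _ b _ hab => sub_left_injective hab)
    intro x' hx'
    rw [Finset.mem_coe, Finset.mem_filter] at hx'
    rw [Finset.mem_coe, mem_supported, intVec_sub]
    have h2 := mem_intPoints.1 hx'.1
    have h3 := mem_intPoints.1 hx
    refine ⟨by rwa [sub_sub_sub_cancel_right], fun i hi => ?_⟩
    rw [Finset.mem_compl, not_not] at hi
    have h4 : ‖intVec (x' - x)‖ < p := by
      rw [intVec_sub, ← sub_sub_sub_cancel_right _ _ c]
      exact (norm_sub_le _ _).trans_lt (by linarith)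
    have h5 := hx'.2 i hi
    by_contra h6
    have h7 : i ∈ supp (x' - x) := mem_supp.2 h6
    rw [← supp_reduce h4, mem_supp] at h7
    exact h7 h5
  have hmain : (p : ℝ) ^ m * (∑ a ∈ X ×ˢ X, frac fun h : M =>
          (parityCheck E h).mulVec (reduce p (a.1 - a.2)) = 0) ≤
      (X.card : ℝ) ^ 2 + X.card * ∑ T ∈ Finset.univ.erase ∅, (p : ℝ) ^ T.card * K (nbrC E T)ᶜ := by
    calc (p : ℝ) ^ m * (∑ a ∈ X ×ˢ X, frac fun h : M =>
          (parityCheck E h).mulVec (reduce p (a.1 - a.2)) = 0)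
        ≤ ∑ a ∈ X ×ˢ X, (1 + ∑ T ∈ Finset.univ.erase ∅,
          if ∀ i ∈ nbrC E T, reduce p (a.1 - a.2) i = 0 then (p : ℝ) ^ T.card else 0) := by
          rw [Finset.mul_sum]
          exact Finset.sum_le_sum fun a _ => pow_mul_frac_le E _
      _ = (X.card : ℝ) ^ 2 + ∑ T ∈ Finset.univ.erase ∅, (p : ℝ) ^ T.card *
          (((X ×ˢ X).filter fun a => ∀ i ∈ nbrC E T, reduce p (a.1 - a.2) i = 0).card : ℝ) := by
          rw [Finset.sum_add_distrib, Finset.sum_comm]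
          congr 1
          · simp [sq]
          · refine Finset.sum_congr rfl fun T _ => ?_
            rw [← Finset.sum_filter, Finset.sum_const, nsmul_eq_mul, mul_comm]
      _ ≤ _ := by
          rw [Finset.mul_sum]
          refine add_le_add le_rfl (Finset.sum_le_sum fun T _ => ?_)
          calc _ ≤ (p : ℝ) ^ T.card * (X.card * K (nbrC E T)ᶜ) :=
                mul_le_mul_of_nonneg_left (hcount T) (by positivity)
            _ = _ := by ring
  have hcheb : ∀ h : M, ((Finset.univ.filter fun w => ∀ x ∈ X,
        (parityCheck E h).mulVec (reduce p x) ≠ w).card : ℝ) ≤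
      (p : ℝ) ^ m * ((p : ℝ) ^ m * (((X ×ˢ X).filter fun a =>
      (parityCheck E h).mulVec (reduce p a.1) = (parityCheck E h).mulVec (reduce p a.2)).card : ℝ)
        - (X.card : ℝ) ^ 2) / (X.card : ℝ) ^ 2 := by
    intro h
    rw [le_div_iff₀ (by positivity), ← hW]
    exact card_missed_mul_le X fun x => (parityCheck E h).mulVec (reduce p x)
  calc _ ≤ (∑ h : M, (p : ℝ) ^ m * ((p : ℝ) ^ m * (((X ×ˢ X).filter fun a =>
      (parityCheck E h).mulVec (reduce p a.1) = (parityCheck E h).mulVec (reduce p a.2)).card : ℝ)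
        - (X.card : ℝ) ^ 2) / (X.card : ℝ) ^ 2) / Fintype.card M := by
        gcongr with h _
        exact hcheb h
    _ = (p : ℝ) ^ m * ((p : ℝ) ^ m * ((∑ h : M, (((X ×ˢ X).filter fun a =>
      (parityCheck E h).mulVec (reduce p a.1) = (parityCheck E h).mulVec (reduce p a.2)).card : ℝ)) /
        Fintype.card M) - (X.card : ℝ) ^ 2) / (X.card : ℝ) ^ 2 := by
        rw [← Finset.sum_div, ← Finset.mul_sum, Finset.sum_sub_distrib, ← Finset.mul_sum,
          Finset.sum_const, Finset.card_univ, nsmul_eq_mul]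
        field_simp
    _ ≤ _ := by
        rw [hpairs, div_le_iff₀ (by positivity)]
        have e : (p : ℝ) ^ m * ((X.card : ℝ)⁻¹ * ∑ T ∈ Finset.univ.erase ∅, (p : ℝ) ^ T.card *
            K (nbrC E T)ᶜ) * (X.card : ℝ) ^ 2 = (p : ℝ) ^ m * (X.card *
            ∑ T ∈ Finset.univ.erase ∅, (p : ℝ) ^ T.card * K (nbrC E T)ᶜ) := by
          field_simp
        rw [e]
        refine mul_le_mul_of_nonneg_left ?_ (by positivity)
        linarith

end Ensemble

/-! ### Expansion -/

section Graph

variable {n m : ℕ} {E : Finset (Fin n × Fin m)} {R α A β B ε ϑ : ℝ}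

theorem nbrV_mono {S S' : Finset (Fin n)} (h : S ⊆ S') : nbrV E S ⊆ nbrV E S' := by
  intro j hj
  obtain ⟨i, hi, hij⟩ := mem_nbrV.1 hj
  exact mem_nbrV.2 ⟨i, h hi, hij⟩

theorem nbrC_compl_subset (S : Finset (Fin n)) : nbrC E (nbrV E S)ᶜ ⊆ Sᶜ := by
  intro i hi
  obtain ⟨j, hj, hij⟩ := mem_nbrC.1 hi
  rw [Finset.mem_compl] at hj ⊢
  exact fun h => hj (mem_nbrV.2 ⟨i, h, hij⟩)

theorem nbrV_compl_subset (T : Finset (Fin m)) : nbrV E (nbrC E T)ᶜ ⊆ Tᶜ := by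
  intro j hj
  obtain ⟨i, hi, hij⟩ := mem_nbrV.1 hj
  rw [Finset.mem_compl] at hi ⊢
  exact fun h => hi (mem_nbrC.2 ⟨j, h, hij⟩)

theorem IsGoodGraph.half_le_card_nbrV (hE : IsGoodGraph R α A β B ε ϑ E) (hα : 1 ≤ α)
    (hm : (m : ℝ) = n * (1 - R)) {S : Finset (Fin n)}
    (hS : ⌈n * (1 - R) / (2 * α)⌉₊ ≤ S.card) : (m : ℝ) / 2 ≤ (nbrV E S).card := by
  obtain ⟨S', hS', hcard⟩ := Finset.exists_subset_card_eq hS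
  have h1 := hE.L2 S' hcard.le
  have h2 : n * (1 - R) / (2 * α) ≤ S'.card := by rw [hcard]; exact Nat.le_ceil _
  have h3 : ((nbrV E S').card : ℝ) ≤ (nbrV E S).card := by
    exact_mod_cast Finset.card_le_card (nbrV_mono hS')
  rw [div_le_iff₀ (by linarith)] at h2
  rw [hm]
  linarith

/-- At most half of the checks miss `S`, so (R2) applies to them, and their neighbours all lie
outside `S`. -/
theorem IsGoodGraph.sub_div_le_card_nbrV (hE : IsGoodGraph R α A β B ε ϑ E) (hα : 1 ≤ α)
    (hβ : 0 < β) (hm : (m : ℝ) = n * (1 - R)) {S : Finset (Fin n)}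
    (hS : n * (1 - R) / (2 * α) < S.card) : (m : ℝ) - (n - S.card) / β ≤ (nbrV E S).card := by
  have h1 := hE.half_le_card_nbrV hα hm (Nat.ceil_le.2 hS.le)
  have h2 : (((nbrV E S)ᶜ).card : ℝ) = m - (nbrV E S).card := by
    rw [Finset.card_compl, Nat.cast_sub (Finset.card_le_univ _), Fintype.card_fin]
  have h3 := hE.R2 (nbrV E S)ᶜ (by rw [h2, ← hm]; linarith)
  have h4 : ((nbrC E (nbrV E S)ᶜ).card : ℝ) ≤ n - S.card := by
    have : (((Sᶜ : Finset (Fin n)).card : ℕ) : ℝ) = n - S.card := by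
      rw [Finset.card_compl, Nat.cast_sub (Finset.card_le_univ _), Fintype.card_fin]
    rw [← this]
    exact_mod_cast Finset.card_le_card (nbrC_compl_subset S)
  rw [h2] at h3
  have h5 : (m : ℝ) - (nbrV E S).card ≤ (n - S.card) / β := by
    rw [le_div_iff₀ hβ]; linarith
  linarith

/-- The neighbours of `(nbrC E T)ᶜ` avoid `T`, so they are fewer than `m / 2`. This puts `(nbrC E
T)ᶜ` below the threshold of (L2), and it injects in size into `Tᶜ` because `α ≥ 1`. -/
theorem IsGoodGraph.card_compl_nbrC_le (hE : IsGoodGraph R α A β B ε ϑ E) (hα : 1 ≤ α)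
    (hm : (m : ℝ) = n * (1 - R)) {T : Finset (Fin m)} (hT : (m : ℝ) / 2 < T.card) :
    (nbrC E T)ᶜ.card + T.card ≤ m := by
  have h1 : (nbrV E (nbrC E T)ᶜ).card + T.card ≤ m := by
    have h := Finset.card_le_card (nbrV_compl_subset (E := E) T)
    have h' := Finset.card_compl_add_card T
    rw [Fintype.card_fin] at h'
    omega
  have h1' : ((nbrV E (nbrC E T)ᶜ).card : ℝ) + T.card ≤ m := by exact_mod_cast h1
  by_cases hc : ⌈n * (1 - R) / (2 * α)⌉₊ ≤ (nbrC E T)ᶜ.card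
  · have := hE.half_le_card_nbrV hα hm hc
    linarith
  · have h2 := hE.L2 (nbrC E T)ᶜ (not_le.1 hc).le
    have h3 : ((nbrC E T)ᶜ.card : ℝ) ≤ α * ((nbrC E T)ᶜ.card : ℝ) :=
      le_mul_of_one_le_left (Nat.cast_nonneg _) hα
    have h4 : ((nbrC E T)ᶜ.card : ℝ) ≤ (nbrV E (nbrC E T)ᶜ).card := h3.trans h2
    have h5 : (nbrC E T)ᶜ.card ≤ (nbrV E (nbrC E T)ᶜ).card := by exact_mod_cast h4
    omega

/-- Double counting of the edges at `T`. -/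
theorem IsBiregular.mul_card_le {ΔV ΔC : ℕ} (hE : IsBiregular E ΔV ΔC) (T : Finset (Fin m)) :
    T.card * ΔC ≤ (nbrC E T).card * ΔV := by
  classical
  calc T.card * ΔC = (E.filter fun e => e.2 ∈ T).card := by
        have h := Finset.card_eq_sum_card_fiberwise (s := E.filter fun e => e.2 ∈ T) (f := Prod.snd)
          (t := T) fun e he => (Finset.mem_filter.1 (Finset.mem_coe.1 he)).2
        rw [h, Finset.sum_congr rfl (g := fun _ => ΔC)]
        · simp
        · intro j hj
          rw [← hE.2 j, Finset.filter_filter]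
          congr 1
          ext e
          simp only [Finset.mem_filter]
          exact ⟨fun h => ⟨h.1, h.2.2⟩, fun h => ⟨h.1, h.2 ▸ hj, h.2⟩⟩
    _ ≤ (E.filter fun e => e.1 ∈ nbrC E T).card := by
        refine Finset.card_le_card fun e he => ?_
        rw [Finset.mem_filter] at he ⊢
        exact ⟨he.1, mem_nbrC.2 ⟨e.2, he.2, he.1⟩⟩
    _ = (nbrC E T).card * ΔV := by
        have h := Finset.card_eq_sum_card_fiberwise (s := E.filter fun e => e.1 ∈ nbrC E T) (f := Prod.fst)
          (t := nbrC E T) fun e he => (Finset.mem_filter.1 (Finset.mem_coe.1 he)).2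
        rw [h, Finset.sum_congr rfl (g := fun _ => ΔV)]
        · simp
        · intro i hi
          rw [← hE.1 i, Finset.filter_filter]
          congr 1
          ext e
          simp only [Finset.mem_filter]
          exact ⟨fun h => ⟨h.1, h.2.2⟩, fun h => ⟨h.1, h.2 ▸ hi, h.2⟩⟩

end Graph

/-! ### Sums over sets of nodes -/

section Sums

theorem sum_pow_mul_pow_compl {k : ℕ} (a b : ℝ) :
    ∑ T : Finset (Fin k), a ^ T.card * b ^ (k - T.card) = (a + b) ^ k := by
  have := Finset.sum_pow_mul_eq_add_pow a b (Finset.univ : Finset (Fin k))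
  simpa using this

theorem sum_pow_card {k : ℕ} (a : ℝ) : ∑ T : Finset (Fin k), a ^ T.card = (1 + a) ^ k := by
  have := sum_pow_mul_pow_compl (k := k) a 1
  simpa [add_comm] using this

/-- The common shape of the union bounds: small sets decay geometrically in their size, medium sets
share one bound, and large sets have a majorant that can be summed exactly. -/
theorem sum_le_three {k : ℕ} {f g : Finset (Fin k) → ℝ} {y b : ℝ} (hy : 0 ≤ y) (hb : 0 ≤ b)
    (hg : ∀ T, 0 ≤ g T) (h : ∀ T, T ≠ ∅ → f T ≤ y ^ T.card ∨ f T ≤ b ∨ f T ≤ g T) :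
    ∑ T ∈ Finset.univ.erase ∅, f T ≤ ((1 + y) ^ k - 1) + 2 ^ k * b + ∑ T, g T := by
  have h1 : ∑ T ∈ Finset.univ.erase (∅ : Finset (Fin k)), y ^ T.card = (1 + y) ^ k - 1 := by
    rw [← sum_pow_card, ← Finset.add_sum_erase _ _ (Finset.mem_univ (∅ : Finset (Fin k)))]
    simp
  have h2 : ∑ T ∈ Finset.univ.erase (∅ : Finset (Fin k)), b ≤ 2 ^ k * b := by
    calc ∑ T ∈ Finset.univ.erase (∅ : Finset (Fin k)), b ≤ ∑ _T : Finset (Fin k), b :=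
          Finset.sum_le_sum_of_subset_of_nonneg (Finset.erase_subset _ _) fun _ _ _ => hb
      _ = 2 ^ k * b := by simp
  have h3 : ∑ T ∈ Finset.univ.erase (∅ : Finset (Fin k)), g T ≤ ∑ T, g T :=
    Finset.sum_le_sum_of_subset_of_nonneg (Finset.erase_subset _ _) fun T _ _ => hg T
  calc ∑ T ∈ Finset.univ.erase ∅, f T
      ≤ ∑ T ∈ Finset.univ.erase ∅, (y ^ T.card + b + g T) := by
        refine Finset.sum_le_sum fun T hT => ?_
        have hy' : 0 ≤ y ^ T.card := by positivity
        have := hg T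
        rcases h T (Finset.mem_erase.1 hT).1 with h | h | h <;> linarith
    _ ≤ _ := by
      rw [Finset.sum_add_distrib, Finset.sum_add_distrib, h1]
      linarith

theorem inv_pow_le_rpow_pow {P x : ℝ} (hP : 1 ≤ P) {s w : ℕ} (h : x * s ≤ w) :
    (P ^ w)⁻¹ ≤ (P ^ (-x)) ^ s := by
  have hP0 : 0 < P := by linarith
  rw [← Real.rpow_natCast, ← Real.rpow_natCast, ← Real.rpow_mul hP0.le, ← Real.rpow_neg hP0.le]
  exact Real.rpow_le_rpow_of_exponent_le hP (by linarith)

theorem pow_le_rpow_pow {b x : ℝ} (hb : 0 < b) (hb1 : b ≤ 1) {s w : ℕ} (h : x * s ≤ w) :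
    b ^ w ≤ (b ^ x) ^ s := by
  rw [← Real.rpow_natCast, ← Real.rpow_natCast, ← Real.rpow_mul hb.le]
  exact Real.rpow_le_rpow_of_exponent_ge hb hb1 h

theorem pow_le_rpow {b x : ℝ} (hb : 0 < b) (hb1 : b ≤ 1) {s : ℕ} (h : x ≤ s) :
    b ^ s ≤ b ^ x := by
  rw [← Real.rpow_natCast]
  exact Real.rpow_le_rpow_of_exponent_ge hb hb1 h

/-- Up to lower order terms, the radius of the `n`-ball of volume `1`. -/
noncomputable def unitRadius (n : ℕ) : ℝ := √(n / (2 * Real.pi * Real.exp 1))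

theorem unitRadius_pos {n : ℕ} (hn : 0 < n) : 0 < unitRadius n := by
  have := Real.pi_pos
  unfold unitRadius
  positivity

theorem unitRadius_sq (n : ℕ) : unitRadius n ^ 2 = n / (2 * Real.pi * Real.exp 1) := by
  have := Real.pi_pos
  rw [unitRadius, Real.sq_sqrt (by positivity)]

/-- With `τ = a * n / r ^ 2` the exponential cost no longer depends on the radius. To leading order
in `Q` the best choice is `a = |S| / (2 * n)`, which is `1 / 2` for full support. -/
theorem card_supported_mul_unitRadius_le {n : ℕ} (hn : 0 < n) {Q a : ℝ} (hQ : 0 < Q) (ha : 0 < a)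
    (c : Euc n) (S : Finset (Fin n)) : ((supported c (Q * unitRadius n) S).card : ℝ) ≤
      Real.exp (a * n) * (2 + Q / √(2 * Real.exp 1 * a)) ^ S.card := by
  have hpi := Real.pi_pos
  have hn0 : (0 : ℝ) < n := by exact_mod_cast hn
  set r := Q * unitRadius n with hr
  have hr0 : 0 < r := mul_pos hQ (unitRadius_pos hn)
  have hr2 : r ^ 2 = Q ^ 2 * n / (2 * Real.pi * Real.exp 1) := by
    rw [hr, mul_pow, unitRadius_sq, mul_div_assoc]
  have h := card_supported_le (τ := a * n / r ^ 2) (by positivity) c r S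
  have e1 : a * n / r ^ 2 * r ^ 2 = a * n := by field_simp
  have e2 : √(Real.pi / (a * n / r ^ 2)) = Q / √(2 * Real.exp 1 * a) := by
    have : Real.pi / (a * n / r ^ 2) = Q ^ 2 / (2 * Real.exp 1 * a) := by
      rw [hr2]; field_simp
    rw [this, Real.sqrt_div (by positivity), Real.sqrt_sq hQ.le]
  rwa [e1, e2] at h

theorem sqrt_exp_one_le_two : √(Real.exp 1) ≤ 2 := by
  rw [Real.sqrt_le_left (by norm_num)]
  linarith [Real.exp_one_lt_d9]

theorem card_supported_le_half {n : ℕ} (hn : 0 < n) {Q : ℝ} (hQ : 0 < Q)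
    (c : Euc n) (S : Finset (Fin n)) : ((supported c (Q * unitRadius n) S).card : ℝ) ≤
      √(Real.exp 1) ^ n * (2 + Q / √(Real.exp 1)) ^ S.card := by
  have h := card_supported_mul_unitRadius_le hn hQ (a := 1 / 2) (by norm_num) c S
  have e1 : Real.exp (1 / 2 * n) = √(Real.exp 1) ^ n := by
    rw [Real.sqrt_eq_rpow, ← Real.exp_mul, ← Real.rpow_natCast, ← Real.exp_mul, one_mul]
  have e2 : 2 * Real.exp 1 * (1 / 2) = Real.exp 1 := by ring
  rwa [e1, e2] at h

theorem card_supported_le_pow {n : ℕ} (hn : 0 < n) {Q : ℝ} (hQ : 0 < Q)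
    (c : Euc n) (S : Finset (Fin n)) (hS : 0 < S.card) {θ : ℝ} (hθ : 0 < θ)
    (h : θ * n ≤ S.card) : ((supported c (Q * unitRadius n) S).card : ℝ) ≤
      (2 * (2 + Q / √θ)) ^ S.card := by
  have hn0 : (0 : ℝ) < n := by exact_mod_cast hn
  have hs0 : (0 : ℝ) < S.card := by exact_mod_cast hS
  refine (card_supported_mul_unitRadius_le hn hQ (a := S.card / n / 2) (by positivity) c S).trans ?_
  have e1 : Real.exp ((S.card : ℝ) / n / 2 * n) = √(Real.exp 1) ^ S.card := by
    rw [Real.sqrt_eq_rpow, ← Real.exp_mul, ← Real.rpow_natCast, ← Real.exp_mul, one_mul]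
    congr 1
    field_simp
  rw [e1, ← mul_pow]
  refine pow_le_pow_left₀ (by positivity) ?_ _
  refine mul_le_mul sqrt_exp_one_le_two ?_ (by positivity) (by norm_num)
  gcongr
  have h1 : θ ≤ S.card / n := by rwa [le_div_iff₀ hn0]
  have h2 : 1 ≤ Real.exp 1 := Real.one_le_exp (by norm_num)
  have h3 : (0 : ℝ) ≤ S.card / n := by positivity
  nlinarith

theorem card_supported_le_pow_sqrt {n : ℕ} (hn : 0 < n) {Q : ℝ} (hQ : 0 < Q)
    (c : Euc n) (S : Finset (Fin n)) (hS : 0 < S.card) :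
    ((supported c (Q * unitRadius n) S).card : ℝ) ≤ (2 * (2 + Q * √n)) ^ S.card := by
  have hn0 : (0 : ℝ) < n := by exact_mod_cast hn
  -- A nonempty set has density at least `1 / n`.
  have h := card_supported_le_pow hn hQ c S hS (θ := (n : ℝ)⁻¹) (by positivity) (by
    rw [inv_mul_cancel₀ hn0.ne']; exact_mod_cast hS)
  rwa [Real.sqrt_inv, div_inv_eq_mul] at h

end Sums

/-! ### The sums that bound the error probabilities -/

section Bounds

variable {n m : ℕ} {E : Finset (Fin n × Fin m)} {R α A β B ε ϑ P Q : ℝ}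

theorem sum_rank_le (hP : 1 ≤ P) {γ : ℝ}
    (hE : ∀ T : Finset (Fin m), γ * T.card ≤ (nbrC E T).card) :
    ∑ T ∈ Finset.univ.erase ∅, P ^ T.card * (P ^ (nbrC E T).card)⁻¹ ≤
      (1 + P * P ^ (-γ)) ^ m - 1 := by
  have hP0 : 0 < P := by linarith
  have h := sum_le_three (k := m) (f := fun T => P ^ T.card * (P ^ (nbrC E T).card)⁻¹)
    (g := fun _ => 0) (y := P * P ^ (-γ)) (b := 0) (by positivity) le_rfl (fun _ => le_rfl)
    fun T _ => Or.inl ?_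
  · simpa using h
  · rw [mul_pow]
    exact mul_le_mul_of_nonneg_left (inv_pow_le_rpow_pow hP (hE T)) (by positivity)

/-- The three terms come from (L1), from (L2) with `α ≥ 1`, and from `sub_div_le_card_nbrV`. The
last one fixes the critical radius: for `Q = c * P ^ (1 - R)` its base tends to `c`. -/
theorem sum_variable_nodes_le (hE : IsGoodGraph R α A β B ε ϑ E) (hα : 1 ≤ α) (hβ : 0 < β)
    (hε : 0 < ε) (hm : (m : ℝ) = n * (1 - R)) (hn : 0 < n) (hP : 1 ≤ P) (hQ : 0 < Q)
    (hy : 2 * (2 + Q / √ε) / P ≤ 1) (c : Euc n) :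
    ∑ S ∈ Finset.univ.erase ∅,
        ((supported c (Q * unitRadius n) S).card : ℝ) * (P ^ (nbrV E S).card)⁻¹ ≤
      ((1 + 2 * (2 + Q * √n) * P ^ (-A)) ^ n - 1) + (2 * (2 * (2 + Q / √ε) / P) ^ ε) ^ n +
        (√(Real.exp 1) * (2 + Q / √(Real.exp 1) + P ^ (1 / β)) / P ^ (1 - R)) ^ n := by
  have hP0 : 0 < P := by linarith
  have hn0 : (0 : ℝ) < n := by exact_mod_cast hn
  set e := √(Real.exp 1) with he
  have he0 : 0 < e := by positivity
  have hy0 : 0 < 2 * (2 + Q / √ε) / P := by positivity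
  have h := sum_le_three (k := n)
    (f := fun S => ((supported c (Q * unitRadius n) S).card : ℝ) * (P ^ (nbrV E S).card)⁻¹)
    (g := fun S => e ^ n * P ^ (-(m : ℝ)) * ((2 + Q / e) ^ S.card * (P ^ (1 / β)) ^ (n - S.card)))
    (y := 2 * (2 + Q * √n) * P ^ (-A)) (b := (2 * (2 + Q / √ε) / P) ^ (ε * n))
    (by positivity) (by positivity) (fun S => by positivity) ?_
  · refine h.trans_eq ?_
    rw [← Finset.mul_sum, sum_pow_mul_pow_compl]
    congr 1
    · congr 1
      rw [Real.rpow_mul hy0.le, Real.rpow_natCast, mul_pow]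
    · have : P ^ (-(m : ℝ)) = ((P ^ (1 - R)) ^ n)⁻¹ := by
        rw [Real.rpow_neg hP0.le, ← Real.rpow_natCast (P ^ (1 - R)), ← Real.rpow_mul hP0.le, hm,
          mul_comm]
      rw [this, div_pow, mul_pow]
      field_simp
  · intro S hS
    have hS0 : 0 < S.card := Finset.card_pos.2 (Finset.nonempty_iff_ne_empty.2 hS)
    by_cases h1 : (S.card : ℝ) ≤ ε * n
    · left
      rw [mul_pow]
      refine mul_le_mul (card_supported_le_pow_sqrt hn hQ c S hS0) (inv_pow_le_rpow_pow hP ?_)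
        (by positivity) (by positivity)
      refine hE.L1 S ?_
      exact_mod_cast h1.trans (Nat.le_ceil _)
    right
    rw [not_le] at h1
    by_cases h2 : (S.card : ℝ) ≤ n * (1 - R) / (2 * α)
    · left
      have h3 := hE.L2 S (by exact_mod_cast h2.trans (Nat.le_ceil _))
      have h4 : (S.card : ℝ) ≤ (nbrV E S).card :=
        (le_mul_of_one_le_left (Nat.cast_nonneg _) hα).trans h3
      calc ((supported c (Q * unitRadius n) S).card : ℝ) * (P ^ (nbrV E S).card)⁻¹
          ≤ (2 * (2 + Q / √ε)) ^ S.card * (P ^ S.card)⁻¹ := by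
            refine mul_le_mul (card_supported_le_pow hn hQ c S hS0 hε h1.le) ?_
              (by positivity) (by positivity)
            gcongr
            exact_mod_cast h4
        _ = (2 * (2 + Q / √ε) / P) ^ S.card := by
            rw [div_pow _ P, div_eq_mul_inv _ (P ^ _)]
        _ ≤ _ := pow_le_rpow hy0 hy h1.le
    · right
      have h3 := hE.sub_div_le_card_nbrV hα hβ hm (not_le.1 h2)
      have hSn : S.card ≤ n := by simpa using Finset.card_le_univ S
      calc ((supported c (Q * unitRadius n) S).card : ℝ) * (P ^ (nbrV E S).card)⁻¹
          ≤ (e ^ n * (2 + Q / e) ^ S.card) * (P ^ (-(m : ℝ)) * (P ^ (1 / β)) ^ (n - S.card)) := by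
            refine mul_le_mul (card_supported_le_half hn hQ c S) ?_ (by positivity) (by positivity)
            rw [← Real.rpow_natCast, ← Real.rpow_natCast, ← Real.rpow_mul hP0.le,
              ← Real.rpow_add hP0, ← Real.rpow_neg hP0.le, Nat.cast_sub hSn]
            refine Real.rpow_le_rpow_of_exponent_le hP ?_
            have : (1 : ℝ) / β * (n - S.card) = (n - S.card) / β := by ring
            rw [this]
            linarith
        _ = _ := by ring

/-- Small and medium sets use (R1) and (R2). For large `T`, `card_compl_nbrC_le` makes the
neighbourhood exceed `T` by at least `n - m` nodes, whence the factor `P ^ R` per dimension. -/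
theorem sum_check_nodes_le (hE : IsGoodGraph R α A β B ε ϑ E) (hα : 1 ≤ α) (hβ : 1 ≤ β)
    (hB : 0 < B) (hϑ : 0 < ϑ) (hR : 0 < 1 - R) (hm : (m : ℝ) = n * (1 - R)) (hmn : m ≤ n)
    (hn : 0 < n) (hP : 1 ≤ P) (hQ : 0 < Q) (hy1 : 2 * (2 + Q * √n) / P ≤ 1)
    (hy2 : 2 * (2 + Q / √(ϑ * (1 - R))) / P ≤ 1)
    (hy3 : P * (2 * (2 + Q / √(ϑ * (1 - R))) / P) ^ β ≤ 1)
    (hy4 : (2 + Q / √(Real.exp 1)) / P ≤ 1) (c : Euc n) :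
    ∑ T ∈ Finset.univ.erase ∅, P ^ T.card *
        (((supported c (Q * unitRadius n) (nbrC E T)).card : ℝ) * (P ^ (nbrC E T).card)⁻¹) ≤
      ((1 + P * (2 * (2 + Q * √n) / P) ^ B) ^ m - 1) +
        (2 * (P * (2 * (2 + Q / √(ϑ * (1 - R))) / P) ^ β) ^ ϑ) ^ m +
        (√(Real.exp 1) * (3 + Q / √(Real.exp 1)) / P ^ R) ^ n := by
  have hP0 : 0 < P := by linarith
  have hn0 : (0 : ℝ) < n := by exact_mod_cast hn
  set e := √(Real.exp 1) with he
  have he0 : 0 < e := by positivity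
  set b₁ := 2 * (2 + Q * √n) / P with hb₁
  set b₂ := 2 * (2 + Q / √(ϑ * (1 - R))) / P with hb₂
  have hb₁0 : 0 < b₁ := by positivity
  have hb₂0 : 0 < b₂ := by positivity
  have hy30 : 0 < P * b₂ ^ β := by positivity
  have h := sum_le_three (k := m)
    (f := fun T => P ^ T.card *
        (((supported c (Q * unitRadius n) (nbrC E T)).card : ℝ) * (P ^ (nbrC E T).card)⁻¹))
    (g := fun T => e ^ n * ((2 + Q / e) / P) ^ (n - m) * (2 + Q / e) ^ T.card)
    (y := P * b₁ ^ B) (b := (P * b₂ ^ β) ^ (ϑ * m))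
    (by positivity) (by positivity) (fun S => by positivity) ?_
  · refine h.trans ?_
    rw [← Finset.mul_sum, sum_pow_card]
    refine add_le_add (add_le_add le_rfl (le_of_eq ?_)) ?_
    · rw [Real.rpow_mul hy30.le, Real.rpow_natCast, mul_pow]
    · have e1 : (P ^ R) ^ n = P ^ (n - m) := by
        rw [← Real.rpow_natCast, ← Real.rpow_natCast, ← Real.rpow_mul hP0.le, Nat.cast_sub hmn, hm]
        congr 1; ring
      have e2 : (3 + Q / e) ^ n = (3 + Q / e) ^ (n - m) * (3 + Q / e) ^ m := by
        rw [← pow_add, Nat.sub_add_cancel hmn]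
      rw [div_pow _ (P ^ R), mul_pow e, e1, e2, div_pow _ P, mul_div_assoc, mul_assoc,
        div_mul_eq_mul_div]
      refine mul_le_mul_of_nonneg_left ?_ (by positivity)
      have h3 : 1 + (2 + Q / e) = 3 + Q / e := by ring
      rw [h3]
      gcongr
      norm_num
  · intro T hT
    have hT0 : 0 < T.card := Finset.card_pos.2 (Finset.nonempty_iff_ne_empty.2 hT)
    have hT0' : (0 : ℝ) < T.card := by exact_mod_cast hT0
    set w := (nbrC E T).card with hw
    by_cases h1 : (T.card : ℝ) ≤ ϑ * n * (1 - R)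
    · left
      have h2 := hE.R1 T h1
      have hw0 : 0 < w := by
        have : (0 : ℝ) < w := lt_of_lt_of_le (by positivity) h2
        exact_mod_cast this
      calc _ ≤ P ^ T.card * ((2 * (2 + Q * √n)) ^ w * (P ^ w)⁻¹) := by
            gcongr
            exact card_supported_le_pow_sqrt hn hQ c _ hw0
        _ = P ^ T.card * b₁ ^ w := by rw [hb₁, div_pow _ P, div_eq_mul_inv _ (P ^ _)]
        _ ≤ P ^ T.card * (b₁ ^ B) ^ T.card := by
            gcongr
            exact pow_le_rpow_pow hb₁0 hy1 h2
        _ = _ := by rw [mul_pow]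
    right
    rw [not_le] at h1
    by_cases h2 : (T.card : ℝ) ≤ n * (1 - R) / 2
    · left
      have h3 := hE.R2 T h2
      have h4 : (T.card : ℝ) ≤ w := (le_mul_of_one_le_left (Nat.cast_nonneg _) hβ).trans h3
      have hw0 : 0 < w := by
        have : (0 : ℝ) < w := lt_of_lt_of_le (by positivity) h4
        exact_mod_cast this
      calc _ ≤ P ^ T.card * ((2 * (2 + Q / √(ϑ * (1 - R)))) ^ w * (P ^ w)⁻¹) := by
            gcongr
            exact card_supported_le_pow hn hQ c _ hw0 (by positivity) (by linarith)
        _ = P ^ T.card * b₂ ^ w := by rw [hb₂, div_pow _ P, div_eq_mul_inv _ (P ^ _)]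
        _ ≤ P ^ T.card * (b₂ ^ β) ^ T.card := by
            gcongr
            exact pow_le_rpow_pow hb₂0 hy2 h3
        _ = (P * b₂ ^ β) ^ T.card := by rw [mul_pow]
        _ ≤ _ := pow_le_rpow hy30 hy3 (by rw [hm]; linarith)
    · right
      have h3 := hE.card_compl_nbrC_le hα hm (T := T) (by rw [hm]; linarith)
      rw [Finset.card_compl, Fintype.card_fin] at h3
      have hwn : w ≤ n := by simpa using Finset.card_le_univ (nbrC E T)
      have h4 : n - m + T.card ≤ w := by omega
      calc _ ≤ P ^ T.card * ((e ^ n * (2 + Q / e) ^ w) * (P ^ w)⁻¹) := by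
            gcongr
            exact card_supported_le_half hn hQ c _
        _ = P ^ T.card * e ^ n * ((2 + Q / e) / P) ^ w := by rw [div_pow]; ring
        _ ≤ P ^ T.card * e ^ n * ((2 + Q / e) / P) ^ (n - m + T.card) := by
            refine mul_le_mul_of_nonneg_left ?_ (by positivity)
            exact pow_le_pow_of_le_one (by positivity) hy4 h4
        _ = _ := by
            rw [pow_add, div_pow _ _ T.card]
            field_simp

/-- A bound on the number of integer points with support in a set of the given size. -/
noncomputable def pointBound (n : ℕ) (Q a : ℝ) (s : ℕ) : ℝ :=
  min (√(Real.exp 1) ^ n * (2 + Q / √(Real.exp 1)) ^ s)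
    (Real.exp (a * n) * (2 + Q / √(2 * Real.exp 1 * a)) ^ s)

theorem card_supported_le_pointBound (hn : 0 < n) (hQ : 0 < Q) {a : ℝ} (ha : 0 < a) (c : Euc n)
    (S : Finset (Fin n)) :
    ((supported c (Q * unitRadius n) S).card : ℝ) ≤ pointBound n Q a S.card :=
  le_min (card_supported_le_half hn hQ c S) (card_supported_mul_unitRadius_le hn hQ ha c S)

/-- The factor `√e ^ n * (2 + Q / √e) ^ n` is the scale of the number of integer points in the whole
ball; relative to it, each node of `nbrC E T` saves a factor `2 + Q / √e`. For large `T` few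
coordinates remain free, and the bound with the adjustable rate `a` is the better one. -/
theorem sum_pointBound_le (hE : IsGoodGraph R α A β B ε ϑ E) (hα : 1 ≤ α) (hm : (m : ℝ) = n * (1 - R))
    (hP : 1 ≤ P) (hQ : 0 < Q) {a u : ℝ} (hu1 : u ≤ 1)
    (hu : (2 + Q / √(Real.exp 1))⁻¹ ≤ u) (hy : P * u ^ β ≤ 1) :
    ∑ T ∈ Finset.univ.erase ∅, P ^ T.card * pointBound n Q a (nbrC E T)ᶜ.card ≤
      √(Real.exp 1) ^ n * (2 + Q / √(Real.exp 1)) ^ n *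
        (((1 + P * u ^ B) ^ m - 1) + (2 * (P * u ^ β) ^ ϑ) ^ m) +
      Real.exp (a * n) * (P + (2 + Q / √(2 * Real.exp 1 * a))) ^ m := by
  have hP0 : 0 < P := by linarith
  set e := √(Real.exp 1) with he
  have he0 : 0 < e := by positivity
  set q := 2 + Q / e with hq
  have hq0 : 0 < q := by positivity
  have hu0 : 0 < u := lt_of_lt_of_le (by positivity) hu
  set q' := 2 + Q / √(2 * Real.exp 1 * a) with hq'
  have hq'1 : 1 ≤ q' := by
    have : 0 ≤ Q / √(2 * Real.exp 1 * a) := by positivity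
    rw [hq']; linarith
  set D := e ^ n * q ^ n with hD
  have hD0 : 0 < D := by positivity
  have hyy : 0 < P * u ^ β := by positivity
  have h := sum_le_three (k := m)
    (f := fun T => D⁻¹ * (P ^ T.card * pointBound n Q a (nbrC E T)ᶜ.card))
    (g := fun T => D⁻¹ * Real.exp (a * n) * (P ^ T.card * q' ^ (m - T.card)))
    (y := P * u ^ B) (b := (P * u ^ β) ^ (ϑ * m))
    (by positivity) (by positivity) (fun S => by positivity) ?_
  · rw [← Finset.mul_sum, ← Finset.mul_sum, sum_pow_mul_pow_compl] at h
    have h' := mul_le_mul_of_nonneg_left h hD0.le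
    rw [mul_inv_cancel_left₀ hD0.ne'] at h'
    refine h'.trans_eq ?_
    rw [mul_add]
    congr 1
    · congr 2
      rw [Real.rpow_mul hyy.le, Real.rpow_natCast, mul_pow]
    · field_simp
  · intro T hT
    set w := (nbrC E T).card with hw
    have hwn : w ≤ n := by simpa using Finset.card_le_univ (nbrC E T)
    have hc : (nbrC E T)ᶜ.card = n - w := by rw [Finset.card_compl, Fintype.card_fin]
    have hsmall : D⁻¹ * (P ^ T.card * pointBound n Q a (nbrC E T)ᶜ.card) ≤ P ^ T.card * u ^ w := by
      calc D⁻¹ * (P ^ T.card * pointBound n Q a (nbrC E T)ᶜ.card)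
          ≤ D⁻¹ * (P ^ T.card * (e ^ n * q ^ (n - w))) := by
            gcongr
            rw [hc]
            exact min_le_left _ _
        _ = P ^ T.card * (q⁻¹) ^ w := by
            have : q ^ n = q ^ (n - w) * q ^ w := by rw [← pow_add, Nat.sub_add_cancel hwn]
            rw [hD, this, inv_pow]
            field_simp
        _ ≤ _ := by gcongr
    by_cases h1 : (T.card : ℝ) ≤ ϑ * n * (1 - R)
    · left
      refine hsmall.trans ?_
      rw [mul_pow]
      gcongr
      exact pow_le_rpow_pow hu0 hu1 (hE.R1 T h1)
    right
    rw [not_le] at h1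
    by_cases h2 : (T.card : ℝ) ≤ n * (1 - R) / 2
    · left
      refine hsmall.trans ?_
      calc P ^ T.card * u ^ w ≤ P ^ T.card * (u ^ β) ^ T.card := by
            gcongr
            exact pow_le_rpow_pow hu0 hu1 (hE.R2 T h2)
        _ = (P * u ^ β) ^ T.card := by rw [mul_pow]
        _ ≤ _ := pow_le_rpow hyy hy (by rw [hm]; linarith)
    · right
      have h3 := hE.card_compl_nbrC_le hα hm (T := T) (by rw [hm]; linarith)
      calc D⁻¹ * (P ^ T.card * pointBound n Q a (nbrC E T)ᶜ.card)
          ≤ D⁻¹ * (P ^ T.card * (Real.exp (a * n) * q' ^ (m - T.card))) := by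
            gcongr
            refine (min_le_right _ _).trans ?_
            refine mul_le_mul_of_nonneg_left ?_ (by positivity)
            exact pow_le_pow_right₀ hq'1 (by omega)
        _ = _ := by ring

/-- As `√n = √(2 π e) * unitRadius n`, losing `√n` in the radius subtracts a constant from `Q`. -/
theorem le_card_intPoints (hn : 4 ≤ n) (hQ : √(2 * Real.pi * Real.exp 1) ≤ Q) (c : Euc n) :
    (Q - √(2 * Real.pi * Real.exp 1)) ^ n / (2 * n) ≤ (intPoints c (Q * unitRadius n)).card := by
  have hpi := Real.pi_pos
  have hn0 : (0 : ℝ) < n := by exact_mod_cast (by omega : 0 < n)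
  have hb : √(2 * Real.pi * Real.exp 1) * unitRadius n = √n := by
    rw [unitRadius, ← Real.sqrt_mul (by positivity)]
    congr 1; field_simp
  have hru := unitRadius_pos (by omega : 0 < n)
  have hr : 0 ≤ Q * unitRadius n - √n := by
    rw [← hb, ← sub_mul]
    exact mul_nonneg (by linarith) hru.le
  have h1 := le_volume_closedBall hn c hr
  have h2 : volume.real (Metric.closedBall c (Q * unitRadius n - √n)) ≤
      (intPoints c (Q * unitRadius n)).card := by
    have := ENNReal.toReal_mono (ENNReal.natCast_ne_top _)
      (volume_closedBall_le_card_intPoints c (Q * unitRadius n))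
    rw [measureReal_def]
    simpa using this
  refine le_trans (le_of_eq ?_) (h1.trans h2)
  have h3 : unitRadius n * √(2 * Real.pi * Real.exp 1 / n) = 1 := by
    rw [unitRadius, ← Real.sqrt_mul (by positivity), ← Real.sqrt_one]
    congr 1; field_simp
  rw [← hb, ← sub_mul, mul_assoc (Q - _), h3, mul_one]

end Bounds

/-! ### Asymptotics -/

section Limits

theorem tendsto_pow_mul_pow_self {f : ℕ → ℝ} {c : ℝ} (k : ℕ) (hf : Tendsto f atTop (𝓝 c))
    (hc : c < 1) (h0 : ∀ n, 0 ≤ f n) : Tendsto (fun n : ℕ => (n : ℝ) ^ k * f n ^ n) atTop (𝓝 0) := by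
  have hc0 : 0 ≤ c := ge_of_tendsto' hf h0
  obtain ⟨θ, hcθ, hθ⟩ := exists_between hc
  have hθ0 : 0 ≤ θ := hc0.trans hcθ.le
  refine squeeze_zero' (Eventually.of_forall fun n => mul_nonneg (by positivity) (pow_nonneg (h0 n) n))
    ?_ (tendsto_pow_const_mul_const_pow_of_abs_lt_one k (r := θ) (by rwa [abs_of_nonneg hθ0]))
  filter_upwards [hf.eventually (ge_mem_nhds hcθ)] with n hn
  exact mul_le_mul_of_nonneg_left (pow_le_pow_left₀ (h0 n) hn n) (by positivity)

theorem tendsto_pow_self {f : ℕ → ℝ} {c : ℝ} (hf : Tendsto f atTop (𝓝 c))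
    (hc : c < 1) (h0 : ∀ n, 0 ≤ f n) : Tendsto (fun n : ℕ => f n ^ n) atTop (𝓝 0) := by
  simpa using tendsto_pow_mul_pow_self 0 hf hc h0

theorem one_add_pow_sub_one_le {y : ℝ} (hy : 0 ≤ y) {n : ℕ} (h : n * y ≤ 1) :
    (1 + y) ^ n - 1 ≤ 2 * (n * y) := by
  have h1 : (1 + y) ^ n ≤ Real.exp (n * y) := by
    rw [Real.exp_nat_mul]
    exact pow_le_pow_left₀ (by linarith) (by linarith [Real.add_one_le_exp y]) n
  have h2 : 0 ≤ (n : ℝ) * y := by positivity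
  have h3 := Real.abs_exp_sub_one_le (x := n * y) (by rwa [abs_of_nonneg h2])
  rw [abs_of_nonneg h2] at h3
  linarith [le_abs_self (Real.exp (n * y) - 1)]

theorem tendsto_one_add_pow_sub_one {y : ℕ → ℝ} (hy : ∀ᶠ n in atTop, 0 ≤ y n)
    (h : Tendsto (fun n : ℕ => n * y n) atTop (𝓝 0)) :
    Tendsto (fun n => (1 + y n) ^ n - 1) atTop (𝓝 0) := by
  refine squeeze_zero' ?_ ?_ (by simpa using h.const_mul 2)
  · filter_upwards [hy] with n hn
    linarith [one_le_pow₀ (show 1 ≤ 1 + y n by linarith) (n := n)]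
  · filter_upwards [hy, h.eventually (ge_mem_nhds zero_lt_one)] with n hn h1
    exact one_add_pow_sub_one_le hn h1

variable (lam : ℝ)

/-- The modulus of the ensemble, as a real number. -/
noncomputable def modulus (n : ℕ) : ℝ := ldaPrime lam n

theorem two_le_modulus (n : ℕ) : 2 ≤ modulus lam n := by
  unfold modulus
  exact_mod_cast (ldaPrime_prime lam n).two_le

theorem modulus_pos (n : ℕ) : 0 < modulus lam n := by linarith [two_le_modulus lam n]

theorem one_le_modulus (n : ℕ) : 1 ≤ modulus lam n := by linarith [two_le_modulus lam n]

theorem rpow_le_modulus (n : ℕ) : (n : ℝ) ^ lam ≤ modulus lam n := by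
  classical
  exact (Nat.find_spec (exists_prime_ge ((n : ℝ) ^ lam))).2

/-- Bertrand's postulate. The upper bound lets powers of the modulus be absorbed by exponentially
small terms. -/
theorem exists_modulus_le_pow : ∃ k : ℕ, ∀ n : ℕ, 2 ≤ n → modulus lam n ≤ (n : ℝ) ^ k := by
  classical
  refine ⟨⌈max lam 0⌉₊ + 2, fun n hn => ?_⟩
  have hn2 : (2 : ℝ) ≤ n := by exact_mod_cast hn
  have hx : 0 < (n : ℝ) ^ lam := by positivity
  obtain ⟨q, hq, hlt, hle⟩ := Nat.exists_prime_lt_and_le_two_mul ⌈(n : ℝ) ^ lam⌉₊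
    (Nat.ceil_pos.2 hx).ne'
  have h1 : ldaPrime lam n ≤ q := Nat.find_min' _ ⟨hq, (Nat.le_ceil _).trans (by exact_mod_cast hlt.le)⟩
  have h2 : modulus lam n ≤ 2 * (⌈(n : ℝ) ^ lam⌉₊ : ℝ) := by
    unfold modulus
    exact_mod_cast h1.trans hle
  have h3 : (n : ℝ) ^ lam ≤ (n : ℝ) ^ ⌈max lam 0⌉₊ := by
    rw [← Real.rpow_natCast]
    exact Real.rpow_le_rpow_of_exponent_le (by linarith) ((le_max_left _ _).trans (Nat.le_ceil _))
  have h4 : (⌈(n : ℝ) ^ lam⌉₊ : ℝ) ≤ 2 * (n : ℝ) ^ ⌈max lam 0⌉₊ := by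
    have : ⌈(n : ℝ) ^ lam⌉₊ ≤ n ^ ⌈max lam 0⌉₊ := Nat.ceil_le.2 (by push_cast; exact h3)
    have h5 : (⌈(n : ℝ) ^ lam⌉₊ : ℝ) ≤ (n : ℝ) ^ ⌈max lam 0⌉₊ := by exact_mod_cast this
    have : (0 : ℝ) ≤ (n : ℝ) ^ ⌈max lam 0⌉₊ := by positivity
    linarith
  calc modulus lam n ≤ 4 * (n : ℝ) ^ ⌈max lam 0⌉₊ := by linarith
    _ ≤ (n : ℝ) ^ 2 * (n : ℝ) ^ ⌈max lam 0⌉₊ := by gcongr; nlinarith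
    _ = _ := by rw [← pow_add, add_comm]

variable {lam}

/-- The form in which the lower bounds on `lam` enter the limits. -/
theorem tendsto_rpow_mul_modulus {a b : ℝ} (hb : 0 < b) (hab : a < lam * b) :
    Tendsto (fun n : ℕ => (n : ℝ) ^ a * modulus lam n ^ (-b)) atTop (𝓝 0) := by
  have h := (tendsto_rpow_neg_atTop (y := lam * b - a) (by linarith)).comp
    (tendsto_natCast_atTop_atTop (R := ℝ))
  refine squeeze_zero' (Eventually.of_forall fun n =>
    mul_nonneg (by positivity) (Real.rpow_nonneg (modulus_pos lam n).le _)) ?_ h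
  filter_upwards [eventually_gt_atTop 0] with n hn
  have hn0 : (0 : ℝ) < n := by exact_mod_cast hn
  have h1 : modulus lam n ^ (-b) ≤ (n : ℝ) ^ (-(lam * b)) := by
    have := Real.rpow_le_rpow_of_nonpos (Real.rpow_pos_of_pos hn0 lam) (rpow_le_modulus lam n)
      (show -b ≤ 0 by linarith)
    rwa [← Real.rpow_mul hn0.le, mul_neg] at this
  calc (n : ℝ) ^ a * modulus lam n ^ (-b) ≤ (n : ℝ) ^ a * (n : ℝ) ^ (-(lam * b)) := by gcongr
    _ = _ := by rw [← Real.rpow_add hn0]; simp only [Function.comp]; ring_nf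

theorem tendsto_modulus_rpow {b : ℝ} (hlam : 0 < lam) (hb : 0 < b) :
    Tendsto (fun n : ℕ => modulus lam n ^ (-b)) atTop (𝓝 0) := by
  simpa using tendsto_rpow_mul_modulus (lam := lam) (a := 0) hb (by positivity)

end Limits

/-- The conditions on the parameters of the ensemble that the proof uses. -/
structure Admissible (R α A β B ε ϑ lam : ℝ) (I : Set ℕ) (m : ℕ → ℕ)
    (G : ∀ n, Finset (Fin n × Fin (m n))) : Prop where
  R_pos : 0 < R
  R_lt : R < 1
  one_le_α : 1 ≤ α
  lt_β : 1 / (1 - R) < β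
  lt_A : 2 * (1 + R) < A
  lt_B : 2 * (1 + R) < B * (1 - R)
  ε_pos : 0 < ε
  ϑ_pos : 0 < ϑ
  lam_R : 1 < lam * R
  lam_one_sub : 1 < lam * (1 - R)
  lam_A : 2 < lam * (A - 2 * (1 - R))
  lam_B : 2 < lam * (B * (1 - R) - 2 * (1 + R))
  lam_B' : 2 * B + 3 / 2 < lam * (B * (1 - R) - 1)
  card_eq : ∀ n ∈ I, (m n : ℝ) = n * (1 - R)
  le_nbrC : ∀ n ∈ I, ∀ T : Finset (Fin (m n)), 1 / (1 - R) * T.card ≤ (nbrC (G n) T).card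
  good : ∀ n ∈ I, IsGoodGraph R α A β B ε ϑ (G n)

/-! ### The union bounds tend to zero -/

namespace Admissible

variable {R α A β B ε ϑ lam : ℝ} {I : Set ℕ} {m : ℕ → ℕ} {G : ∀ n, Finset (Fin n × Fin (m n))}
  (h : Admissible R α A β B ε ϑ lam I m G)

include h

theorem one_sub_pos : 0 < 1 - R := by linarith [h.R_lt]

theorem one_lt_lam : 1 < lam := by nlinarith [h.lam_R, h.lam_one_sub]

theorem lam_pos : 0 < lam := by linarith [h.one_lt_lam]

theorem B_pos : 0 < B := by
  have := h.lt_B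
  have h1 := h.one_sub_pos
  have h2 := h.R_pos
  by_contra hB
  nlinarith

theorem one_lt_β_mul : 1 < β * (1 - R) := by
  have := h.lt_β
  rwa [div_lt_iff₀ h.one_sub_pos] at this

theorem one_le_β : 1 ≤ β := by
  have := h.one_lt_β_mul
  have := h.R_pos
  have := h.one_sub_pos
  nlinarith

theorem β_pos : 0 < β := by linarith [h.one_le_β]

theorem card_le {n : ℕ} (hn : n ∈ I) : m n ≤ n := by
  have h1 := h.card_eq n hn
  have h2 : (m n : ℝ) ≤ n := by
    rw [h1]
    have := h.R_pos
    nlinarith [Nat.cast_nonneg (α := ℝ) n]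
  exact_mod_cast h2

theorem one_add_pow_le {n : ℕ} (hn : n ∈ I) {y : ℝ} (hy : 0 ≤ y) :
    (1 + y) ^ m n - 1 ≤ (1 + y) ^ n - 1 :=
  sub_le_sub_right (pow_le_pow_right₀ (by linarith) (h.card_le hn)) 1

theorem pow_card_eq {n : ℕ} (hn : n ∈ I) {x : ℝ} (hx : 0 ≤ x) : x ^ m n = (x ^ (1 - R)) ^ n := by
  rw [← Real.rpow_natCast, ← Real.rpow_natCast, ← Real.rpow_mul hx, h.card_eq n hn, mul_comm]

theorem eventually_rank {κ : ℝ} (hκ : 0 < κ) : ∀ᶠ n in atTop ⊓ 𝓟 I,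
    ∑ T ∈ Finset.univ.erase ∅, modulus lam n ^ T.card *
      (modulus lam n ^ (nbrC (G n) T).card)⁻¹ ≤ κ := by
  have hR := h.one_sub_pos
  have hlim : Tendsto (fun n : ℕ => n * (modulus lam n * modulus lam n ^ (-(1 / (1 - R)))))
      atTop (𝓝 0) := by
    -- This is `1 < lam * R / (1 - R)`, which follows from `lam_R`.
    have h1 : 1 < lam * (1 / (1 - R) - 1) := by
      have e : lam * (1 / (1 - R) - 1) = lam * R / (1 - R) := by field_simp; ring
      rw [e, lt_div_iff₀ hR]
      linarith [h.lam_R, h.R_pos]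
    refine (tendsto_rpow_mul_modulus (a := 1) (b := 1 / (1 - R) - 1) ?_ h1).congr fun n => ?_
    · exact pos_of_mul_pos_right (by linarith) h.lam_pos.le
    · have e : -(1 / (1 - R) - 1) = 1 + -(1 / (1 - R)) := by ring
      rw [Real.rpow_one, e, Real.rpow_add (modulus_pos lam n), Real.rpow_one]
  have h2 := tendsto_one_add_pow_sub_one (Eventually.of_forall fun n =>
    mul_nonneg (modulus_pos lam n).le (Real.rpow_nonneg (modulus_pos lam n).le _)) hlim
  rw [eventually_inf_principal]
  filter_upwards [h2.eventually (ge_mem_nhds hκ)] with n hn hnI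
  refine (sum_rank_le (one_le_modulus lam n) (h.le_nbrC n hnI)).trans ((h.one_add_pow_le hnI ?_).trans hn)
  exact mul_nonneg (modulus_pos lam n).le (Real.rpow_nonneg (modulus_pos lam n).le _)

theorem eventually_variable_nodes {c κ : ℝ} (hc : 0 < c) (hc1 : c < 1) (hκ : 0 < κ) :
    ∀ᶠ n in atTop ⊓ 𝓟 I, ∀ x : Euc n, ∑ S ∈ Finset.univ.erase ∅,
      ((supported x (c * modulus lam n ^ (1 - R) * unitRadius n) S).card : ℝ) *
        (modulus lam n ^ (nbrV (G n) S).card)⁻¹ ≤ κ := by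
  have hR := h.one_sub_pos
  have hR0 := h.R_pos
  have hlam := h.lam_pos
  have hA := h.lt_A
  have hA' := h.lam_A
  have hε := h.ε_pos
  have hP := modulus_pos lam
  set e := √(Real.exp 1) with he
  have he0 : 0 < e := by positivity
  -- The summand containing `√n` is the demanding one: it needs `3 / 2 < lam * (A - (1 - R))`, which
  -- `lam_A` provides.
  have t1 : Tendsto (fun n : ℕ => n * (2 * (2 + c * modulus lam n ^ (1 - R) * √n) *
      modulus lam n ^ (-A))) atTop (𝓝 0) := by
    have a1 := tendsto_rpow_mul_modulus (lam := lam) (a := 1) (b := A) (by linarith) (by nlinarith)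
    have a2 := tendsto_rpow_mul_modulus (lam := lam) (a := 3 / 2) (b := A - (1 - R)) (by linarith)
      (by nlinarith)
    have a3 := (a1.const_mul 4).add (a2.const_mul (2 * c))
    simp only [mul_zero, add_zero] at a3
    refine a3.congr' ?_
    filter_upwards [eventually_gt_atTop 0] with n hn
    have hn0 : (0 : ℝ) < n := by exact_mod_cast hn
    have e1 : (n : ℝ) ^ (3 / 2 : ℝ) = n * √n := by
      rw [Real.sqrt_eq_rpow, show (3 / 2 : ℝ) = 1 + 1 / 2 by norm_num, Real.rpow_add hn0,
        Real.rpow_one]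
    have e2 : modulus lam n ^ (-(A - (1 - R))) =
        modulus lam n ^ (1 - R) * modulus lam n ^ (-A) := by
      rw [← Real.rpow_add (hP n)]; ring_nf
    rw [e1, e2, Real.rpow_one]
    ring
  have t2 : Tendsto (fun n : ℕ => 2 * (2 + c * modulus lam n ^ (1 - R) / √ε) / modulus lam n)
      atTop (𝓝 0) := by
    have a1 := tendsto_modulus_rpow (lam := lam) hlam (b := 1) one_pos
    have a2 := tendsto_modulus_rpow (lam := lam) hlam (b := R) hR0
    have a3 := (a1.const_mul 4).add (a2.const_mul (2 * c / √ε))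
    simp only [mul_zero, add_zero] at a3
    refine a3.congr fun n => ?_
    have e2 : modulus lam n ^ (-R) = modulus lam n ^ (1 - R) * modulus lam n ^ (-1 : ℝ) := by
      rw [← Real.rpow_add (hP n)]; ring_nf
    rw [e2, Real.rpow_neg_one]
    ring
  -- Since `β * (1 - R) > 1`, the term `P ^ (1 / β)` is negligible against `P ^ (1 - R)`.
  have t3 : Tendsto (fun n : ℕ => e * (2 + c * modulus lam n ^ (1 - R) / e +
      modulus lam n ^ (1 / β)) / modulus lam n ^ (1 - R)) atTop (𝓝 c) := by
    have hβ : 0 < 1 - R - 1 / β := by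
      rw [sub_pos, div_lt_iff₀ h.β_pos]
      linarith [h.one_lt_β_mul]
    have a1 := tendsto_modulus_rpow (lam := lam) hlam hR
    have a2 := tendsto_modulus_rpow (lam := lam) hlam hβ
    have a3 := ((a1.const_mul (2 * e)).add (a2.const_mul e)).add_const c
    simp only [mul_zero, add_zero, zero_add] at a3
    refine a3.congr fun n => ?_
    have e2 : modulus lam n ^ (-(1 - R - 1 / β)) =
        modulus lam n ^ (1 / β) * modulus lam n ^ (-(1 - R)) := by
      rw [← Real.rpow_add (hP n)]; ring_nf
    have hx : modulus lam n ^ (1 - R) ≠ 0 := (Real.rpow_pos_of_pos (hP n) _).ne'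
    rw [e2, Real.rpow_neg (hP n).le]
    field_simp
    ring
  have u1 := tendsto_one_add_pow_sub_one (Eventually.of_forall fun n => by
    have := hP n; positivity) t1
  have u2 : Tendsto (fun n : ℕ => (2 * (2 * (2 + c * modulus lam n ^ (1 - R) / √ε) /
      modulus lam n) ^ ε) ^ n) atTop (𝓝 0) := by
    refine tendsto_pow_self (c := 0) ?_ zero_lt_one fun n => by have := hP n; positivity
    have := (t2.rpow_const (p := ε) (Or.inr hε.le)).const_mul 2
    rwa [Real.zero_rpow hε.ne', mul_zero] at this
  have u3 := tendsto_pow_self t3 hc1 fun n => by have := hP n; positivity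
  have u := (u1.add u2).add u3
  simp only [add_zero] at u
  rw [eventually_inf_principal]
  filter_upwards [u.eventually (ge_mem_nhds hκ), t2.eventually (ge_mem_nhds zero_lt_one),
    eventually_gt_atTop 0] with n hn h2 hn0 hnI x
  exact (sum_variable_nodes_le (h.good n hnI) h.one_le_α h.β_pos hε (h.card_eq n hnI) hn0
    (one_le_modulus lam n) (by have := hP n; positivity) h2 x).trans hn

theorem tendsto_two_mul_rpow_pow {y : ℕ → ℝ} (hy0 : ∀ n, 0 ≤ y n) (hy : Tendsto y atTop (𝓝 0))
    (k : ℕ) :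
    Tendsto (fun n : ℕ => (n : ℝ) ^ k * ((2 * y n ^ ϑ) ^ (1 - R)) ^ n) atTop (𝓝 0) := by
  have hR := h.one_sub_pos
  refine tendsto_pow_mul_pow_self (c := 0) k ?_ zero_lt_one fun n => by have := hy0 n; positivity
  have h1 := (hy.rpow_const (p := ϑ) (Or.inr h.ϑ_pos.le)).const_mul 2
  rw [Real.zero_rpow h.ϑ_pos.ne', mul_zero] at h1
  have h2 := h1.rpow_const (p := 1 - R) (Or.inr hR.le)
  rwa [Real.zero_rpow hR.ne'] at h2

/-- The row-space lattice has volume `P ^ (n - m) = (P ^ R) ^ n` when `H` is onto, hence the scale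
`P ^ R` of the radius. -/
theorem eventually_check_nodes {c κ : ℝ} (hc : 0 < c) (hc1 : c < 1) (hκ : 0 < κ) :
    ∀ᶠ n in atTop ⊓ 𝓟 I, ∑ T ∈ Finset.univ.erase ∅, modulus lam n ^ T.card *
      (((supported 0 (c * modulus lam n ^ R * unitRadius n) (nbrC (G n) T)).card : ℝ) *
        (modulus lam n ^ (nbrC (G n) T).card)⁻¹) ≤ κ := by
  have hR := h.one_sub_pos
  have hR0 := h.R_pos
  have hlam := h.lam_pos
  have hϑ := h.ϑ_pos
  have hB := h.B_pos
  have hβ := h.β_pos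
  have hP := modulus_pos lam
  set e := √(Real.exp 1) with he
  have he0 : 0 < e := by positivity
  have e0 : ∀ n, modulus lam n ^ (-(1 - R)) = modulus lam n ^ R * (modulus lam n)⁻¹ := by
    intro n
    rw [← Real.rpow_neg_one, ← Real.rpow_add (hP n)]; ring_nf
  have a1 := tendsto_modulus_rpow (lam := lam) hlam (b := 1) one_pos
  have a2 := tendsto_modulus_rpow (lam := lam) hlam hR
  have a4 := tendsto_modulus_rpow (lam := lam) hlam hR0
  have t1 : Tendsto (fun n : ℕ => 2 * (2 + c * modulus lam n ^ R * √n) / modulus lam n)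
      atTop (𝓝 0) := by
    have b1 := tendsto_rpow_mul_modulus (lam := lam) (a := 1 / 2) (b := 1 - R) hR
      (by linarith [h.lam_one_sub])
    have b2 := (a1.const_mul 4).add (b1.const_mul (2 * c))
    simp only [mul_zero, add_zero] at b2
    refine b2.congr fun n => ?_
    rw [e0, Real.rpow_neg_one, ← Real.sqrt_eq_rpow]
    ring
  have t2 : ∀ s : ℝ, Tendsto (fun n : ℕ => (2 + c * modulus lam n ^ R / s) / modulus lam n)
      atTop (𝓝 0) := by
    intro s
    have b2 := (a1.const_mul 2).add (a2.const_mul (c / s))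
    simp only [mul_zero, add_zero] at b2
    refine b2.congr fun n => ?_
    rw [e0, Real.rpow_neg_one]
    ring
  have t2' : Tendsto (fun n : ℕ => 2 * (2 + c * modulus lam n ^ R / √(ϑ * (1 - R))) /
      modulus lam n) atTop (𝓝 0) := by
    have := (t2 √(ϑ * (1 - R))).const_mul 2
    rw [mul_zero] at this
    exact this.congr fun n => by ring
  have t3 : Tendsto (fun n : ℕ => modulus lam n *
      (2 * (2 + c * modulus lam n ^ R / √(ϑ * (1 - R))) / modulus lam n) ^ β) atTop (𝓝 0) := by
    have b1 := (tendsto_modulus_rpow (lam := lam) hlam (b := β * (1 - R) - 1)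
      (by linarith [h.one_lt_β_mul])).const_mul ((4 + 2 * c / √(ϑ * (1 - R))) ^ β)
    rw [mul_zero] at b1
    refine squeeze_zero (fun n => by have := hP n; positivity) (fun n => ?_) b1
    have hPn := hP n
    have e1 : modulus lam n ^ (-(β * (1 - R) - 1)) =
        modulus lam n * (modulus lam n ^ (-(1 - R))) ^ β := by
      rw [← Real.rpow_mul hPn.le]
      nth_rw 2 [← Real.rpow_one (modulus lam n)]
      rw [← Real.rpow_add hPn]; ring_nf
    rw [e1, mul_left_comm, ← Real.mul_rpow (by positivity) (by positivity)]
    gcongr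
    rw [e0, ← div_eq_mul_inv, ← mul_div_assoc]
    refine div_le_div_of_nonneg_right ?_ hPn.le
    have : 1 ≤ modulus lam n ^ R := Real.one_le_rpow (one_le_modulus lam n) hR0.le
    have h2 : 0 ≤ 2 * c / √(ϑ * (1 - R)) := by positivity
    calc 2 * (2 + c * modulus lam n ^ R / √(ϑ * (1 - R)))
        = 4 + 2 * c / √(ϑ * (1 - R)) * modulus lam n ^ R := by ring
      _ ≤ _ := by nlinarith
  -- The exponent `1 + B / 2` collects the factor `n` and `√n ^ B`; `lam_B'` covers it.
  have t4 : Tendsto (fun n : ℕ => n * (modulus lam n *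
      (2 * (2 + c * modulus lam n ^ R * √n) / modulus lam n) ^ B)) atTop (𝓝 0) := by
    have b1 := (tendsto_rpow_mul_modulus (lam := lam) (a := 1 + B / 2) (b := B * (1 - R) - 1)
      (by linarith [h.lt_B]) (by linarith [h.lam_B'])).const_mul ((4 + 2 * c) ^ B)
    rw [mul_zero] at b1
    refine squeeze_zero' (Eventually.of_forall fun n => by have := hP n; positivity) ?_ b1
    filter_upwards [eventually_gt_atTop 0] with n hn
    have hPn := hP n
    have hn1 : (1 : ℝ) ≤ n := by exact_mod_cast hn
    have hn0 : (0 : ℝ) < n := by linarith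
    have e1 : modulus lam n ^ (-(B * (1 - R) - 1)) =
        modulus lam n * (modulus lam n ^ (-(1 - R))) ^ B := by
      rw [← Real.rpow_mul hPn.le]
      nth_rw 2 [← Real.rpow_one (modulus lam n)]
      rw [← Real.rpow_add hPn]; ring_nf
    have e2 : (n : ℝ) ^ (1 + B / 2) = n * √n ^ B := by
      rw [Real.rpow_add hn0, Real.rpow_one, Real.sqrt_eq_rpow, ← Real.rpow_mul hn0.le]; ring_nf
    rw [e1, e2]
    have e3 : (4 + 2 * c) ^ B * (n * √n ^ B * (modulus lam n * (modulus lam n ^ (-(1 - R))) ^ B)) =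
        n * (modulus lam n * ((4 + 2 * c) * √n * modulus lam n ^ (-(1 - R))) ^ B) := by
      rw [Real.mul_rpow (by positivity) (by positivity), Real.mul_rpow (by positivity) (by positivity)]
      ring
    rw [e3]
    gcongr
    rw [e0, ← div_eq_mul_inv, ← mul_div_assoc]
    refine div_le_div_of_nonneg_right ?_ hPn.le
    have h1 : 1 ≤ modulus lam n ^ R := Real.one_le_rpow (one_le_modulus lam n) hR0.le
    have h2 : 1 ≤ √(n : ℝ) := Real.one_le_sqrt.2 hn1
    have h3 : 1 ≤ √(n : ℝ) * modulus lam n ^ R := one_le_mul_of_one_le_of_one_le h2 h1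
    nlinarith
  have t5 : Tendsto (fun n : ℕ => e * (3 + c * modulus lam n ^ R / e) / modulus lam n ^ R)
      atTop (𝓝 c) := by
    have b1 := (a4.const_mul (3 * e)).add_const c
    simp only [mul_zero, zero_add] at b1
    refine b1.congr fun n => ?_
    have hx : modulus lam n ^ R ≠ 0 := (Real.rpow_pos_of_pos (hP n) _).ne'
    rw [Real.rpow_neg (hP n).le]
    field_simp
  have u1 := tendsto_one_add_pow_sub_one (Eventually.of_forall fun n => by
    have := hP n; positivity) t4
  have u2 := h.tendsto_two_mul_rpow_pow (fun n => by have := hP n; positivity) t3 0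
  have u3 := tendsto_pow_self t5 hc1 fun n => by have := hP n; positivity
  have u := (u1.add u2).add u3
  simp only [add_zero, pow_zero, one_mul] at u
  rw [eventually_inf_principal]
  filter_upwards [u.eventually (ge_mem_nhds hκ), t1.eventually (ge_mem_nhds zero_lt_one),
    t2'.eventually (ge_mem_nhds zero_lt_one), t3.eventually (ge_mem_nhds zero_lt_one),
    (t2 e).eventually (ge_mem_nhds zero_lt_one), eventually_gt_atTop 0]
    with n hn h1 h2 h3 h4 hn0 hnI
  have hPn := hP n
  refine (sum_check_nodes_le (h.good n hnI) h.one_le_α h.one_le_β hB hϑ hR (h.card_eq n hnI)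
    (h.card_le hnI) hn0 (one_le_modulus lam n) (by positivity) h1 h2 h3 h4 0).trans (le_trans ?_ hn)
  refine add_le_add (add_le_add (h.one_add_pow_le hnI (by positivity)) ?_) le_rfl
  rw [h.pow_card_eq hnI (by positivity)]

/-- The prefactor `P ^ (2 * R)` is the ratio of `P²`, the scale of the worst squared distance, to
`(P ^ (1 - R))²`, the scale of the typical one. The proportion of missed syndromes has to beat it.
-/
theorem eventually_pointBound {δ κ : ℝ} (hδ : 0 < δ) (hκ : 0 < κ) : ∀ᶠ n in atTop ⊓ 𝓟 I,
    modulus lam n ^ (2 * R) * ((((1 + δ) * modulus lam n ^ (1 - R) -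
        √(2 * Real.pi * Real.exp 1)) ^ n / (2 * n))⁻¹ *
      ∑ T ∈ Finset.univ.erase ∅, modulus lam n ^ T.card *
        pointBound n ((1 + δ) * modulus lam n ^ (1 - R)) (Real.log (1 + δ) / 2)
          (nbrC (G n) T)ᶜ.card) ≤ κ := by
  have hR := h.one_sub_pos
  have hR0 := h.R_pos
  have hlam := h.lam_pos
  have hB := h.B_pos
  have hβ := h.β_pos
  have hP := modulus_pos lam
  set e := √(Real.exp 1) with he
  have he0 : 0 < e := by positivity
  set b := √(2 * Real.pi * Real.exp 1) with hb
  have hb0 : 0 ≤ b := Real.sqrt_nonneg _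
  -- Then `exp a = √(1 + δ)`, strictly below the gain `1 + δ` from enlarging the radius.
  set a := Real.log (1 + δ) / 2 with ha
  have ha0 : 0 < a := by rw [ha]; have := Real.log_pos (show 1 < 1 + δ by linarith); linarith
  have hea : Real.exp a < 1 + δ := by
    have h1 : Real.exp (Real.log (1 + δ)) = 1 + δ := Real.exp_log (by linarith)
    rw [← h1]
    apply Real.exp_lt_exp.2
    rw [ha]; have := Real.log_pos (show 1 < 1 + δ by linarith); linarith
  set s := √(2 * Real.exp 1 * a) with hs
  have hs0 : 0 < s := by positivity
  have a1 := tendsto_modulus_rpow (lam := lam) hlam hR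
  have a2 := tendsto_modulus_rpow (lam := lam) hlam hR0
  have a3 := tendsto_modulus_rpow (lam := lam) hlam (b := 1) one_pos
  -- the denominators
  have d0 : Tendsto (fun n : ℕ => 1 + δ - b * modulus lam n ^ (-(1 - R))) atTop (𝓝 (1 + δ)) := by
    simpa using (a1.const_mul b).const_sub (1 + δ)
  have d1 : ∀ᶠ n : ℕ in atTop, b < (1 + δ) * modulus lam n ^ (1 - R) - b := by
    have h0 := (a1.const_mul (2 * b)).const_sub (1 + δ)
    simp only [mul_zero, sub_zero] at h0
    filter_upwards [h0.eventually (lt_mem_nhds (show 0 < 1 + δ by linarith))] with n hn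
    have hx := Real.rpow_pos_of_pos (hP n) (1 - R)
    rw [Real.rpow_neg (hP n).le] at hn
    have := mul_pos hn hx
    rw [sub_mul, mul_assoc (2 * b), inv_mul_cancel₀ hx.ne'] at this
    linarith
  have d2 : ∀ n, (1 + δ) * modulus lam n ^ (1 - R) - b =
      modulus lam n ^ (1 - R) * (1 + δ - b * modulus lam n ^ (-(1 - R))) := by
    intro n
    have hx := Real.rpow_pos_of_pos (hP n) (1 - R)
    rw [Real.rpow_neg (hP n).le]
    field_simp
  -- the two bases
  have x1 : ∀ᶠ n : ℕ in atTop, (e * (2 + (1 + δ) * modulus lam n ^ (1 - R) / e) /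
      ((1 + δ) * modulus lam n ^ (1 - R) - b)) ^ n ≤ 2 := by
    -- The base is `1 + O(P ^ (-(1 - R)))`, so its `n`-th power stays bounded because `lam * (1 - R)
    -- > 1`.
    have h0 : Tendsto (fun n : ℕ => n * ((b + 2 * e) /
        ((1 + δ) * modulus lam n ^ (1 - R) - b))) atTop (𝓝 0) := by
      have h1 := ((tendsto_rpow_mul_modulus (lam := lam) (a := 1) (b := 1 - R) hR
        (by linarith [h.lam_one_sub])).const_mul (b + 2 * e)).div d0 (by linarith)
      simp only [mul_zero, zero_div] at h1
      refine h1.congr fun n => ?_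
      have hx := Real.rpow_pos_of_pos (hP n) (1 - R)
      rw [Pi.div_apply, d2, Real.rpow_one]
      nth_rw 1 [Real.rpow_neg (hP n).le]
      rw [← div_div]
      ring
    have h1 := tendsto_one_add_pow_sub_one (by
      filter_upwards [d1] with n hn
      have : 0 < (1 + δ) * modulus lam n ^ (1 - R) - b := by linarith
      positivity) h0
    filter_upwards [h1.eventually (ge_mem_nhds zero_lt_one), d1] with n hn hd
    have hd' : (1 + δ) * modulus lam n ^ (1 - R) - b ≠ 0 := by linarith
    have e1 : e * (2 + (1 + δ) * modulus lam n ^ (1 - R) / e) /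
      ((1 + δ) * modulus lam n ^ (1 - R) - b) = 1 + (b + 2 * e) /
        ((1 + δ) * modulus lam n ^ (1 - R) - b) := by
      field_simp
      ring
    rw [e1]
    linarith
  -- The absolute value covers the finitely many `n` whose denominator may fail to be positive, as
  -- `tendsto_pow_mul_pow_self` wants nonnegative terms throughout.
  have x2 : Tendsto (fun n : ℕ => |Real.exp a * (1 + (2 + (1 + δ) * modulus lam n ^ (1 - R) / s) /
      modulus lam n) * modulus lam n ^ (1 - R) / ((1 + δ) * modulus lam n ^ (1 - R) - b)|)
      atTop (𝓝 (Real.exp a / (1 + δ))) := by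
    have h1 := (((a3.const_mul 2).add (a2.const_mul ((1 + δ) / s))).const_add 1).const_mul (Real.exp a)
    have h2 := (h1.div d0 (by linarith)).abs
    simp only [mul_zero, add_zero, mul_one] at h2
    rw [abs_of_pos (by positivity)] at h2
    refine h2.congr fun n => ?_
    have hx := Real.rpow_pos_of_pos (hP n) (1 - R)
    rw [Pi.div_apply, d2]
    congr 1
    have e2 : modulus lam n ^ (-R) = modulus lam n ^ (1 - R) * (modulus lam n)⁻¹ := by
      rw [← Real.rpow_neg_one, ← Real.rpow_add (hP n)]; ring_nf
    rw [e2, Real.rpow_neg_one, mul_comm (modulus lam n ^ (1 - R)) (1 + δ - _),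
      mul_div_mul_right _ _ hx.ne']
    ring
  -- polynomial growth
  obtain ⟨k, hk⟩ := exists_modulus_le_pow lam
  have hpoly : ∀ᶠ n : ℕ in atTop, n * modulus lam n ^ (2 * R) ≤ (n : ℝ) ^ (1 + 2 * k) := by
    filter_upwards [eventually_ge_atTop 2] with n hn
    have h1 : modulus lam n ^ (2 * R) ≤ modulus lam n ^ 2 := by
      rw [← Real.rpow_natCast]
      refine Real.rpow_le_rpow_of_exponent_le (one_le_modulus lam n) ?_
      push_cast
      linarith [h.R_lt]
    calc n * modulus lam n ^ (2 * R) ≤ n * (((n : ℝ) ^ k) ^ 2) := by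
          gcongr
          exact h1.trans (pow_le_pow_left₀ (hP n).le (hk n hn) 2)
      _ = _ := by rw [← pow_mul, pow_add, pow_one, mul_comm k]
  -- the terms
  have ey : ∀ x : ℝ, ∀ n, modulus lam n * (2 * modulus lam n ^ (-(1 - R))) ^ x =
      2 ^ x * modulus lam n ^ (-(x * (1 - R) - 1)) := by
    intro x n
    have hPn := hP n
    rw [Real.mul_rpow (by norm_num) (by positivity), ← Real.rpow_mul hPn.le, mul_left_comm]
    congr 1
    nth_rw 1 [← Real.rpow_one (modulus lam n)]
    rw [← Real.rpow_add hPn]; ring_nf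
  have t1 : Tendsto (fun n : ℕ => n * (modulus lam n * (2 * modulus lam n ^ (-(1 - R))) ^ B))
      atTop (𝓝 0) := by
    have h1 := (tendsto_rpow_mul_modulus (lam := lam) (a := 1) (b := B * (1 - R) - 1)
      (by linarith [h.lt_B]) (by linarith [h.lam_B'])).const_mul (2 ^ B)
    rw [mul_zero] at h1
    refine h1.congr fun n => ?_
    rw [ey, Real.rpow_one]; ring
  -- Here the prefactor `n * P ^ (2 * R)` meets a term that is only polynomially small, so `lam_B`
  -- is called for.
  have t1' : Tendsto (fun n : ℕ => n * modulus lam n ^ (2 * R) *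
      (n * (modulus lam n * (2 * modulus lam n ^ (-(1 - R))) ^ B))) atTop (𝓝 0) := by
    have h1 := (tendsto_rpow_mul_modulus (lam := lam) (a := 2) (b := B * (1 - R) - 1 - 2 * R)
      (by linarith [h.lt_B]) (by nlinarith [h.lam_B])).const_mul (2 ^ B)
    rw [mul_zero] at h1
    refine h1.congr fun n => ?_
    have e2 : modulus lam n ^ (-(B * (1 - R) - 1 - 2 * R)) =
        modulus lam n ^ (2 * R) * modulus lam n ^ (-(B * (1 - R) - 1)) := by
      rw [← Real.rpow_add (hP n)]; ring_nf
    rw [ey, e2, Real.rpow_two]; ring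
  have t2 : Tendsto (fun n : ℕ => modulus lam n * (2 * modulus lam n ^ (-(1 - R))) ^ β)
      atTop (𝓝 0) := by
    have h1 := (tendsto_modulus_rpow (lam := lam) hlam (b := β * (1 - R) - 1)
      (by linarith [h.one_lt_β_mul])).const_mul (2 ^ β)
    rw [mul_zero] at h1
    exact h1.congr fun n => (ey β n).symm
  have u2 := h.tendsto_two_mul_rpow_pow (fun n => by have := hP n; positivity) t2 (1 + 2 * k)
  have u3 := tendsto_pow_mul_pow_self (1 + 2 * k) x2
    (by rw [div_lt_one (by linarith)]; exact hea) fun n => abs_nonneg _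
  have u := ((t1'.const_mul 8).add (u2.const_mul 4)).add (u3.const_mul 2)
  simp only [mul_zero, add_zero] at u
  have hu1 : ∀ᶠ n : ℕ in atTop, 2 * modulus lam n ^ (-(1 - R)) ≤ 1 := by
    have := a1.const_mul 2
    rw [mul_zero] at this
    exact this.eventually (ge_mem_nhds zero_lt_one)
  rw [eventually_inf_principal]
  filter_upwards [u.eventually (ge_mem_nhds hκ), d1, x1, hpoly, hu1,
    t1.eventually (ge_mem_nhds zero_lt_one), t2.eventually (ge_mem_nhds zero_lt_one),
    eventually_gt_atTop 0] with n hn hd hx1 hp hu1 ht1 ht2 hn0 hnI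
  have hPn := hP n
  have hnr : (0 : ℝ) < n := by exact_mod_cast hn0
  set P := modulus lam n with hPdef
  set Q := (1 + δ) * P ^ (1 - R) with hQ
  have hQ0 : 0 < Q := by positivity
  have hQb : 0 < Q - b := by linarith
  -- It is enough that `Q ≥ P ^ (1 - R)` and `√e ≤ 2`.
  have hu : (2 + Q / e)⁻¹ ≤ 2 * P ^ (-(1 - R)) := by
    have hx := Real.rpow_pos_of_pos hPn (1 - R)
    rw [Real.rpow_neg hPn.le, inv_le_comm₀ (by positivity) (by positivity), mul_inv, inv_inv]
    have : P ^ (1 - R) / 2 ≤ Q / e := by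
      rw [div_le_div_iff₀ (by norm_num) he0]
      have h2 := sqrt_exp_one_le_two
      rw [← he] at h2
      have : P ^ (1 - R) ≤ Q := by rw [hQ]; nlinarith
      nlinarith
    linarith
  have hsum := sum_pointBound_le (h.good n hnI) h.one_le_α (h.card_eq n hnI)
    (one_le_modulus lam n) hQ0 (a := a) hu1 hu ht2
  rw [← he, ← hs] at hsum
  set y₁ := P * (2 * P ^ (-(1 - R))) ^ B with hy₁
  set y₂ := P * (2 * P ^ (-(1 - R))) ^ β with hy₂
  have hy₁0 : 0 ≤ y₁ := by positivity
  have hy₂0 : 0 ≤ y₂ := by positivity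
  have hm1 : (1 + y₁) ^ m n - 1 ≤ 2 * (n * y₁) :=
    (h.one_add_pow_le hnI hy₁0).trans (one_add_pow_sub_one_le hy₁0 ht1)
  have hm2 : (2 * y₂ ^ ϑ) ^ m n = ((2 * y₂ ^ ϑ) ^ (1 - R)) ^ n :=
    h.pow_card_eq hnI (by positivity)
  have hm3 : (P + (2 + Q / s)) ^ m n ≤ ((1 + (2 + Q / s) / P) * P ^ (1 - R)) ^ n := by
    have e1 : P + (2 + Q / s) = (1 + (2 + Q / s) / P) * P := by field_simp
    rw [e1, mul_pow, mul_pow, h.pow_card_eq hnI hPn.le]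
    gcongr
    · have : 0 ≤ (2 + Q / s) / P := by positivity
      linarith
    · exact h.card_le hnI
  set x₁ := e * (2 + Q / e) / (Q - b) with hx₁
  set x₂ := Real.exp a * (1 + (2 + Q / s) / P) * P ^ (1 - R) / (Q - b) with hx₂
  set z := (2 * y₂ ^ ϑ) ^ (1 - R) with hz
  have hz0 : 0 ≤ z := by positivity
  have hx₂0 : 0 ≤ x₂ := by positivity
  rw [abs_of_nonneg hx₂0] at hn
  have hsum' : ((Q - b) ^ n)⁻¹ * ∑ T ∈ Finset.univ.erase ∅, P ^ T.card *
      pointBound n Q a (nbrC (G n) T)ᶜ.card ≤ 2 * (2 * (n * y₁) + z ^ n) + x₂ ^ n := by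
    calc _ ≤ ((Q - b) ^ n)⁻¹ * (e ^ n * (2 + Q / e) ^ n * (2 * (n * y₁) + z ^ n) +
          Real.exp (a * n) * ((1 + (2 + Q / s) / P) * P ^ (1 - R)) ^ n) := by
          refine mul_le_mul_of_nonneg_left (hsum.trans ?_) (by positivity)
          rw [hm2]
          gcongr
      _ = x₁ ^ n * (2 * (n * y₁) + z ^ n) + x₂ ^ n := by
          rw [hx₁, hx₂, div_pow _ (Q - b), div_pow _ (Q - b), mul_pow e, mul_assoc (Real.exp a),
            mul_pow (Real.exp a), ← Real.exp_nat_mul, mul_comm a]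
          ring
      _ ≤ _ := by gcongr
  calc P ^ (2 * R) * (((Q - b) ^ n / (2 * n))⁻¹ * ∑ T ∈ Finset.univ.erase ∅, P ^ T.card *
      pointBound n Q a (nbrC (G n) T)ᶜ.card)
      = 2 * (n * P ^ (2 * R)) * (((Q - b) ^ n)⁻¹ * ∑ T ∈ Finset.univ.erase ∅, P ^ T.card *
      pointBound n Q a (nbrC (G n) T)ᶜ.card) := by rw [inv_div, div_eq_mul_inv]; ring
    _ ≤ 2 * (n * P ^ (2 * R)) * (2 * (2 * (n * y₁) + z ^ n) + x₂ ^ n) := by gcongr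
    _ = 8 * (n * P ^ (2 * R) * (n * y₁)) + 4 * ((n * P ^ (2 * R)) * z ^ n) +
        2 * ((n * P ^ (2 * R)) * x₂ ^ n) := by ring
    _ ≤ 8 * (n * P ^ (2 * R) * (n * y₁)) + 4 * ((n : ℝ) ^ (1 + 2 * k) * z ^ n) +
        2 * ((n : ℝ) ^ (1 + 2 * k) * x₂ ^ n) := by gcongr
    _ ≤ κ := hn

end Admissible

/-! ### Lattices with all the good properties up to `η` -/

/-- The properties that a random lattice of the ensemble has with high probability. -/
structure IsGoodLattice {n : ℕ} (X η : ℝ) (ζ : ProbabilityMeasure (Euc n))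
    (L : Submodule ℤ (Euc n)) : Prop where
  vol_eq : vol L = X ^ n
  bounded : ∃ K, voronoi L ⊆ Metric.closedBall 0 K
  minDist : ∀ y ∈ L, y ≠ 0 → (1 - η) * (X * unitRadius n) ≤ ‖y‖
  vol_dual : vol (dualLattice L) = X⁻¹ ^ n
  bounded_dual : ∃ K, voronoi (dualLattice L) ⊆ Metric.closedBall 0 K
  minDist_dual : ∀ y ∈ dualLattice L, y ≠ 0 → (1 - η) * (X⁻¹ * unitRadius n) ≤ ‖y‖
  error : (ζ : Measure (Euc n)).real
    (Metric.closedBall 0 ((1 - η) * (X * unitRadius n)) ∩ (strictVoronoi L)ᶜ) ≤ η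
  moment : normalizedSecondMoment L ≤ 1 / (2 * Real.pi * Real.exp 1) + η

theorem IsGoodLattice.mono {n : ℕ} {X η η' : ℝ} (hX : 0 ≤ X) (h : η ≤ η')
    {ζ : ProbabilityMeasure (Euc n)} {L : Submodule ℤ (Euc n)} (hL : IsGoodLattice X η ζ L) :
    IsGoodLattice X η' ζ L := by
  have hu : 0 ≤ unitRadius n := Real.sqrt_nonneg _
  have h1 : (1 - η') * (X * unitRadius n) ≤ (1 - η) * (X * unitRadius n) := by gcongr
  have h2 : (1 - η') * (X⁻¹ * unitRadius n) ≤ (1 - η) * (X⁻¹ * unitRadius n) := by gcongr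
  exact
  { vol_eq := hL.vol_eq
    bounded := hL.bounded
    minDist := fun y hy h0 => h1.trans (hL.minDist y hy h0)
    vol_dual := hL.vol_dual
    bounded_dual := hL.bounded_dual
    minDist_dual := fun y hy h0 => h2.trans (hL.minDist_dual y hy h0)
    error := (measureReal_mono (Set.inter_subset_inter_left _
      (Metric.closedBall_subset_closedBall h1))).trans (hL.error.trans h)
    moment := hL.moment.trans (by linarith) }

/-! ### Averages of measures and measurability of the error event -/

section Measure

/-- Exchanging sum and integral turns a bound at each point into a bound on the sum of the measures.
-/
theorem sum_measureReal_le {Ω ι : Type*} [MeasurableSpace Ω] [Fintype ι] {μ : Measure Ω}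
    {D : Set Ω} (hD : MeasurableSet D) (hDfin : μ D ≠ ∞) {S : ι → Set Ω}
    (hS : ∀ i, MeasurableSet (S i)) (hSD : ∀ i, S i ⊆ D) {C : ℝ}
    (h : ∀ x ∈ D, ∑ i, (S i).indicator (fun _ => (1 : ℝ)) x ≤ C) :
    ∑ i, μ.real (S i) ≤ C * μ.real D := by
  have hi : ∀ i, Integrable ((S i).indicator fun _ => (1 : ℝ)) μ := fun i =>
    (integrable_indicator_iff (hS i)).2
      (integrableOn_const ((measure_mono (hSD i)).trans_lt hDfin.lt_top).ne)
  calc ∑ i, μ.real (S i) = ∑ i, ∫ x, (S i).indicator (fun _ => (1 : ℝ)) x ∂μ := by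
        refine Finset.sum_congr rfl fun i _ => ?_
        rw [integral_indicator (hS i)]
        simp
    _ = ∫ x, ∑ i, (S i).indicator (fun _ => (1 : ℝ)) x ∂μ :=
        (integral_finsetSum _ fun i _ => hi i).symm
    _ ≤ ∫ x, D.indicator (fun _ => C) x ∂μ := by
        refine integral_mono (integrable_finsetSum _ fun i _ => hi i)
          ((integrable_indicator_iff hD).2 (integrableOn_const hDfin)) fun x => ?_
        by_cases hx : x ∈ D
        · simp only [Set.indicator_of_mem hx]
          exact h x hx
        · simp only [Set.indicator_of_notMem hx]
          exact (Finset.sum_eq_zero fun i _ =>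
            Set.indicator_of_notMem (fun hxi => hx (hSD i hxi)) _).le
    _ = C * μ.real D := by
        rw [integral_indicator hD, setIntegral_const, smul_eq_mul, mul_comm]

theorem measurableSet_strictVoronoi_compl {n : ℕ} (L : Submodule ℤ (Euc n)) [Countable L] :
    MeasurableSet (strictVoronoi L)ᶜ := by
  have : (strictVoronoi L)ᶜ = ⋃ y : L, {x : Euc n | (y : Euc n) ≠ 0 ∧ ‖x - y‖ ≤ ‖x‖} := by
    ext x
    simp [strictVoronoi, and_left_comm]
  rw [this]
  refine MeasurableSet.iUnion fun y => ?_
  by_cases hy : (y : Euc n) = 0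
  · simp [hy]
  · simp only [ne_eq, hy, not_false_eq_true, true_and]
    exact (isClosed_le (by fun_prop) (by fun_prop)).measurableSet

end Measure

/-! ### Probabilities of the bad events -/

namespace Admissible

variable {R α A β B ε ϑ lam : ℝ} {I : Set ℕ} {m : ℕ → ℕ} {G : ∀ n, Finset (Fin n × Fin (m n))}
  (h : Admissible R α A β B ε ϑ lam I m G)

include h

theorem modulus_pow_card {n : ℕ} (hn : n ∈ I) :
    modulus lam n ^ m n = (modulus lam n ^ (1 - R)) ^ n :=
  h.pow_card_eq hn (modulus_pos lam n).le

omit h in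
-- Keeps the radii below `p`, as the support arguments require; the `1 / 2` comes from `unitRadius n
-- ≤ √n`.
theorem eventually_mul_unitRadius_lt {a : ℝ} (ha : 1 / 2 < lam * (1 - a)) (ha1 : a < 1) (c : ℝ) :
    ∀ᶠ n in atTop, c * modulus lam n ^ a * unitRadius n < modulus lam n := by
  have h1 := (tendsto_rpow_mul_modulus (lam := lam) (b := 1 - a) (by linarith) ha).const_mul |c|
  rw [mul_zero] at h1
  filter_upwards [h1.eventually (gt_mem_nhds zero_lt_one)] with n hn
  have hP := modulus_pos lam n
  have hu : unitRadius n ≤ √n := by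
    refine Real.sqrt_le_sqrt (div_le_self (Nat.cast_nonneg n) ?_)
    nlinarith [Real.pi_gt_three, Real.add_one_le_exp 1]
  have hu0 : 0 ≤ unitRadius n := Real.sqrt_nonneg _
  have e1 : modulus lam n ^ (-(1 - a)) = modulus lam n ^ a * (modulus lam n)⁻¹ := by
    rw [← Real.rpow_neg_one, ← Real.rpow_add hP]; ring_nf
  rw [e1, ← Real.sqrt_eq_rpow, ← mul_assoc, ← mul_assoc, ← div_eq_mul_inv, div_lt_one hP] at hn
  refine lt_of_le_of_lt ?_ hn
  calc c * modulus lam n ^ a * unitRadius n ≤ |c| * modulus lam n ^ a * √n := by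
        gcongr
        exact le_abs_self c
    _ = _ := by ring

theorem eventually_frac_not_surjective {κ : ℝ} (hκ : 0 < κ) : ∀ᶠ n in atTop ⊓ 𝓟 I,
    frac (fun H : Matrix (Fin (m n)) (Fin n) (ZMod (ldaPrime lam n)) =>
      ¬ Function.Surjective (parityCheck (G n) H).mulVecLin) ≤ κ := by
  filter_upwards [h.eventually_rank hκ] with n hn
  exact (frac_not_surjective_le (G n)).trans hn

theorem eventually_frac_codeword {c κ : ℝ} (hc : 0 < c) (hc1 : c < 1) (hκ : 0 < κ) :
    ∀ᶠ n in atTop ⊓ 𝓟 I, ∀ x : Euc n, ‖x‖ ≤ c * modulus lam n ^ (1 - R) * unitRadius n →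
      frac (fun H : Matrix (Fin (m n)) (Fin n) (ZMod (ldaPrime lam n)) =>
        ∃ y ∈ constructionA (code (parityCheck (G n) H)), y ≠ 0 ∧
          ‖y - x‖ ≤ c * modulus lam n ^ (1 - R) * unitRadius n) ≤ κ := by
  have h1 := eventually_mul_unitRadius_lt (lam := lam) (a := 1 - R) (by linarith [h.lam_R])
    (by linarith [h.R_pos]) (2 * c)
  filter_upwards [h.eventually_variable_nodes hc hc1 hκ, h1.filter_mono inf_le_left]
    with n hn h1 x hx
  refine (frac_exists_codeword_le (G n) hx ?_).trans (hn x)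
  calc _ = 2 * c * modulus lam n ^ (1 - R) * unitRadius n := by ring
    _ < _ := h1

theorem eventually_frac_dual {c κ : ℝ} (hc : 0 < c) (hc1 : c < 1) (hκ : 0 < κ) :
    ∀ᶠ n in atTop ⊓ 𝓟 I,
      frac (fun H : Matrix (Fin (m n)) (Fin n) (ZMod (ldaPrime lam n)) =>
        ∃ y ∈ constructionA (rowSpace (parityCheck (G n) H)), y ≠ 0 ∧
          ‖y‖ ≤ c * modulus lam n ^ R * unitRadius n) ≤ κ := by
  have h1 := eventually_mul_unitRadius_lt (lam := lam) (a := R) (by linarith [h.lam_one_sub]) h.R_lt c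
  filter_upwards [h.eventually_check_nodes hc hc1 hκ, h1.filter_mono inf_le_left] with n hn h1
  exact (frac_exists_dual_codeword_le (G n) h1).trans hn

/-- If the origin is not the unique closest lattice point to `x`, a nonzero lattice point lies
within `‖x‖ ≤ r` of `x`. The codeword bound is uniform in `x`, so it survives averaging over the
noise, and Markov's inequality concludes. -/
theorem eventually_frac_error (z : ∀ n, ProbabilityMeasure (Euc n)) {c η κ : ℝ} (hc : 0 < c)
    (hc1 : c < 1) (hη : 0 < η) (hκ : 0 < κ) :
    ∀ᶠ n in atTop ⊓ 𝓟 I,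
      frac (fun H : Matrix (Fin (m n)) (Fin n) (ZMod (ldaPrime lam n)) =>
        η < (z n : Measure (Euc n)).real (Metric.closedBall 0
          (c * modulus lam n ^ (1 - R) * unitRadius n) ∩
            (strictVoronoi (constructionA (code (parityCheck (G n) H))))ᶜ)) ≤ κ := by
  classical
  filter_upwards [h.eventually_frac_codeword hc hc1 (mul_pos hκ hη)] with n hn
  set r := c * modulus lam n ^ (1 - R) * unitRadius n with hr
  set M := Matrix (Fin (m n)) (Fin n) (ZMod (ldaPrime lam n))
  have hM : (0 : ℝ) < Fintype.card M := by exact_mod_cast Fintype.card_pos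
  refine (frac_lt_le (fun _ => measureReal_nonneg) hη).trans ?_
  rw [div_le_iff₀ hη, div_le_iff₀ hM]
  refine (sum_measureReal_le (μ := (z n : Measure (Euc n))) (D := Metric.closedBall 0 r)
    (C := κ * η * Fintype.card M)
    measurableSet_closedBall (measure_ne_top _ _) (fun H => measurableSet_closedBall.inter
      (measurableSet_strictVoronoi_compl _)) (fun H => Set.inter_subset_left) fun x hx => ?_).trans ?_
  · have h1 := hn x (mem_closedBall_zero_iff.1 hx)
    rw [frac_eq_sum, div_le_iff₀ hM] at h1
    refine le_trans (Finset.sum_le_sum fun H _ => ?_) h1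
    rw [Set.indicator_apply]
    split_ifs with h2 h3
    · exact le_rfl
    · refine absurd ?_ h3
      have h4 := h2.2
      simp only [strictVoronoi, Set.mem_compl_iff, Set.mem_ofPred_eq, not_forall, not_lt] at h4
      obtain ⟨y, hy, hy0, hxy⟩ := h4
      refine ⟨y, hy, hy0, ?_⟩
      rw [norm_sub_rev]
      exact hxy.trans (mem_closedBall_zero_iff.1 hx)
    · exact zero_le_one
    · exact le_rfl
  · have h2 : (z n : Measure (Euc n)).real (Metric.closedBall 0 r) ≤ 1 := measureReal_le_one
    have h3 : 0 ≤ κ * η * Fintype.card M := by positivity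
    nlinarith

-- The point `x + rep s` is within `r` of the lattice as soon as some integer point of the ball
-- around `-x` has syndrome `s`. The uncovered volume is thus at most the number of missed
-- syndromes, integrated over `x` in the unit cube.
open Classical in
theorem eventually_frac_moment {η κ : ℝ} (hη : 0 < η) (hκ : 0 < κ) :
    ∀ᶠ n in atTop ⊓ 𝓟 I,
      frac (fun H : Matrix (Fin (m n)) (Fin n) (ZMod (ldaPrime lam n)) =>
        Function.Surjective (parityCheck (G n) H).mulVecLin ∧
        1 / (2 * Real.pi * Real.exp 1) + η <
          normalizedSecondMoment (constructionA (code (parityCheck (G n) H)))) ≤ κ := by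
  have hpi := Real.pi_pos
  obtain ⟨δ, hδ, hδη⟩ : ∃ δ : ℝ, 0 < δ ∧
      (1 + δ) ^ 2 / (2 * Real.pi * Real.exp 1) ≤ 1 / (2 * Real.pi * Real.exp 1) + η / 2 := by
    -- For `δ ≤ 1` one has `(1 + δ)² ≤ 1 + 3 * δ ≤ 1 + η / 2`, and `2 π e ≥ 1`.
    refine ⟨min 1 (η / 6), by positivity, ?_⟩
    have h1 : 1 ≤ 2 * Real.pi * Real.exp 1 := by
      nlinarith [Real.pi_gt_three, Real.add_one_le_exp 1]
    have h2 : min 1 (η / 6) ≤ 1 := min_le_left _ _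
    have h3 : min 1 (η / 6) ≤ η / 6 := min_le_right _ _
    have h4 : 0 < min 1 (η / 6) := by positivity
    rw [div_le_iff₀ (by positivity), add_mul, div_mul_cancel₀ _ (by positivity)]
    nlinarith
  have hR := h.one_sub_pos
  have hlarge : ∀ᶠ n in atTop, √(2 * Real.pi * Real.exp 1) <
      (1 + δ) * modulus lam n ^ (1 - R) := by
    have h1 := (tendsto_modulus_rpow (lam := lam) h.lam_pos hR).const_mul √(2 * Real.pi * Real.exp 1)
    rw [mul_zero] at h1
    filter_upwards [h1.eventually (gt_mem_nhds zero_lt_one)] with n hn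
    have hx := Real.rpow_pos_of_pos (modulus_pos lam n) (1 - R)
    rw [Real.rpow_neg (modulus_pos lam n).le, ← div_eq_mul_inv, div_lt_one hx] at hn
    nlinarith
  have hsmall := eventually_mul_unitRadius_lt (lam := lam) (a := 1 - R) (by linarith [h.lam_R])
    (by linarith [h.R_pos]) (2 * (1 + δ))
  have hmemI : ∀ᶠ n in atTop ⊓ 𝓟 I, n ∈ I := mem_inf_of_right (mem_principal_self I)
  filter_upwards [h.eventually_pointBound hδ (show 0 < κ * (η / 2) by positivity),
    hlarge.filter_mono inf_le_left, hsmall.filter_mono inf_le_left,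
    (eventually_ge_atTop 4).filter_mono inf_le_left, hmemI] with n hn hb hs hn4 hnI
  set P := modulus lam n with hP
  have hP0 : 0 < P := modulus_pos lam n
  set Q := (1 + δ) * P ^ (1 - R) with hQ
  set b := √(2 * Real.pi * Real.exp 1)
  set r := Q * unitRadius n with hr
  set M := Matrix (Fin (m n)) (Fin n) (ZMod (ldaPrime lam n)) with hMdef
  have hM : (0 : ℝ) < Fintype.card M := by exact_mod_cast Fintype.card_pos
  have hn0 : 0 < n := by omega
  have hnr : (0 : ℝ) < n := by exact_mod_cast hn0
  have hQ0 : 0 < Q := by positivity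
  have ha : 0 < Real.log (1 + δ) / 2 := by
    have := Real.log_pos (show 1 < 1 + δ by linarith); linarith
  have hpm : P ^ m n = (P ^ (1 - R)) ^ n := h.modulus_pow_card hnI
  have hcardW : (Fintype.card (Fin (m n) → ZMod (ldaPrime lam n)) : ℝ) = P ^ m n := by
    simp [ZMod.card, hP, modulus]
  set N₀ := (Q - b) ^ n / (2 * n) with hN₀
  have hN₀0 : 0 < N₀ := by
    have : 0 < Q - b := by linarith
    positivity
  set Z₀ := ∑ T ∈ Finset.univ.erase ∅, P ^ T.card *
        pointBound n Q (Real.log (1 + δ) / 2) (nbrC (G n) T)ᶜ.card with hZ₀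
  have hZ₀0 : 0 ≤ Z₀ := Finset.sum_nonneg fun T _ => mul_nonneg (by positivity)
    ((Nat.cast_nonneg _).trans (card_supported_le_pointBound hn0 hQ0 ha 0 _))
  have hrep : ∀ H : M, ∃ rep : (Fin (m n) → ZMod (ldaPrime lam n)) → Fin n → ℤ,
      Function.Surjective (parityCheck (G n) H).mulVecLin →
        ∀ s, (parityCheck (G n) H).mulVecLin (reduce _ (rep s)) = s := by
    intro H
    by_cases hH : Function.Surjective (parityCheck (G n) H).mulVecLin
    · obtain ⟨rep, hrep⟩ := exists_rep hH
      exact ⟨rep, fun _ => hrep⟩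
    · exact ⟨0, fun h' => absurd h' hH⟩
  choose rep hrep using hrep
  -- Surjectivity is part of the set because `rep` is meaningful only then.
  let S : M × (Fin (m n) → ZMod (ldaPrime lam n)) → Set (Euc n) := fun a =>
    {x ∈ unitCube n | Function.Surjective (parityCheck (G n) a.1).mulVecLin ∧
      r < Metric.infDist (x + intVec (rep a.1 a.2))
        (constructionA (code (parityCheck (G n) a.1)) : Set (Euc n))}
  have hSm : ∀ a, MeasurableSet (S a) := by
    intro a
    refine (measurableSet_unitCube n).inter ?_
    by_cases hs : Function.Surjective (parityCheck (G n) a.1).mulVecLin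
    · simp only [hs, true_and]
      exact (isOpen_lt continuous_const ((Metric.continuous_infDist_pt _).comp
        (by fun_prop))).measurableSet
    · simp only [hs, false_and]
      exact MeasurableSet.const False
  have hmissed : ∀ x ∈ unitCube n, ∑ a, (S a).indicator (fun _ => (1 : ℝ)) x ≤
      Fintype.card M * (P ^ m n * (N₀⁻¹ * Z₀)) := by
    intro x _
    have hN := le_card_intPoints hn4 hb.le (-x)
    have hX : 0 < (intPoints (-x) r).card := by
      have : (0 : ℝ) < (intPoints (-x) r).card := lt_of_lt_of_le hN₀0 hN
      exact_mod_cast this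
    have h1 := sum_card_missed_le (p := ldaPrime lam n) (G n) (r := r) (by
      calc 2 * r = 2 * (1 + δ) * P ^ (1 - R) * unitRadius n := by rw [hr, hQ]; ring
        _ < _ := hs)
      (K := fun S => pointBound n Q (Real.log (1 + δ) / 2) S.card)
      (fun c S => card_supported_le_pointBound hn0 hQ0 ha c S) (-x) hX
    rw [div_le_iff₀ hM] at h1
    calc ∑ a, (S a).indicator (fun _ => (1 : ℝ)) x
        = ∑ H : M, ∑ s, (S (H, s)).indicator (fun _ => (1 : ℝ)) x := Fintype.sum_prod_type _
      _ ≤ ∑ H : M, ((Finset.univ.filter fun w => ∀ y ∈ intPoints (-x) r,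
          (parityCheck (G n) H).mulVec (reduce _ y) ≠ w).card : ℝ) := by
          refine Finset.sum_le_sum fun H _ => ?_
          rw [Finset.card_filter]
          push_cast
          refine Finset.sum_le_sum fun s _ => ?_
          rw [Set.indicator_apply]
          by_cases h2 : x ∈ S (H, s)
          · rw [if_pos h2, if_pos]
            intro y hy hys
            obtain ⟨-, hsurj, hfar⟩ := h2
            refine absurd hfar (not_lt.2 ?_)
            have hmem : intVec (rep H s - y) ∈ constructionA (code (parityCheck (G n) H)) := by
              rw [intVec_mem_constructionA, reduce_sub]
              change (parityCheck (G n) H).mulVecLin _ = 0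
              rw [map_sub, hrep H hsurj, Matrix.mulVecLin_apply, hys, sub_self]
            refine (Metric.infDist_le_dist_of_mem hmem).trans ?_
            rw [dist_eq_norm, intVec_sub]
            have := mem_intPoints.1 hy
            rwa [show x + intVec (rep H s) - (intVec (rep H s) - intVec y) = intVec y - -x by abel]
          · rw [if_neg h2]
            split_ifs <;> norm_num
      _ ≤ _ := h1
      _ ≤ _ := by
          rw [mul_comm]
          refine mul_le_mul_of_nonneg_left (mul_le_mul_of_nonneg_left ?_ (by positivity)) hM.le
          exact mul_le_mul_of_nonneg_right (inv_anti₀ hN₀0 hN) hZ₀0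
  have hvolS := sum_measureReal_le (μ := (volume : Measure (Euc n))) (measurableSet_unitCube n)
    (by rw [volume_unitCube]; exact ENNReal.one_ne_top) hSm (fun a => Set.sep_subset _ _) hmissed
  rw [measureReal_def, volume_unitCube, ENNReal.toReal_one, mul_one, Fintype.sum_prod_type] at hvolS
  -- The share of the uncovered points in the normalized second moment: `P² n` times their
  -- proportion, divided by `n * (P ^ (1 - R))²`.
  set f : M → ℝ := fun H => P ^ (2 * R) * ((P ^ m n)⁻¹ * ∑ s, volume.real (S (H, s))) with hf
  have hf0 : ∀ H, 0 ≤ f H := fun H =>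
    mul_nonneg (by positivity) (mul_nonneg (by positivity) (Finset.sum_nonneg fun _ _ => measureReal_nonneg))
  refine (frac_mono (Q := fun H => η / 2 < f H) ?_).trans ((frac_lt_le hf0 (half_pos hη)).trans ?_)
  · rintro H ⟨hsurj, hbad⟩
    have h1 := integral_voronoi_le (φ := (parityCheck (G n) H).mulVecLin) (hrep H hsurj) r
    have hvol := vol_code (H := parityCheck (G n) H) hsurj
    change _ = P ^ m n at hvol
    have hS' : ∀ s, S (H, s) = {x ∈ unitCube n | r < Metric.infDist (x + intVec (rep H s))
        (constructionA (LinearMap.ker (parityCheck (G n) H).mulVecLin) : Set (Euc n))} := by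
      intro s
      ext x
      simp [S, hsurj, code]
    simp_rw [← hS'] at h1
    change ∫ y in voronoi (constructionA (code (parityCheck (G n) H))), ‖y‖ ^ 2 ≤ _ at h1
    rw [hcardW] at h1
    change _ ≤ P ^ m n * r ^ 2 + P ^ 2 * n * _ at h1
    have hx := Real.rpow_pos_of_pos hP0 (1 - R)
    have e1 : (P ^ m n) ^ (1 + 2 / (n : ℝ)) = P ^ m n * (P ^ (1 - R)) ^ 2 := by
      rw [Real.rpow_add (by positivity), Real.rpow_one, hpm, ← Real.rpow_natCast (P ^ (1 - R)) n,
        ← Real.rpow_mul hx.le]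
      have : (n : ℝ) * (2 / n) = 2 := by field_simp
      rw [this, Real.rpow_two]
    have e2 : P ^ (2 * R) * (P ^ (1 - R)) ^ 2 = P ^ 2 := by
      rw [← Real.rpow_natCast (P ^ (1 - R)), ← Real.rpow_mul hP0.le, ← Real.rpow_add hP0,
        ← Real.rpow_natCast]
      congr 1; push_cast; ring
    have e3 : r ^ 2 = (1 + δ) ^ 2 / (2 * Real.pi * Real.exp 1) * n * (P ^ (1 - R)) ^ 2 := by
      rw [hr, hQ, mul_pow, unitRadius_sq]; ring
    rw [normalizedSecondMoment, hvol, e1, div_mul_eq_mul_div, one_mul,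
      lt_div_iff₀ (by positivity)] at hbad
    by_contra hcon
    rw [not_lt] at hcon
    have hpm0 : 0 < P ^ m n := by positivity
    have h2 : ∑ s, volume.real (S (H, s)) = (P ^ m n) * ((P ^ m n)⁻¹ * ∑ s, volume.real (S (H, s))) := by
      rw [mul_inv_cancel_left₀ hpm0.ne']
    rw [h2, e3, ← e2] at h1
    have h3 : ∫ y in voronoi (constructionA (code (parityCheck (G n) H))), ‖y‖ ^ 2 ≤
        n * (P ^ m n * (P ^ (1 - R)) ^ 2) * ((1 + δ) ^ 2 / (2 * Real.pi * Real.exp 1) + f H) := by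
      refine h1.trans_eq ?_
      rw [hf]; ring
    have h4 : (1 + δ) ^ 2 / (2 * Real.pi * Real.exp 1) + f H ≤
        1 / (2 * Real.pi * Real.exp 1) + η := by linarith
    have h5 := mul_le_mul_of_nonneg_left h4
      (show 0 ≤ n * (P ^ m n * (P ^ (1 - R)) ^ 2) by positivity)
    linarith
  · rw [div_le_iff₀ (half_pos hη), div_le_iff₀ hM]
    calc ∑ H, f H = P ^ (2 * R) * ((P ^ m n)⁻¹ * ∑ H : M, ∑ s, volume.real (S (H, s))) := by
          rw [hf, ← Finset.mul_sum, ← Finset.mul_sum]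
      _ ≤ P ^ (2 * R) * ((P ^ m n)⁻¹ * (Fintype.card M * (P ^ m n * (N₀⁻¹ * Z₀)))) := by
          gcongr
      _ = P ^ (2 * R) * (N₀⁻¹ * Z₀) * Fintype.card M := by field_simp
      _ ≤ _ := mul_le_mul_of_nonneg_right hn hM.le

end Admissible

/-! ### Combination of the bad events and diagonalization -/

namespace Admissible

variable {R α A β B ε ϑ lam : ℝ} {I : Set ℕ} {m : ℕ → ℕ} {G : ∀ n, Finset (Fin n × Fin (m n))}
  (h : Admissible R α A β B ε ϑ lam I m G)

include h

/-- A random lattice of the ensemble is good with high probability. -/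
theorem eventually_frac_not_isGoodLattice (z : ∀ n, ProbabilityMeasure (Euc n)) {η κ : ℝ}
    (hη : 0 < η) (hη1 : η < 1) (hκ : 0 < κ) : ∀ᶠ n in atTop ⊓ 𝓟 I,
    frac (fun H : Matrix (Fin (m n)) (Fin n) (ZMod (ldaPrime lam n)) =>
      ¬ IsGoodLattice (modulus lam n ^ (1 - R)) η (z n)
        (constructionA (code (parityCheck (G n) H)))) ≤ κ := by
  have hc : 0 < 1 - η := by linarith
  have hc1 : 1 - η < 1 := by linarith
  have hκ5 : 0 < κ / 5 := by linarith
  have hmemI : ∀ᶠ n in atTop ⊓ 𝓟 I, n ∈ I := mem_inf_of_right (mem_principal_self I)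
  filter_upwards [h.eventually_frac_not_surjective hκ5, h.eventually_frac_codeword hc hc1 hκ5,
    h.eventually_frac_dual hc hc1 hκ5, h.eventually_frac_error z hc hc1 hη hκ5,
    h.eventually_frac_moment hη hκ5, hmemI] with n h1 h2 h3 h4 h5 hnI
  have hP := modulus_pos lam n
  have hx := Real.rpow_pos_of_pos hP (1 - R)
  have hu : 0 ≤ unitRadius n := Real.sqrt_nonneg _
  have h2 := h2 0 (by rw [norm_zero]; positivity)
  refine (frac_mono (Q := fun H =>
    (¬ Function.Surjective (parityCheck (G n) H).mulVecLin) ∨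
    (∃ y ∈ constructionA (code (parityCheck (G n) H)), y ≠ 0 ∧
          ‖y - 0‖ ≤ (1 - η) * modulus lam n ^ (1 - R) * unitRadius n) ∨
    (∃ y ∈ constructionA (rowSpace (parityCheck (G n) H)), y ≠ 0 ∧
          ‖y‖ ≤ (1 - η) * modulus lam n ^ R * unitRadius n) ∨
    (η < (z n : Measure (Euc n)).real (Metric.closedBall 0
          ((1 - η) * modulus lam n ^ (1 - R) * unitRadius n) ∩
            (strictVoronoi (constructionA (code (parityCheck (G n) H))))ᶜ)) ∨
    (Function.Surjective (parityCheck (G n) H).mulVecLin ∧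
        1 / (2 * Real.pi * Real.exp 1) + η <
          normalizedSecondMoment (constructionA (code (parityCheck (G n) H))))) ?_).trans ?_
  · intro H hH
    by_contra hcon
    push Not at hcon
    obtain ⟨k1, k2, k3, k4, k5⟩ := hcon
    refine hH ⟨?_, ⟨_, voronoi_constructionA_subset⟩, fun y hy hy0 => ?_, ?_,
      ⟨_, voronoi_dualLattice_subset⟩, fun y hy hy0 => ?_, ?_, k5 k1⟩
    · rw [← h.modulus_pow_card hnI]
      exact vol_code k1
    · have := k2 y hy hy0
      rw [sub_zero, mul_assoc] at this
      exact this.le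
    · rw [inv_pow, ← h.modulus_pow_card hnI]
      exact vol_dualLattice k1
    · have := k3 _ (mem_dualLattice_constructionA.1 hy) (smul_ne_zero (by
        exact_mod_cast (ldaPrime_prime lam n).ne_zero) hy0)
      rw [norm_smul, Real.norm_eq_abs] at this
      change _ < |modulus lam n| * ‖y‖ at this
      rw [abs_of_pos hP] at this
      have e1 : (modulus lam n ^ (1 - R))⁻¹ = modulus lam n ^ R * (modulus lam n)⁻¹ := by
        rw [← Real.rpow_neg hP.le, ← Real.rpow_neg_one, ← Real.rpow_add hP]; ring_nf
      rw [e1]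
      calc (1 - η) * (modulus lam n ^ R * (modulus lam n)⁻¹ * unitRadius n)
          = (1 - η) * modulus lam n ^ R * unitRadius n / modulus lam n := by
            rw [div_eq_mul_inv]; ring
        _ ≤ ‖y‖ := by rw [div_le_iff₀ hP, mul_comm ‖y‖]; exact this.le
    · rw [← mul_assoc]; exact k4
  · refine ((frac_or_le _ _).trans (add_le_add h1 ((frac_or_le _ _).trans (add_le_add h2
      ((frac_or_le _ _).trans (add_le_add h3 ((frac_or_le _ _).trans
        (add_le_add h4 h5)))))))).trans ?_
    linarith

/-- Diagonalization: there are sets of lattices of probability tending to `1` whose members are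
better and better. -/
theorem exists_sets (z : ∀ n, ProbabilityMeasure (Euc n)) :
    ∃ 𝒜 : ∀ n, Set (Submodule ℤ (Euc n)),
      Tendsto (fun n => (ldaEnsemble lam (G n)).toOuterMeasure (𝒜 n)) (atTop ⊓ 𝓟 I) (𝓝 1) ∧
      ∀ η : ℝ, 0 < η → ∀ᶠ n in atTop ⊓ 𝓟 I, ∀ L ∈ 𝒜 n,
        IsGoodLattice (modulus lam n ^ (1 - R)) η (z n) L := by
  classical
  -- The shift by 2 keeps every `η k` below 1, so the factors `1 - η k` are positive.
  let η : ℕ → ℝ := fun k => 1 / ((k : ℝ) + 2)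
  have hη0 : ∀ k, 0 < η k := fun k => by positivity
  have hη1 : ∀ k, η k < 1 := fun k => by
    have : (0 : ℝ) ≤ k := Nat.cast_nonneg k
    simp only [η]
    rw [div_lt_one (by positivity)]; linarith
  have hηanti : Antitone η := fun k l hkl => by
    simp only [η]
    gcongr
  have hηlim : Tendsto η atTop (𝓝 0) := by
    have := (tendsto_one_div_add_atTop_nhds_zero_nat (𝕜 := ℝ)).comp (tendsto_add_atTop_nat 1)
    refine this.congr fun k => ?_
    simp only [η, Function.comp]
    push_cast
    ring_nf
  let q : ℕ → ℕ → ℝ := fun k n =>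
    frac (fun H : Matrix (Fin (m n)) (Fin n) (ZMod (ldaPrime lam n)) =>
      ¬ IsGoodLattice (modulus lam n ^ (1 - R)) (η k) (z n)
        (constructionA (code (parityCheck (G n) H))))
  -- The finest tolerance of index at most `n` whose failure probability is already below the
  -- tolerance itself.
  let ν : ℕ → ℕ := fun n => Nat.findGreatest (fun k => q k n ≤ η k) n
  have hq : ∀ k, ∀ᶠ n in atTop ⊓ 𝓟 I, q k n ≤ η k := fun k =>
    h.eventually_frac_not_isGoodLattice z (hη0 k) (hη1 k) (hη0 k)
  have hν : ∀ k, ∀ᶠ n in atTop ⊓ 𝓟 I, k ≤ ν n := fun k => by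
    filter_upwards [hq k, (eventually_ge_atTop k).filter_mono inf_le_left] with n hn hk
    exact Nat.le_findGreatest hk hn
  -- `Nat.findGreatest` also returns 0 when no index qualifies, so the bound is claimed only where
  -- index 0 qualifies.
  have hqν : ∀ᶠ n in atTop ⊓ 𝓟 I, q (ν n) n ≤ η (ν n) := by
    filter_upwards [hq 0] with n hn
    exact Nat.findGreatest_spec (P := fun k => q k n ≤ η k) (Nat.zero_le n) hn
  have hνlim : Tendsto ν (atTop ⊓ 𝓟 I) atTop := tendsto_atTop.2 hν
  refine ⟨fun n => {L | IsGoodLattice (modulus lam n ^ (1 - R)) (η (ν n)) (z n) L}, ?_, ?_⟩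
  · have hprob : ∀ n, (ldaEnsemble lam (G n)).toOuterMeasure
        {L | IsGoodLattice (modulus lam n ^ (1 - R)) (η (ν n)) (z n) L} =
        ENNReal.ofReal (1 - q (ν n) n) := by
      intro n
      have h1 := frac_not_add fun H : Matrix (Fin (m n)) (Fin n) (ZMod (ldaPrime lam n)) =>
        IsGoodLattice (modulus lam n ^ (1 - R)) (η (ν n)) (z n)
          (constructionA (code (parityCheck (G n) H)))
      have h2 : 1 - q (ν n) n = frac fun H : Matrix (Fin (m n)) (Fin n) (ZMod (ldaPrime lam n)) =>
        IsGoodLattice (modulus lam n ^ (1 - R)) (η (ν n)) (z n)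
          (constructionA (code (parityCheck (G n) H))) := by
        simp only [q]; linarith
      rw [h2, ldaEnsemble, PMF.toOuterMeasure_map_apply, PMF.toOuterMeasure_uniformOfFintype_apply,
        frac, ENNReal.ofReal_div_of_pos (by exact_mod_cast Fintype.card_pos),
        ENNReal.ofReal_natCast, ENNReal.ofReal_natCast]
      congr 2
      · rw [Fintype.card_subtype]
        congr!
    simp_rw [hprob]
    have h3 : Tendsto (fun n => 1 - q (ν n) n) (atTop ⊓ 𝓟 I) (𝓝 1) := by
      have h4 : Tendsto (fun n => q (ν n) n) (atTop ⊓ 𝓟 I) (𝓝 0) :=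
        squeeze_zero' (Eventually.of_forall fun n => frac_nonneg _) hqν (hηlim.comp hνlim)
      simpa using h4.const_sub 1
    simpa using ENNReal.tendsto_ofReal h3
  · intro δ hδ
    obtain ⟨k, hk⟩ := (hηlim.eventually (ge_mem_nhds hδ)).exists
    filter_upwards [hν k] with n hn L hL
    exact hL.mono (Real.rpow_nonneg (modulus_pos lam n).le _) ((hηanti hn).trans hk)

end Admissible

/-! ### Goodness of sequences -/

/-- The polynomial loss in the ball volume lets the effective radius exceed `X n * unitRadius n` by
at most the factor `(2 * n) ^ (1 / n)`, which tends to 1. -/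
theorem goodForPacking_of_minDist {F : Filter ℕ} (hF : F ≤ atTop) {L : ∀ n, Submodule ℤ (Euc n)}
    {X : ℕ → ℝ} (hX : ∀ n, 0 < X n) (hvol : ∀ᶠ n in F, vol (L n) = X n ^ n)
    (hbdd : ∀ᶠ n in F, ∃ K, voronoi (L n) ⊆ Metric.closedBall 0 K)
    (hdist : ∀ η : ℝ, 0 < η → ∀ᶠ n in F, ∀ y ∈ L n, y ≠ 0 →
      (1 - η) * (X n * unitRadius n) ≤ ‖y‖) : GoodForPacking F L := by
  intro η hη
  have hroot : Tendsto (fun n : ℕ => (2 * (n : ℝ)) ^ (1 / (n : ℝ))) atTop (𝓝 1) := by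
    have h1 := (tendsto_rpow_div_mul_add 1 1 0 zero_ne_one).comp
      (tendsto_natCast_atTop_atTop (R := ℝ))
    have h2 : Tendsto (fun n : ℕ => (2 : ℝ) ^ (1 / (n : ℝ))) atTop (𝓝 1) := by
      have h3 : Tendsto (fun n : ℕ => 1 / (n : ℝ)) atTop (𝓝 0) := tendsto_one_div_atTop_nhds_zero_nat
      have h4 := (Real.continuousAt_const_rpow (a := 2) (b := 0) two_ne_zero).tendsto.comp h3
      simpa [Function.comp_def] using h4
    have h5 := h2.mul h1
    rw [mul_one] at h5
    refine h5.congr fun n => ?_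
    rw [Real.mul_rpow (by norm_num) (Nat.cast_nonneg n)]
    simp [Function.comp]
  -- Truncation keeps `1 / 2 - η'` nonnegative, so that inequalities can be multiplied by it.
  set η' := min η (1 / 2) with hη'
  have hη'0 : 0 < η' := by positivity
  have hη'1 : η' ≤ 1 / 2 := min_le_right _ _
  have hη'2 : η' ≤ η := min_le_left _ _
  have hlim : ∀ᶠ n : ℕ in atTop, (1 - 2 * η') * (2 * (n : ℝ)) ^ (1 / (n : ℝ)) < 1 - η' := by
    have := hroot.const_mul (1 - 2 * η')
    exact this.eventually (gt_mem_nhds (by linarith))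
  filter_upwards [hvol, hbdd, hdist η' hη'0, hlim.filter_mono hF,
    (eventually_ge_atTop 4).filter_mono hF] with n hv ⟨K, hK⟩ hd hl hn4
  have hn0 : 0 < n := by omega
  have hnr : (0 : ℝ) < n := by exact_mod_cast hn0
  have hXn := hX n
  have hu := unitRadius_pos hn0
  have hpack := le_packingRadius hn0 hK hd
  have hball := le_volume_closedBall hn4 (0 : Euc n) zero_le_one
  have hpi := Real.pi_pos
  have e1 : 1 * √(2 * Real.pi * Real.exp 1 / n) = (unitRadius n)⁻¹ := by
    rw [one_mul, unitRadius, ← Real.sqrt_inv, inv_div]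
  rw [e1] at hball
  set V := volume.real (Metric.closedBall (0 : Euc n) 1) with hV
  have hV0 : 0 < V := lt_of_lt_of_le (by positivity) hball
  have hreff : effectiveRadius (L n) ≤ X n * unitRadius n * (2 * (n : ℝ)) ^ (1 / (n : ℝ)) := by
    have h1 : vol (L n) / V ≤ (X n * unitRadius n) ^ n * (2 * n) := by
      rw [hv, div_le_iff₀ hV0]
      rw [div_le_iff₀ (by positivity), inv_pow] at hball
      calc X n ^ n = (X n * unitRadius n) ^ n * (unitRadius n ^ n)⁻¹ := by
            rw [mul_pow, mul_inv_cancel_right₀ (by positivity)]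
        _ ≤ (X n * unitRadius n) ^ n * (V * (2 * n)) := by gcongr
        _ = _ := by ring
    have h2 : ((X n * unitRadius n) ^ n) ^ (1 / (n : ℝ)) = X n * unitRadius n := by
      rw [one_div, Real.pow_rpow_inv_natCast (by positivity) hn0.ne']
    calc effectiveRadius (L n) ≤ ((X n * unitRadius n) ^ n * (2 * n)) ^ (1 / (n : ℝ)) := by
          rw [effectiveRadius]
          refine Real.rpow_le_rpow ?_ h1 (by positivity)
          rw [hv]; positivity
      _ = _ := by rw [Real.mul_rpow (by positivity) (by positivity), h2]
  have hreff0 : 0 < effectiveRadius (L n) := by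
    rw [effectiveRadius, hv]
    exact Real.rpow_pos_of_pos (by positivity) _
  rw [le_div_iff₀ hreff0]
  calc (1 / 2 - η) * effectiveRadius (L n) ≤ (1 / 2 - η') * effectiveRadius (L n) := by gcongr
    _ ≤ (1 / 2 - η') * (X n * unitRadius n * (2 * (n : ℝ)) ^ (1 / (n : ℝ))) := by
        refine mul_le_mul_of_nonneg_left hreff (by linarith)
    _ = (X n * unitRadius n) * ((1 - 2 * η') * (2 * (n : ℝ)) ^ (1 / (n : ℝ))) / 2 := by ring
    _ ≤ (X n * unitRadius n) * (1 - η') / 2 := by gcongr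
    _ = (1 - η') * (X n * unitRadius n) / 2 := by ring
    _ ≤ packingRadius (L n) := hpack

section Sequences

variable {F : Filter ℕ} {L : ∀ n, Submodule ℤ (Euc n)} {X : ℕ → ℝ}
  {z : ∀ n, ProbabilityMeasure (Euc n)}

theorem goodForMSE_of_isGoodLattice (hF : F ≤ atTop) (hX : ∀ n, 0 < X n)
    (hL : ∀ η : ℝ, 0 < η → ∀ᶠ n in F, IsGoodLattice (X n) η (z n) (L n)) : GoodForMSE F L := by
  rw [GoodForMSE, tendsto_order]
  have hlow : ∀ᶠ n in F, 1 / (2 * Real.pi * Real.exp 1) ≤ normalizedSecondMoment (L n) := by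
    filter_upwards [hL 1 one_pos, (eventually_gt_atTop 0).filter_mono hF] with n hn hn0
    obtain ⟨K, hK⟩ := hn.bounded
    refine le_normalizedSecondMoment hn0 hK ?_
    rw [hn.vol_eq]
    exact pow_pos (hX n) n
  refine ⟨fun a ha => hlow.mono fun n hn => ha.trans_le hn, fun a ha => ?_⟩
  filter_upwards [hL ((a - 1 / (2 * Real.pi * Real.exp 1)) / 2) (by linarith)] with n hn
  have := hn.moment
  linarith

/-- Noise of constant variance has norm `O(√n)` with high probability, whereas half the minimum
distance is of order `X n * √n` with `X n` tending to infinity. -/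
theorem goodForCoding_of_isGoodLattice (hXlim : Tendsto X F atTop)
    (hL : ∀ η : ℝ, 0 < η → ∀ᶠ n in F, IsGoodLattice (X n) η (z n) (L n))
    (hF : F ≤ atTop) : GoodForCoding F L := by
  intro w σsq hw _
  have hpi := Real.pi_pos
  -- The absolute value avoids a discussion of the sign of `σsq`.
  set D := √(4 * Real.pi * Real.exp 1 * |σsq|) with hD
  have hw1 := hw.ergodic 1 one_pos
  refine tendsto_of_tendsto_of_tendsto_of_le_of_le' tendsto_const_nhds hw1
    (Eventually.of_forall fun _ => bot_le) ?_
  filter_upwards [hL (1 / 2) (by norm_num), hXlim.eventually (eventually_gt_atTop (4 * D)),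
    (eventually_gt_atTop 0).filter_mono hF] with n hn hXn hn0
  refine measure_mono (Set.compl_subset_compl.2 ?_)
  refine (Metric.closedBall_subset_ball ?_).trans (ball_subset_strictVoronoi hn.minDist)
  have hu := unitRadius_pos hn0
  calc √((1 + 1) * n * σsq) ≤ √(4 * Real.pi * Real.exp 1 * |σsq| *
        (n / (2 * Real.pi * Real.exp 1))) := by
        apply Real.sqrt_le_sqrt
        have : 4 * Real.pi * Real.exp 1 * |σsq| * (n / (2 * Real.pi * Real.exp 1)) =
            2 * n * |σsq| := by field_simp; ring
        rw [this]
        have h1 := le_abs_self σsq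
        have h2 : (0 : ℝ) ≤ 2 * n := by positivity
        nlinarith
    _ = D * unitRadius n := by rw [Real.sqrt_mul (by positivity)]; rfl
    _ < (1 - 1 / 2) * (X n * unitRadius n) / 2 := by nlinarith

/-- Half of the margin `η₀` absorbs the fluctuations of the norm of the noise, the other half the
factor `1 - η` in the radius. Inside the resulting ball the `error` field applies. -/
theorem goodForCodingAgainst_of_isGoodLattice {v : ℕ → ℝ} (hz : SemiNormErgodic F z v)
    (hF : F ≤ atTop) (hX : ∀ n, 0 < X n)
    (hL : ∀ η : ℝ, 0 < η → ∀ᶠ n in F, IsGoodLattice (X n) η (z n) (L n)) :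
    GoodForCodingAgainst F z v L := by
  rintro ⟨η₀, hη₀, hvol⟩
  have hpi := Real.pi_pos
  obtain ⟨η₁, hη₁0, hη₁1, hη₁⟩ : ∃ η₁ : ℝ, 0 < η₁ ∧ η₁ < 1 ∧
      (1 + η₀ / 2) ≤ (1 - η₁) ^ 2 * (1 + η₀) := by
    have hpos : 0 < 4 * (1 + η₀) := by linarith
    -- Chosen so that `2 * η₁ * (1 + η₀) = η₀ / 2`, the part of the margin given up.
    refine ⟨η₀ / (4 * (1 + η₀)), by positivity, by rw [div_lt_one hpos]; linarith, ?_⟩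
    have h1 : η₀ / (4 * (1 + η₀)) * (1 + η₀) = η₀ / 4 := by field_simp
    nlinarith [mul_nonneg (sq_nonneg (η₀ / (4 * (1 + η₀)))) (show 0 ≤ 1 + η₀ by linarith)]
  rw [ErrorVanishes, ENNReal.tendsto_nhds_zero]
  intro κ hκ
  obtain ⟨κ', hκ'0, hκ'⟩ : ∃ κ' : ℝ, 0 < κ' ∧ 2 * ENNReal.ofReal κ' ≤ κ := by
    obtain ⟨r, hr0, hr⟩ := ENNReal.lt_iff_exists_real_btwn.1 hκ
    refine ⟨r / 2, ?_, ?_⟩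
    · have := ENNReal.ofReal_pos.1 hr.1
      linarith
    · rw [two_mul, ← ENNReal.ofReal_add (by linarith) (by linarith), add_halves]
      exact hr.2.le
  set η := min η₁ κ' with hη
  have hη0 : 0 < η := lt_min hη₁0 hκ'0
  have herg := hz.ergodic (η₀ / 2) (by linarith)
  rw [ENNReal.tendsto_nhds_zero] at herg
  filter_upwards [hL η hη0, hvol, herg (ENNReal.ofReal κ') (ENNReal.ofReal_pos.2 hκ'0),
    (eventually_gt_atTop 0).filter_mono hF] with n hn hv he hn0
  have hnr : (0 : ℝ) < n := by exact_mod_cast hn0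
  have hXn := hX n
  have hu := unitRadius_pos hn0
  have hvol2 : vol (L n) ^ (2 / (n : ℝ)) = X n ^ 2 := by
    rw [hn.vol_eq, ← Real.rpow_natCast, ← Real.rpow_mul hXn.le]
    have : (n : ℝ) * (2 / n) = 2 := by field_simp
    rw [this, Real.rpow_two]
  rw [hvol2] at hv
  have hrad : √((1 + η₀ / 2) * n * v n) ≤ (1 - η) * (X n * unitRadius n) := by
    have hη1 : η ≤ η₁ := min_le_left _ _
    refine le_trans (Real.sqrt_le_iff.2 ⟨?_, ?_⟩) (mul_le_mul_of_nonneg_right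
      (show 1 - η₁ ≤ 1 - η by linarith) (by positivity))
    · exact mul_nonneg (by linarith) (by positivity)
    · rw [mul_pow, mul_pow, unitRadius_sq]
      have h1 : v n ≤ X n ^ 2 / ((1 + η₀) * (2 * Real.pi * Real.exp 1)) := by
        rw [le_div_iff₀ (by positivity)]
        linarith
      calc (1 + η₀ / 2) * n * v n
          ≤ (1 + η₀ / 2) * n * (X n ^ 2 / ((1 + η₀) * (2 * Real.pi * Real.exp 1))) := by gcongr
        _ ≤ ((1 - η₁) ^ 2 * (1 + η₀)) * n * (X n ^ 2 / ((1 + η₀) * (2 * Real.pi * Real.exp 1))) := by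
            gcongr
        _ = _ := by field_simp
  have herr : (z n : Measure (Euc n)) (Metric.closedBall 0 ((1 - η) * (X n * unitRadius n)) ∩
      (strictVoronoi (L n))ᶜ) ≤ ENNReal.ofReal κ' := by
    rw [← ENNReal.ofReal_toReal (measure_ne_top (z n : Measure (Euc n)) _)]
    exact ENNReal.ofReal_le_ofReal (hn.error.trans (min_le_right _ _))
  calc (z n : Measure (Euc n)) (strictVoronoi (L n))ᶜ
      ≤ (z n : Measure (Euc n)) ((Metric.closedBall 0 √((1 + η₀ / 2) * n * v n))ᶜ ∪
          (Metric.closedBall 0 ((1 - η) * (X n * unitRadius n)) ∩ (strictVoronoi (L n))ᶜ)) := by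
        refine measure_mono fun x hx => ?_
        by_cases hxb : x ∈ Metric.closedBall 0 √((1 + η₀ / 2) * n * v n)
        · exact Or.inr ⟨Metric.closedBall_subset_closedBall hrad hxb, hx⟩
        · exact Or.inl hxb
    _ ≤ ENNReal.ofReal κ' + ENNReal.ofReal κ' := (measure_union_le _ _).trans (add_le_add he herr)
    _ ≤ κ := by rwa [← two_mul]

end Sequences

end LDA

/-! ### The main theorem -/

theorem mainTheorem1
    (ΔV ΔC : ℕ) (hΔV : 0 < ΔV) (hΔ : ΔV < ΔC)
    (R : ℝ) (hR : R = 1 - (ΔV : ℝ) / ΔC)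
    (α A β B ε ϑ lam : ℝ)
    (hα : 1 ≤ α) (hαA : α < A)
    (hβ : 1 / (1 - R) < β) (hβ' : β < min (2 / (1 - R)) B)
    (hA : 2 * (1 + R) < A) (hB : 2 * (1 + R) / (1 - R) < B)
    (hε : ε = (1 - R) / (A + 1 - R)) (hϑ : ϑ = 1 / (B * (1 - R) + 1))
    (hdeg : LDA.degreeBound R α A β B ε ϑ < ΔV)
    (hlam : LDA.lamBound R α A B < lam)
    (I : Set ℕ) (hI : I.Infinite)
    (m : ℕ → ℕ) (hm : ∀ n ∈ I, m n * ΔC = n * ΔV)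
    (G : ∀ n, Finset (Fin n × Fin (m n)))
    (hreg : ∀ n ∈ I, LDA.IsBiregular (G n) ΔV ΔC)
    (hgood : ∀ n ∈ I, LDA.IsGoodGraph R α A β B ε ϑ (G n))
    (z : ∀ n, ProbabilityMeasure (LDA.Euc n)) (v : ℕ → ℝ)
    (hz : LDA.SemiNormErgodic (atTop ⊓ 𝓟 I) z v) :
    ∃ 𝒜 : ∀ n, Set (Submodule ℤ (LDA.Euc n)),
      Tendsto (fun n => (LDA.ldaEnsemble lam (G n)).toOuterMeasure (𝒜 n))
        (atTop ⊓ 𝓟 I) (𝓝 1) ∧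
      ∀ L : ∀ n, Submodule ℤ (LDA.Euc n), (∀ᶠ n in atTop ⊓ 𝓟 I, L n ∈ 𝒜 n) →
        LDA.GoodForPacking (atTop ⊓ 𝓟 I) L ∧
        LDA.GoodForCoding (atTop ⊓ 𝓟 I) L ∧
        LDA.GoodForCodingAgainst (atTop ⊓ 𝓟 I) z v L ∧
        LDA.GoodForMSE (atTop ⊓ 𝓟 I) L ∧
        LDA.GoodForPacking (atTop ⊓ 𝓟 I) (fun n => LDA.dualLattice (L n)) := by
  have hV0 : (0 : ℝ) < ΔV := by exact_mod_cast hΔV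
  have hVC : (ΔV : ℝ) < ΔC := by exact_mod_cast hΔ
  have hC0 : (0 : ℝ) < ΔC := by linarith
  have h1R : 1 - R = ΔV / ΔC := by rw [hR]; ring
  have hR1 : 0 < 1 - R := by rw [h1R]; positivity
  have hR0 : 0 < R := by
    have : (ΔV : ℝ) / ΔC < 1 := by rwa [div_lt_one hC0]
    linarith
  have hBR : 2 * (1 + R) < B * (1 - R) := by rwa [div_lt_iff₀ hR1] at hB
  simp only [LDA.lamBound, max_lt_iff] at hlam
  obtain ⟨l1, l2, l3, l4, -, -, l7⟩ := hlam
  -- The denominators are positive by the bounds on `R`, `A` and `B`.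
  rw [div_lt_iff₀ (by linarith)] at l1 l2 l3 l4 l7
  have hadm : LDA.Admissible R α A β B ε ϑ lam I m G :=
    { R_pos := hR0
      R_lt := by linarith
      one_le_α := hα
      lt_β := hβ
      lt_A := hA
      lt_B := hBR
      ε_pos := by rw [hε]; exact div_pos hR1 (by linarith)
      ϑ_pos := by rw [hϑ]; exact div_pos one_pos (by linarith)
      lam_R := l1
      lam_one_sub := l2
      lam_A := l3
      lam_B := l4
      lam_B' := l7
      card_eq := fun n hn => by
        have : (m n : ℝ) * ΔC = n * ΔV := by exact_mod_cast hm n hn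
        rw [h1R]
        field_simp
        exact this
      le_nbrC := fun n hn T => by
        have : (T.card : ℝ) * ΔC ≤ (LDA.nbrC (G n) T).card * ΔV := by
          exact_mod_cast (hreg n hn).mul_card_le T
        rw [h1R, one_div_div, div_mul_eq_mul_div, div_le_iff₀ hV0]
        linarith
      good := hgood }
  obtain ⟨𝒜, h𝒜, hgoodL⟩ := hadm.exists_sets z
  refine ⟨𝒜, h𝒜, fun L hL => ?_⟩
  have hF : atTop ⊓ 𝓟 I ≤ (atTop : Filter ℕ) := inf_le_left
  have hX : ∀ n, 0 < LDA.modulus lam n ^ (1 - R) := fun n =>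
    Real.rpow_pos_of_pos (LDA.modulus_pos lam n) _
  have hXlim : Tendsto (fun n => LDA.modulus lam n ^ (1 - R)) (atTop ⊓ 𝓟 I) atTop := by
    have h1 := (LDA.tendsto_modulus_rpow hadm.lam_pos hR1).mono_left hF
    have h2 := (tendsto_nhdsWithin_iff.2 ⟨h1, Eventually.of_forall fun n =>
      Set.mem_Ioi.2 (Real.rpow_pos_of_pos (LDA.modulus_pos lam n) (-(1 - R)))⟩).inv_tendsto_nhdsGT_zero
    refine h2.congr fun n => ?_
    rw [Pi.inv_apply, Real.rpow_neg (LDA.modulus_pos lam n).le, inv_inv]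
  have hLη : ∀ η : ℝ, 0 < η → ∀ᶠ n in atTop ⊓ 𝓟 I,
      LDA.IsGoodLattice (LDA.modulus lam n ^ (1 - R)) η (z n) (L n) := fun η hη => by
    filter_upwards [hgoodL η hη, hL] with n h1 h2 using h1 _ h2
  refine ⟨?_, ?_, ?_, ?_, ?_⟩
  · exact LDA.goodForPacking_of_minDist hF hX ((hLη 1 one_pos).mono fun n hn => hn.vol_eq)
      ((hLη 1 one_pos).mono fun n hn => hn.bounded)
      fun η hη => (hLη η hη).mono fun n hn => hn.minDist
  · exact LDA.goodForCoding_of_isGoodLattice hXlim hLη hF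
  · exact LDA.goodForCodingAgainst_of_isGoodLattice hz hF hX hLη
  · exact LDA.goodForMSE_of_isGoodLattice hF hX hLη
  · exact LDA.goodForPacking_of_minDist hF (fun n => inv_pos.2 (hX n))
      ((hLη 1 one_pos).mono fun n hn => hn.vol_dual)
      ((hLη 1 one_pos).mono fun n hn => hn.bounded_dual)
      fun η hη => (hLη η hη).mono fun n hn => hn.minDist_dual
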